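/- Conventions. A \emph{closed curve} in $\mathbb R^2$ is the image of an injective continuous map from the circle; a \emph{union of closed curves} is a union of finitely many pairwise disjoint closed curves. Let $\mathcal C\subset\mathbb R^2$ be a union of closed curves. Its \emph{medial axis} $\mathcal M$ is the set of points of $\mathbb R^2$ that do not have a unique closest point in $\mathcal C$, and for $p\in\mathcal C$ the \emph{local feature size} is $\mathrm{lfs}(p)=d(p,\mathcal M)$, where $d(p,X)=\inf_{y\in X}d(p,y)\in[0,\infty]$ and $d(x,y)$ is the Euclidean distance. For $\epsilon>0$, a set $\mathcal S\subset\mathcal C$ is an \emph{$\epsilon$-sample} of $\mathcal C$ if $d(p,\mathcal S)<\epsilon\,\mathrm{lfs}(p)$ for all $p\in\mathcal C$. For a finite set $\mathcal S\subset\mathcal C$, the graph $G_{\mathcal C}(\mathcal S)$ has vertex set $\mathcal S$, and distinct $a,b\in\mathcal S$ are joined by an edge if and only if they are consecutive on $\mathcal C$: they lie on the same connected component of $\mathcal C$, and for one of the two orientations of that component, $b$ is the first element of $\mathcal S$ that one encounters after leaving $a$ along the component. Theorem. There are a finite set $\mathcal S\subset\mathbb R^2$ and sets $\mathcal C_1,\mathcal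 C_2,\mathcal C_3,\mathcal C_4\subset\mathbb R^2$ such that $\mathcal S$ is a $0.72$-sample of each $\mathcal C_i$, $\mathcal C_1$ and $\mathcal C_2$ are (connected) closed curves, $\mathcal C_3$ and $\mathcal C_4$ are disconnected unions of closed curves, and $G_{\mathcal C_i}(\mathcal S)\neq G_{\mathcal C_j}(\mathcal S)$ for all $i\neq j$. Consequently, reconstruction from $0.72$-samples is not always possible, even for connected curves: there is no map $R$ that assigns to every set $\mathcal S\subset\mathbb R^2$ a graph $R(\mathcal S)$ on $\mathcal S$ such that $R(\mathcal S)=G_{\mathcal C}(\mathcal S)$ for every closed curve $\mathcal C\subset\mathbb R^2$ and every finite $0.72$-sample $\mathcal S$ of $\mathcal C$. -/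

import Mathlib

namespace CurveReconstruction

variable {d : ℕ}

/-- `γ` is a parametrization of the set `K` as a closed curve: an injective continuous map from the
circle to Euclidean `d`-space with image `K`. -/
def IsParametrization (γ : Circle → EuclideanSpace ℝ (Fin d))
    (K : Set (EuclideanSpace ℝ (Fin d))) : Prop :=
  Continuous γ ∧ Function.Injective γ ∧ Set.range γ = K

/-- A closed curve is the image of an injective continuous map from the circle. -/
def IsClosedCurve (K : Set (EuclideanSpace ℝ (Fin d))) : Prop :=
  ∃ γ : Circle → EuclideanSpace ℝ (Fin d), IsParametrization γ K

/-- A finite union of pairwise disjoint closed curves. -/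
def IsUnionOfClosedCurves (C : Set (EuclideanSpace ℝ (Fin d))) : Prop :=
  ∃ (k : ℕ) (K : Fin k → Set (EuclideanSpace ℝ (Fin d))),
    (∀ i, IsClosedCurve (K i)) ∧ (∀ i j, i ≠ j → Disjoint (K i) (K j)) ∧ C = ⋃ i, K i

/-- A finite union of pairwise disjoint closed curves that is not connected
(so it consists of at least two closed curves). -/
def IsDisconnectedUnionOfClosedCurves (C : Set (EuclideanSpace ℝ (Fin d))) : Prop :=
  IsUnionOfClosedCurves C ∧ ¬ IsPreconnected C

/-- `p` is a closest point to `x` in `C`. -/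
def IsClosestPoint (C : Set (EuclideanSpace ℝ (Fin d))) (x p : EuclideanSpace ℝ (Fin d)) : Prop :=
  p ∈ C ∧ ∀ q ∈ C, dist x p ≤ dist x q

/-- The medial axis of `C`: the points of the ambient space that do not have a unique closest
point in `C`. -/
def medialAxis (C : Set (EuclideanSpace ℝ (Fin d))) : Set (EuclideanSpace ℝ (Fin d)) :=
  {x | ¬ ∃! p, IsClosestPoint C x p}

/-- The local feature size of `C` at `p`: the distance from `p` to the medial axis of `C`
(an infimum of distances in `[0, ∞]`, so that the distance to the empty set is `∞`). -/
noncomputable def localFeatureSize (C : Set (EuclideanSpace ℝ (Fin d)))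
    (p : EuclideanSpace ℝ (Fin d)) : ENNReal :=
  Metric.infEDist p (medialAxis C)

/-- `S ⊆ C` is an `ε`-sample of `C` if `d(p, S) < ε * lfs(p)` for all `p ∈ C`. -/
def IsEpsilonSample (ε : ℝ) (C S : Set (EuclideanSpace ℝ (Fin d))) : Prop :=
  S ⊆ C ∧ ∀ p ∈ C, Metric.infEDist p S < ENNReal.ofReal ε * localFeatureSize C p

/-- `a → b` for some orientation: for some parametrization `γ` of the connected component of `C`
containing `a`, moving along the component from `a` in the direction of `γ`, the next element of
`S` that one encounters is `b`. The parameter `θ : ℝ` runs around the circle through `e ^ (i θ)`;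
both orientations occur, since the parametrization is arbitrary. -/
def IsNextSamplePoint (C S : Set (EuclideanSpace ℝ (Fin d)))
    (a b : EuclideanSpace ℝ (Fin d)) : Prop :=
  a ∈ S ∧ b ∈ S ∧ ∃ γ : Circle → EuclideanSpace ℝ (Fin d),
    IsParametrization γ (connectedComponentIn C a) ∧
    ∃ s t : ℝ, s < t ∧ γ (Circle.exp s) = a ∧ γ (Circle.exp t) = b ∧
      ∀ u ∈ Set.Ioo s t, γ (Circle.exp u) ∉ S

/-- The graph `G_C(S)` on the vertex set `S`: distinct sample points `a` and `b` are joined by an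
edge if and only if they are consecutive, that is, `a → b` or `b → a`. -/
def reconstructionGraph (C S : Set (EuclideanSpace ℝ (Fin d))) : SimpleGraph S :=
  SimpleGraph.fromRel fun a b : S => IsNextSamplePoint C S a b

end CurveReconstruction

/-!
The four curves differ only in how eight rays are connected at two places of the plane, which are
centred at `(∓2000, 0)` and are mirror images of each other. At each place, eight rays leave in the
directions `π / 8 + k * π / 4`. Strands inside a disc join them in neighbouring pairs, either across
the coordinate axes (state `1`) or across the diagonals (state `-1`). Outside the discs of radius
`1000`, eight pairwise disjoint circular arms, tangent to the rays at both ends, join the `k`-th ray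
of the left place to its mirror image. `curve ε δ` is the resulting set with the states `ε` and `δ`.
If the states are different, the eight long arms are traversed cyclically, and the curve is a closed
curve (`isClosedCurve_curve`); if they agree, it consists of four closed curves
(`exists_components`).

All strands are built from one function `prof`, a graph over the bisector of an octant, and they
cross the rays at the distances `114`, `180` and `258` from the centre, beyond which they coincide
with the rays. The strands of the two states are exchanged by the reflection in a ray, so the points
of the rays at these three distances lie on all the curves. They are sample points. To see that they
are dense enough, the plane is folded onto an octant by the symmetries of the square. The fold does
not increase distances, and it maps the strands to the graph of `prof`. A point that is not beyond
the edge of the octant where different strands come close, and not in the cone of normals beyond the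
centre of one of the arcs of the profile, has a unique closest point (`IsProfMin.unique`,
`bad_of_mem_medialAxis`). So the folded medial axis lies in a region bounded by lines, and half-plane
estimates bound its distance to the points of the profile from below (`exists_sample_of_prof`,
`exists_sample_of_strands`).

The rest of the curves, the outer parts of the rays and the arms, is a compact set `tame` common to
all of them. As the curves consist of segments and circular arcs with matching tangents, the local
feature size is positive everywhere (`localFeatureSize_curve_pos`), hence bounded below on `tame`,
where a sufficiently fine finite net therefore serves as a sample (`exists_sample`).

Finally, the graph determines both states (`states_eq_of_graph_eq`): the sample points at distance
`114` on the two rays next to the positive horizontal axis are joined by a strand in state `1`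
(`joined_left`), whereas in state `-1` they are separated by a domain whose boundary meets the curve
only in sample points (`not_joined_left`). The state of the right place is read off by reflection.
A reconstruction map would have to assign to the sample the graphs of both closed curves.
-/

open Set Filter Topology

namespace CurveReconstruction

/-! ### The octant fold of the plane -/

/-- The Euclidean plane. -/
abbrev Plane := EuclideanSpace ℝ (Fin 2)

/-- `cos (π / 8)`. -/
noncomputable def cc : ℝ := Real.cos (Real.pi / 8)

/-- `sin (π / 8)`. -/
noncomputable def ss : ℝ := Real.sin (Real.pi / 8)

lemma cc_sq_add_ss_sq : cc ^ 2 + ss ^ 2 = 1 := by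
  unfold cc ss; exact Real.cos_sq_add_sin_sq _

lemma cc_sq_sub_ss_sq : cc ^ 2 - ss ^ 2 = 2 * cc * ss := by
  have h1 : Real.cos (2 * (Real.pi / 8)) = Real.sin (2 * (Real.pi / 8)) := by
    rw [show 2 * (Real.pi / 8) = Real.pi / 4 by ring, Real.cos_pi_div_four, Real.sin_pi_div_four]
  rw [Real.cos_two_mul, Real.sin_two_mul] at h1
  have := cc_sq_add_ss_sq
  unfold cc ss at *
  nlinarith

lemma ss_pos : 0 < ss := by
  unfold ss; exact Real.sin_pos_of_pos_of_lt_pi (by positivity) (by linarith [Real.pi_pos])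

lemma cc_pos : 0 < cc := by
  unfold cc; exact Real.cos_pos_of_mem_Ioo ⟨by linarith [Real.pi_pos], by linarith [Real.pi_pos]⟩

lemma ss_lt_cc : ss < cc := by nlinarith [cc_sq_sub_ss_sq, mul_pos cc_pos ss_pos, cc_pos, ss_pos]

lemma cc_sq : cc ^ 2 = 1 / 2 + Real.sqrt 2 / 4 := by
  have h : Real.cos (2 * (Real.pi / 8)) = Real.sqrt 2 / 2 := by
    rw [show 2 * (Real.pi / 8) = Real.pi / 4 by ring, Real.cos_pi_div_four]
  rw [Real.cos_two_mul] at h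
  unfold cc; linarith

lemma sqrt_two_bounds : 1.414213 < Real.sqrt 2 ∧ Real.sqrt 2 < 1.414214 := by
  constructor
  · rw [Real.lt_sqrt (by norm_num)]; norm_num
  · rw [Real.sqrt_lt' (by norm_num)]; norm_num

lemma cc_bounds : 0.923879 < cc ∧ cc < 0.92388 := by
  have h := cc_sq
  obtain ⟨h1, h2⟩ := sqrt_two_bounds
  have := cc_pos
  constructor <;> nlinarith

lemma ss_bounds : 0.382683 < ss ∧ ss < 0.382684 := by
  have h := cc_sq
  have h' := cc_sq_add_ss_sq
  obtain ⟨h1, h2⟩ := sqrt_two_bounds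
  have := ss_pos
  constructor <;> nlinarith

lemma dist_sq_eq (p q : Plane) : dist p q ^ 2 = (p 0 - q 0) ^ 2 + (p 1 - q 1) ^ 2 := by
  rw [EuclideanSpace.dist_eq, Real.sq_sqrt (by positivity)]
  simp [Fin.sum_univ_two, Real.dist_eq, sq_abs]

lemma Plane.ext {p q : Plane} (h0 : p 0 = q 0) (h1 : p 1 = q 1) : p = q := by
  ext i; fin_cases i <;> assumption

/-- The plane is folded onto the octant `0 ≤ y ≤ x` by `(x, y) ↦ (max |x| |y|, min |x| |y|)`.
`uco` is the coordinate of the folded point along the bisector of the octant. -/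
noncomputable def uco (z : Plane) : ℝ := cc * max |z 0| |z 1| + ss * min |z 0| |z 1|

/-- The coordinate of the folded point orthogonal to the bisector of the octant. -/
noncomputable def vco (z : Plane) : ℝ := -ss * max |z 0| |z 1| + cc * min |z 0| |z 1|

lemma min_abs_eq (z : Plane) : min |z 0| |z 1| = ss * uco z + cc * vco z := by
  unfold uco vco; linear_combination (-(min |z 0| |z 1|)) * cc_sq_add_ss_sq

lemma max_abs_eq (z : Plane) : max |z 0| |z 1| = cc * uco z - ss * vco z := by
  unfold uco vco; linear_combination (-(max |z 0| |z 1|)) * cc_sq_add_ss_sq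

lemma two_cc_ss_mul (u v : ℝ) :
    2 * cc * ss * ((cc * u - ss * v) - (ss * u + cc * v)) = ss * u - cc * v := by
  linear_combination (ss * u - cc * v) * cc_sq_add_ss_sq +
    (cc * v + ss * u) * cc_sq_sub_ss_sq

lemma fold_lower (z : Plane) : 0 ≤ ss * uco z + cc * vco z := by
  rw [← min_abs_eq]; positivity

lemma fold_upper (z : Plane) : 0 ≤ ss * uco z - cc * vco z := by
  rw [← two_cc_ss_mul, ← min_abs_eq, ← max_abs_eq]
  have := min_le_max (a := |z 0|) (b := |z 1|)
  have := mul_pos cc_pos ss_pos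
  nlinarith

lemma fold_upper_pos_iff (z : Plane) :
    0 < ss * uco z - cc * vco z ↔ min |z 0| |z 1| < max |z 0| |z 1| := by
  rw [← two_cc_ss_mul, ← min_abs_eq, ← max_abs_eq]
  have := mul_pos cc_pos ss_pos
  constructor <;> intro h
  · by_contra! h'
    nlinarith
  · nlinarith

lemma continuous_uco : Continuous uco := by unfold uco; fun_prop

lemma continuous_vco : Continuous vco := by unfold vco; fun_prop

lemma uco_sq_add_vco_sq (z : Plane) : uco z ^ 2 + vco z ^ 2 = z 0 ^ 2 + z 1 ^ 2 := by
  have h : uco z ^ 2 + vco z ^ 2 = (max |z 0| |z 1|) ^ 2 + (min |z 0| |z 1|) ^ 2 := by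
    unfold uco vco
    linear_combination ((max |z 0| |z 1|) ^ 2 + (min |z 0| |z 1|) ^ 2) * cc_sq_add_ss_sq
  rw [h, ← sq_abs (z 0), ← sq_abs (z 1)]
  rcases le_total |z 0| |z 1| with h | h <;> simp [h]; ring

lemma fold_inner_le (z w : Plane) :
    z 0 * w 0 + z 1 * w 1 ≤ uco z * uco w + vco z * vco w := by
  have h : uco z * uco w + vco z * vco w =
      max |z 0| |z 1| * max |w 0| |w 1| + min |z 0| |z 1| * min |w 0| |w 1| := by
    unfold uco vco
    linear_combination (max |z 0| |z 1| * max |w 0| |w 1| +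
      min |z 0| |z 1| * min |w 0| |w 1|) * cc_sq_add_ss_sq
  rw [h]
  have h1 : z 0 * w 0 ≤ |z 0| * |w 0| := by rw [← abs_mul]; exact le_abs_self _
  have h2 : z 1 * w 1 ≤ |z 1| * |w 1| := by rw [← abs_mul]; exact le_abs_self _
  rcases le_total |z 0| |z 1| with h | h <;> rcases le_total |w 0| |w 1| with h' | h' <;>
    simp only [h, h', max_eq_left, max_eq_right, min_eq_left, min_eq_right] <;>
    nlinarith [mul_nonneg (sub_nonneg.2 h) (sub_nonneg.2 h')]

lemma dist_sq_sub_fold (z w : Plane) : dist z w ^ 2 -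
    ((uco z - uco w) ^ 2 + (vco z - vco w) ^ 2) =
    2 * (uco z * uco w + vco z * vco w - (z 0 * w 0 + z 1 * w 1)) := by
  rw [dist_sq_eq]
  linear_combination - uco_sq_add_vco_sq z - uco_sq_add_vco_sq w

/-- Folding does not increase distances. -/
lemma fold_dist_le (z w : Plane) :
    (uco z - uco w) ^ 2 + (vco z - vco w) ^ 2 ≤ dist z w ^ 2 := by
  linarith [dist_sq_sub_fold z w, fold_inner_le z w]

/-- Every point of the octant has a preimage under the fold that is as far from `z` as the point
itself is from the folded `z`. -/
lemma exists_fold_preimage (z : Plane) {a b : ℝ} (h1 : 0 ≤ ss * a + cc * b)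
    (h2 : 0 ≤ ss * a - cc * b) :
    ∃ w : Plane, uco w = a ∧ vco w = b ∧
      dist z w ^ 2 = (uco z - a) ^ 2 + (vco z - b) ^ 2 := by
  set X := cc * a - ss * b with hX
  set Y := ss * a + cc * b with hY
  have hXY : Y ≤ X := by
    have := two_cc_ss_mul a b
    have := mul_pos cc_pos ss_pos
    by_contra! h
    nlinarith
  have key : ∀ w : Plane, max |w 0| |w 1| = X → min |w 0| |w 1| = Y →
      z 0 * w 0 + z 1 * w 1 = max |z 0| |z 1| * X + min |z 0| |z 1| * Y →
      ∃ w : Plane, uco w = a ∧ vco w = b ∧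
      dist z w ^ 2 = (uco z - a) ^ 2 + (vco z - b) ^ 2 := by
    intro w hw1 hw2 hw3
    have ha : uco w = a := by
      unfold uco; rw [hw1, hw2, hX, hY]; linear_combination a * cc_sq_add_ss_sq
    have hb : vco w = b := by
      unfold vco; rw [hw1, hw2, hX, hY]; linear_combination b * cc_sq_add_ss_sq
    refine ⟨w, ha, hb, ?_⟩
    have := dist_sq_sub_fold z w
    rw [ha, hb, hw3, max_abs_eq z, min_abs_eq z, hX, hY] at this
    linear_combination this - 2 * (uco z * a + vco z * b) * cc_sq_add_ss_sq
  have hX0 : 0 ≤ X := h1.trans hXY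
  have hs : ∀ t : ℝ, ∃ e : ℝ, |e| = 1 ∧ t * e = |t| := by
    intro t
    rcases le_total 0 t with h | h
    · exact ⟨1, by simp, by simp [abs_of_nonneg h]⟩
    · exact ⟨-1, by simp, by simp [abs_of_nonpos h]⟩
  obtain ⟨e0, he0, he0'⟩ := hs (z 0)
  obtain ⟨e1, he1, he1'⟩ := hs (z 1)
  rcases le_total |z 0| |z 1| with h | h
  · refine key !₂[e0 * Y, e1 * X] ?_ ?_ ?_
    · simp [abs_mul, he0, he1, abs_of_nonneg h1, abs_of_nonneg hX0, hXY]
    · simp [abs_mul, he0, he1, abs_of_nonneg h1, abs_of_nonneg hX0, hXY]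
    · simp [h]
      linear_combination Y * he0' + X * he1'
  · refine key !₂[e0 * X, e1 * Y] ?_ ?_ ?_
    · simp [abs_mul, he0, he1, abs_of_nonneg h1, abs_of_nonneg hX0, hXY]
    · simp [abs_mul, he0, he1, abs_of_nonneg h1, abs_of_nonneg hX0, hXY]
    · simp [h]
      linear_combination X * he0' + Y * he1'

/-- Over the open octant (or at points of its lower edge), a preimage under the fold at the minimal
distance from a given point is unique. -/
lemma fold_rigid {x q q' : Plane} (hu : uco q = uco q') (hv : vco q = vco q')
    (hq : dist x q ^ 2 = (uco x - uco q) ^ 2 + (vco x - vco q) ^ 2)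
    (hq' : dist x q' ^ 2 = (uco x - uco q') ^ 2 + (vco x - vco q') ^ 2)
    (hx1 : 0 < ss * uco x - cc * vco x) (hq1 : 0 < ss * uco q - cc * vco q)
    (hlow : 0 < ss * uco x + cc * vco x ∨ ss * uco q + cc * vco q = 0) : q = q' := by
  have hq1' : 0 < ss * uco q' - cc * vco q' := by rw [← hu, ← hv]; exact hq1
  rw [fold_upper_pos_iff] at hx1 hq1 hq1'
  rw [← min_abs_eq, ← min_abs_eq] at hlow
  have hM : max |q 0| |q 1| = max |q' 0| |q' 1| := by rw [max_abs_eq, max_abs_eq, hu, hv]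
  have hm : min |q 0| |q 1| = min |q' 0| |q' 1| := by rw [min_abs_eq, min_abs_eq, hu, hv]
  have inner : ∀ w : Plane, dist x w ^ 2 = (uco x - uco w) ^ 2 + (vco x - vco w) ^ 2 →
      x 0 * w 0 + x 1 * w 1 =
        max |x 0| |x 1| * max |w 0| |w 1| + min |x 0| |x 1| * min |w 0| |w 1| := by
    intro w hw
    have := dist_sq_sub_fold x w
    rw [max_abs_eq, min_abs_eq, max_abs_eq, min_abs_eq]
    linear_combination this / 2 - hw / 2 - (uco x * uco w + vco x * vco w) * cc_sq_add_ss_sq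
  -- a minimizing preimage is determined by `x` and by its own folded coordinates
  have det : ∀ w : Plane, min |w 0| |w 1| < max |w 0| |w 1| →
      (0 < min |x 0| |x 1| ∨ min |w 0| |w 1| = 0) →
      x 0 * w 0 + x 1 * w 1 =
        max |x 0| |x 1| * max |w 0| |w 1| + min |x 0| |x 1| * min |w 0| |w 1| →
      (|x 1| < |x 0| ∧ w 0 = SignType.sign (x 0) * max |w 0| |w 1| ∧
          w 1 = SignType.sign (x 1) * min |w 0| |w 1|) ∨
      (|x 0| < |x 1| ∧ w 0 = SignType.sign (x 0) * min |w 0| |w 1| ∧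
          w 1 = SignType.sign (x 1) * max |w 0| |w 1|) := by
    intro w hw hl hi
    have a0 : x 0 * w 0 ≤ |x 0| * |w 0| := by rw [← abs_mul]; exact le_abs_self _
    have a1 : x 1 * w 1 ≤ |x 1| * |w 1| := by rw [← abs_mul]; exact le_abs_self _
    have sgn : ∀ s t : ℝ, s ≠ 0 → s * t = |s| * |t| → t = SignType.sign s * |t| := by
      intro s t hs h
      rcases lt_or_gt_of_ne hs with h0 | h0
      · rw [abs_of_neg h0] at h
        simp only [sign_neg h0, SignType.coe_neg_one]
        nlinarith [mul_left_cancel₀ hs (show s * t = s * (-|t|) by linarith)]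
      · rw [abs_of_pos h0] at h
        simp only [sign_pos h0, SignType.coe_one]
        nlinarith [mul_left_cancel₀ hs h]
    rcases le_total |x 0| |x 1| with hx | hx <;> rcases le_total |w 0| |w 1| with hw' | hw' <;>
      simp only [hx, hw', max_eq_left, max_eq_right, min_eq_left, min_eq_right] at *
    · right
      refine ⟨hx1, ?_, sgn _ _ ?_ ?_⟩
      · rcases hl with hl | hl
        · exact sgn _ _ (abs_pos.1 hl) (by linarith)
        · rw [abs_eq_zero.1 hl]; simp
      · intro h; rw [h] at hx1; simp at hx1; exact absurd hx1 (by simp)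
      · linarith
    · nlinarith [mul_pos (sub_pos.2 hx1) (sub_pos.2 hw)]
    · nlinarith [mul_pos (sub_pos.2 hx1) (sub_pos.2 hw)]
    · left
      refine ⟨hx1, sgn _ _ ?_ ?_, ?_⟩
      · intro h; rw [h] at hx1; simp at hx1; exact absurd hx1 (by simp)
      · linarith
      · rcases hl with hl | hl
        · exact sgn _ _ (abs_pos.1 hl) (by linarith)
        · rw [abs_eq_zero.1 hl]; simp
  rcases det q hq1 hlow (inner q hq) with ⟨h, h0, h1⟩ | ⟨h, h0, h1⟩ <;>
  rcases det q' hq1' (by rw [← hm]; exact hlow) (inner q' hq') with ⟨h', h0', h1'⟩ | ⟨h', h0', h1'⟩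
  · exact Plane.ext (by rw [h0, h0', hM]) (by rw [h1, h1', hm])
  · exact absurd h (not_lt.2 h'.le)
  · exact absurd h (not_lt.2 h'.le)
  · exact Plane.ext (by rw [h0, h0', hm]) (by rw [h1, h1', hM])

/-! ### The profile of a strand -/

/-- The function that agrees with `f` up to `a` and with `g` after `a`. -/
noncomputable def glue (a : ℝ) (f g : ℝ → ℝ) (u : ℝ) : ℝ := if u ≤ a then f u else g u

lemma glue_of_le {a u : ℝ} {f g : ℝ → ℝ} (h : u ≤ a) : glue a f g u = f u := if_pos h

lemma glue_of_ge {a u : ℝ} {f g : ℝ → ℝ} (hfg : f a = g a) (h : a ≤ u) : glue a f g u = g u := by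
  rcases h.eq_or_lt with rfl | h
  · rw [glue_of_le le_rfl, hfg]
  · exact if_neg (not_le.2 h)

lemma HasDerivAt.glue_self {a d : ℝ} {f g : ℝ → ℝ} (hfg : f a = g a) (hf : HasDerivAt f d a)
    (hg : HasDerivAt g d a) : HasDerivAt (glue a f g) d a := by
  have h1 : HasDerivWithinAt (glue a f g) d (Iic a) a :=
    hf.hasDerivWithinAt.congr (fun u hu => glue_of_le hu) (glue_of_le le_rfl)
  have h2 : HasDerivWithinAt (glue a f g) d (Ici a) a :=
    hg.hasDerivWithinAt.congr (fun u hu => glue_of_ge hfg hu) (glue_of_ge hfg le_rfl)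
  have := h1.union h2
  rwa [Iic_union_Ici, hasDerivWithinAt_univ] at this

lemma HasDerivAt.glue_left {a d u : ℝ} {f g : ℝ → ℝ} (hfg : f a = g a) (hf : HasDerivAt f d u)
    (hg : u = a → HasDerivAt g d u) (hu : u ≤ a) : HasDerivAt (glue a f g) d u := by
  rcases hu.eq_or_lt with rfl | h
  · exact HasDerivAt.glue_self hfg hf (hg rfl)
  · refine hf.congr_of_eventuallyEq ?_
    filter_upwards [eventually_lt_nhds h] with w hw using glue_of_le hw.le

lemma HasDerivAt.glue_right {a d u : ℝ} {f g : ℝ → ℝ} (hfg : f a = g a) (hg : HasDerivAt g d u)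
    (hf : u = a → HasDerivAt f d u) (hu : a ≤ u) : HasDerivAt (glue a f g) d u := by
  rcases hu.eq_or_lt with rfl | h
  · exact HasDerivAt.glue_self hfg (hf rfl) hg
  · refine hg.congr_of_eventuallyEq ?_
    filter_upwards [eventually_gt_nhds h] with w hw using glue_of_ge hfg hw.le

/-- The distance from the centre of a crossing to the midpoint of a strand. -/
noncomputable def mid : ℝ := 147 * cc + 56 * ss - 65

/-- The coordinate of the midpoint of a strand along the bisector of its octant. -/
noncomputable def uM : ℝ := cc * mid

/-- The coordinate of the end of the straight part of a strand. -/
noncomputable def u0 : ℝ := 147 - 65 * cc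

/-- The straight part of the profile, orthogonal to the edge of the octant. -/
noncomputable def seg (u : ℝ) : ℝ := (cc * u - mid) / ss

/-- The first circular arc of the profile. -/
noncomputable def arc1 (u : ℝ) : ℝ := -56 + √(65 ^ 2 - (u - 147) ^ 2)

/-- The second circular arc of the profile. -/
noncomputable def arc2 (u : ℝ) : ℝ := 56 - √(65 ^ 2 - (u - 213) ^ 2)

/-- The third circular arc of the profile. -/
noncomputable def arc3 (u : ℝ) : ℝ := -52 + √(52 ^ 2 - (u - 258) ^ 2)

/-- The profile of a half-strand, as a graph over the bisector of the octant: a segment, three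
circular arcs with matching tangents, and finally the bisector itself. The centres of the arcs are
`(147, -56)`, `(213, 56)` and `(258, -52)`. Since `33 ^ 2 + 56 ^ 2 = 65 ^ 2`, the first arc meets
the bisector at `114` and at `180`, where the second arc begins; since `25 ^ 2 + 60 ^ 2 = 65 ^ 2`
and `20 ^ 2 + 48 ^ 2 = 52 ^ 2`, the last two arcs meet in `(238, -4)`. -/
noncomputable def prof : ℝ → ℝ :=
  glue u0 seg (glue 180 arc1 (glue 238 arc2 (glue 258 arc3 fun _ => 0)))

lemma hasDerivAt_sqrt_circle {R c u y : ℝ} (hy : 0 < y) (h : (u - c) ^ 2 + y ^ 2 = R ^ 2) :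
    HasDerivAt (fun u => √(R ^ 2 - (u - c) ^ 2)) (-(u - c) / y) u := by
  have h1 : HasDerivAt (fun u => R ^ 2 - (u - c) ^ 2) (-(2 * (u - c))) u := by
    have := (((hasDerivAt_id u).sub_const c).pow 2).const_sub (R ^ 2)
    exact this.congr_deriv (by simp)
  have h2 : R ^ 2 - (u - c) ^ 2 = y ^ 2 := by linarith
  have := h1.sqrt (by rw [h2]; positivity)
  rw [h2, Real.sqrt_sq hy.le] at this
  exact this.congr_deriv (by field_simp)

lemma sqrt_circle {R c u y : ℝ} (hy : 0 < y) (h : (u - c) ^ 2 + y ^ 2 = R ^ 2) :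
    √(R ^ 2 - (u - c) ^ 2) = y := by
  rw [show R ^ 2 - (u - c) ^ 2 = y ^ 2 by linarith, Real.sqrt_sq hy.le]

lemma exists_circle_height {R c u : ℝ} (h : (u - c) ^ 2 < R ^ 2) :
    ∃ y, 0 < y ∧ (u - c) ^ 2 + y ^ 2 = R ^ 2 :=
  ⟨√(R ^ 2 - (u - c) ^ 2), Real.sqrt_pos.2 (by linarith),
    by rw [Real.sq_sqrt (by linarith)]; ring⟩

lemma hasDerivAt_seg (u : ℝ) : HasDerivAt seg (cc / ss) u := by
  unfold seg
  have := (((hasDerivAt_id u).const_mul cc).sub_const mid).div_const ss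
  simpa using this

lemma hasDerivAt_arc1 {u y : ℝ} (hy : 0 < y) (h : (u - 147) ^ 2 + y ^ 2 = 65 ^ 2) :
    HasDerivAt arc1 (-(u - 147) / y) u :=
  (hasDerivAt_sqrt_circle hy h).const_add _

lemma hasDerivAt_arc2 {u y : ℝ} (hy : 0 < y) (h : (u - 213) ^ 2 + y ^ 2 = 65 ^ 2) :
    HasDerivAt arc2 ((u - 213) / y) u := by
  exact ((hasDerivAt_sqrt_circle hy h).const_sub 56).congr_deriv (by ring)

lemma hasDerivAt_arc3 {u y : ℝ} (hy : 0 < y) (h : (u - 258) ^ 2 + y ^ 2 = 52 ^ 2) :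
    HasDerivAt arc3 (-(u - 258) / y) u :=
  (hasDerivAt_sqrt_circle hy h).const_add _

lemma arc1_eq {u y : ℝ} (hy : 0 < y) (h : (u - 147) ^ 2 + y ^ 2 = 65 ^ 2) : arc1 u = -56 + y := by
  unfold arc1; rw [sqrt_circle hy h]

lemma arc2_eq {u y : ℝ} (hy : 0 < y) (h : (u - 213) ^ 2 + y ^ 2 = 65 ^ 2) : arc2 u = 56 - y := by
  unfold arc2; rw [sqrt_circle hy h]

lemma arc3_eq {u y : ℝ} (hy : 0 < y) (h : (u - 258) ^ 2 + y ^ 2 = 52 ^ 2) : arc3 u = -52 + y := by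
  unfold arc3; rw [sqrt_circle hy h]

lemma u0_bounds : 86.9 < u0 ∧ u0 < 86.95 := by
  obtain ⟨h1, h2⟩ := cc_bounds
  unfold u0; constructor <;> linarith

lemma mid_bounds : 92.24 < mid ∧ mid < 92.25 := by
  obtain ⟨h1, h2⟩ := cc_bounds
  obtain ⟨h3, h4⟩ := ss_bounds
  unfold mid; constructor <;> linarith

lemma uM_bounds : 85.21 < uM ∧ uM < 85.23 := by
  obtain ⟨h1, h2⟩ := cc_bounds
  obtain ⟨h3, h4⟩ := mid_bounds
  unfold uM; constructor <;> nlinarith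

lemma u0_circle : (u0 - 147) ^ 2 + (65 * ss) ^ 2 = 65 ^ 2 := by
  unfold u0; linear_combination 65 ^ 2 * cc_sq_add_ss_sq

lemma seg_u0 : seg u0 = -56 + 65 * ss := by
  have := ss_pos
  unfold seg u0 mid
  field_simp
  linear_combination -65 * cc_sq_add_ss_sq

lemma seg_uM : seg uM = -ss * mid := by
  have := ss_pos
  unfold seg uM
  field_simp
  linear_combination mid * cc_sq_add_ss_sq

lemma glue3_eq : arc3 258 = 0 := by
  rw [arc3_eq (y := 52) (by norm_num) (by norm_num)]; norm_num

lemma glue2_eq : arc2 238 = glue 258 arc3 (fun _ => 0) 238 := by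
  rw [glue_of_le (by norm_num), arc2_eq (y := 60) (by norm_num) (by norm_num),
    arc3_eq (y := 48) (by norm_num) (by norm_num)]; norm_num

lemma glue1_eq : arc1 180 = glue 238 arc2 (glue 258 arc3 fun _ => 0) 180 := by
  rw [glue_of_le (by norm_num), arc1_eq (y := 56) (by norm_num) (by norm_num),
    arc2_eq (y := 56) (by norm_num) (by norm_num)]; norm_num

lemma glue0_eq : seg u0 = glue 180 arc1 (glue 238 arc2 (glue 258 arc3 fun _ => 0)) u0 := by
  have := u0_bounds
  rw [glue_of_le (by linarith), arc1_eq (y := 65 * ss) (by have := ss_pos; positivity) u0_circle,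
    seg_u0]

/-- The five parts of the profile, with its derivative. -/
lemma prof_cases (u : ℝ) :
    (u ≤ u0 ∧ prof u = seg u ∧ HasDerivAt prof (cc / ss) u) ∨
    (u0 < u ∧ u ≤ 180 ∧ ∃ y, 0 < y ∧ (u - 147) ^ 2 + y ^ 2 = 65 ^ 2 ∧ prof u = -56 + y ∧
      HasDerivAt prof (-(u - 147) / y) u) ∨
    (180 < u ∧ u ≤ 238 ∧ ∃ y, 0 < y ∧ (u - 213) ^ 2 + y ^ 2 = 65 ^ 2 ∧ prof u = 56 - y ∧
      HasDerivAt prof ((u - 213) / y) u) ∨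
    (238 < u ∧ u ≤ 258 ∧ ∃ y, 0 < y ∧ (u - 258) ^ 2 + y ^ 2 = 52 ^ 2 ∧ prof u = -52 + y ∧
      HasDerivAt prof (-(u - 258) / y) u) ∨
    (258 < u ∧ prof u = 0 ∧ HasDerivAt prof 0 u) := by
  have hb := u0_bounds
  have hs := ss_pos
  have hsl := ss_bounds
  have hcl := cc_bounds
  have uniq : ∀ {X y y' : ℝ}, 0 < y → 0 < y' → ∀ {R : ℝ}, X ^ 2 + y ^ 2 = R → X ^ 2 + y' ^ 2 = R →
      y = y' := by
    intro X y y' hy hy' R h h'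
    exact (pow_left_inj₀ hy.le hy'.le two_ne_zero).1 (by linarith)
  rcases le_or_gt u u0 with h0 | h0
  · refine Or.inl ⟨h0, glue_of_le h0, ?_⟩
    refine HasDerivAt.glue_left glue0_eq (hasDerivAt_seg u) ?_ h0
    rintro rfl
    refine HasDerivAt.glue_left glue1_eq ?_ (fun h => absurd h (by linarith)) (by linarith)
    refine (hasDerivAt_arc1 (y := 65 * ss) (by positivity) u0_circle).congr_deriv ?_
    unfold u0; field_simp; ring
  rcases le_or_gt u 180 with h1 | h1
  · obtain ⟨y, hy, hc⟩ := exists_circle_height (R := 65) (c := 147) (u := u) (by nlinarith)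
    refine Or.inr (Or.inl ⟨h0, h1, y, hy, hc, ?_, ?_⟩)
    · rw [prof, glue_of_ge glue0_eq h0.le, glue_of_le h1, arc1_eq hy hc]
    · refine HasDerivAt.glue_right glue0_eq ?_ (fun h => absurd h h0.ne') h0.le
      refine HasDerivAt.glue_left glue1_eq (hasDerivAt_arc1 hy hc) ?_ h1
      rintro rfl
      refine HasDerivAt.glue_left glue2_eq ?_ (fun h => absurd h (by norm_num)) (by norm_num)
      have := uniq hy (by norm_num : (0:ℝ) < 56) hc (by norm_num)
      subst this
      exact (hasDerivAt_arc2 (u := 180) (y := 56) (by norm_num) (by norm_num)).congr_deriv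
        (by norm_num)
  rcases le_or_gt u 238 with h2 | h2
  · obtain ⟨y, hy, hc⟩ := exists_circle_height (R := 65) (c := 213) (u := u) (by nlinarith)
    refine Or.inr (Or.inr (Or.inl ⟨h1, h2, y, hy, hc, ?_, ?_⟩))
    · rw [prof, glue_of_ge glue0_eq h0.le, glue_of_ge glue1_eq h1.le, glue_of_le h2,
        arc2_eq hy hc]
    · refine HasDerivAt.glue_right glue0_eq ?_ (fun h => absurd h h0.ne') h0.le
      refine HasDerivAt.glue_right glue1_eq ?_ (fun h => absurd h h1.ne') h1.le
      refine HasDerivAt.glue_left glue2_eq (hasDerivAt_arc2 hy hc) ?_ h2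
      rintro rfl
      refine HasDerivAt.glue_left glue3_eq ?_ (fun h => absurd h (by norm_num)) (by norm_num)
      have := uniq hy (by norm_num : (0:ℝ) < 60) hc (by norm_num)
      subst this
      exact (hasDerivAt_arc3 (u := 238) (y := 48) (by norm_num) (by norm_num)).congr_deriv
        (by norm_num)
  rcases le_or_gt u 258 with h3 | h3
  · obtain ⟨y, hy, hc⟩ := exists_circle_height (R := 52) (c := 258) (u := u) (by nlinarith)
    refine Or.inr (Or.inr (Or.inr (Or.inl ⟨h2, h3, y, hy, hc, ?_, ?_⟩)))
    · rw [prof, glue_of_ge glue0_eq h0.le, glue_of_ge glue1_eq h1.le,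
        glue_of_ge glue2_eq h2.le, glue_of_le h3, arc3_eq hy hc]
    · refine HasDerivAt.glue_right glue0_eq ?_ (fun h => absurd h h0.ne') h0.le
      refine HasDerivAt.glue_right glue1_eq ?_ (fun h => absurd h h1.ne') h1.le
      refine HasDerivAt.glue_right glue2_eq ?_ (fun h => absurd h h2.ne') h2.le
      refine HasDerivAt.glue_left glue3_eq (hasDerivAt_arc3 hy hc) ?_ h3
      rintro rfl
      simpa using hasDerivAt_const (258 : ℝ) (0 : ℝ)
  · refine Or.inr (Or.inr (Or.inr (Or.inr ⟨h3, ?_, ?_⟩)))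
    · rw [prof, glue_of_ge glue0_eq h0.le, glue_of_ge glue1_eq h1.le,
        glue_of_ge glue2_eq h2.le, glue_of_ge glue3_eq h3.le]
    · refine HasDerivAt.glue_right glue0_eq ?_ (fun h => absurd h h0.ne') h0.le
      refine HasDerivAt.glue_right glue1_eq ?_ (fun h => absurd h h1.ne') h1.le
      refine HasDerivAt.glue_right glue2_eq ?_ (fun h => absurd h h2.ne') h2.le
      exact HasDerivAt.glue_right glue3_eq (hasDerivAt_const _ _) (fun h => absurd h h3.ne') h3.le

lemma differentiable_prof : Differentiable ℝ prof := fun u => by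
  rcases prof_cases u with ⟨-, -, h⟩ | ⟨-, -, y, -, -, -, h⟩ | ⟨-, -, y, -, -, -, h⟩ |
    ⟨-, -, y, -, -, -, h⟩ | ⟨-, -, h⟩ <;> exact h.differentiableAt

lemma continuous_prof : Continuous prof := differentiable_prof.continuous

/-! ### Nearest points of a half-strand -/

lemma deriv_nonneg_of_min_right {F : ℝ → ℝ} {d u : ℝ} (hF : HasDerivAt F d u)
    (h : ∀ w, u ≤ w → w ≤ u + 1 → F u ≤ F w) : 0 ≤ d := by
  have hmin : IsLocalMinOn F (Icc u (u + 1)) u := by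
    filter_upwards [self_mem_nhdsWithin] with w hw using h w hw.1 hw.2
  have := hmin.hasFDerivWithinAt_nonneg hF.hasDerivWithinAt.hasFDerivWithinAt (y := 1)
    (mem_posTangentConeAt_of_segment_subset (by rw [segment_eq_Icc (by linarith)]))
  simpa using this

/-- The signed position relative to the normal line at the end of the segment (an axis through the
centre of the first arc). -/
noncomputable def g0 (a b : ℝ) : ℝ := ss * (a - 147) + cc * (b + 56)

/-- The signed position relative to the common normal line of the first two arcs. -/
def g1 (a b : ℝ) : ℝ := 56 * (a - 180) - 33 * b

/-- The signed position relative to the common normal line of the last two arcs. -/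
def g2 (a b : ℝ) : ℝ := 12 * (a - 238) + 5 * (b + 4)

/-- The signed position relative to the normal line at the end of the last arc. -/
def g3 (a : ℝ) : ℝ := a - 258

/-- A closed region that contains the folded medial axis: points beyond the edge of the octant that
separates two strands, and, for each arc of the profile, the points in the cone of normals beyond
its centre. -/
def Bad (a b : ℝ) : Prop :=
  ss * a - cc * b ≤ 0 ∨ (g0 a b ≤ 0 ∧ 0 ≤ g1 a b) ∨ (g1 a b ≤ 0 ∧ 0 ≤ g2 a b) ∨
    (g2 a b ≤ 0 ∧ 0 ≤ g3 a)

/-- `u` is the parameter of a point of the half-strand that is closest to `(a, b)`. -/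
def IsProfMin (a b u : ℝ) : Prop :=
  uM ≤ u ∧ ∀ w, uM ≤ w → (a - u) ^ 2 + (b - prof u) ^ 2 ≤ (a - w) ^ 2 + (b - prof w) ^ 2

lemma hasDerivAt_dist_prof {a b u d : ℝ} (hd : HasDerivAt prof d u) :
    HasDerivAt (fun w => (a - w) ^ 2 + (b - prof w) ^ 2)
      (-2 * ((a - u) + (b - prof u) * d)) u := by
  have := (((hasDerivAt_id u).const_sub a).pow 2).add ((hd.const_sub b).pow 2)
  exact this.congr_deriv (by simp; ring)

lemma IsProfMin.deriv_nonpos {a b u d : ℝ} (h : IsProfMin a b u) (hd : HasDerivAt prof d u) :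
    (a - u) + (b - prof u) * d ≤ 0 := by
  have := deriv_nonneg_of_min_right (hasDerivAt_dist_prof (a := a) (b := b) hd)
    fun w hw _ => h.2 w (h.1.trans hw)
  linarith

lemma IsProfMin.deriv_eq_zero {a b u d : ℝ} (h : IsProfMin a b u) (hu : uM < u)
    (hd : HasDerivAt prof d u) : (a - u) + (b - prof u) * d = 0 := by
  have hmin : IsLocalMin (fun w => (a - w) ^ 2 + (b - prof w) ^ 2) u := by
    filter_upwards [eventually_gt_nhds hu] with w hw using h.2 w hw.le
  have := hmin.hasDerivAt_eq_zero (hasDerivAt_dist_prof (a := a) (b := b) hd)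
  linarith

lemma cross_lt {x y x' y' : ℝ} (hx : x < x') (hy : 0 < y) (hy' : 0 < y')
    (h : x ^ 2 + y ^ 2 = x' ^ 2 + y' ^ 2) : x * y' < x' * y := by
  rcases le_or_gt 0 x with h0 | h0
  · have : y' < y := by nlinarith
    nlinarith
  · rcases le_or_gt 0 x' with h1 | h1
    · nlinarith [mul_neg_of_neg_of_pos h0 hy', mul_nonneg h1 hy.le]
    · have : y < y' := by nlinarith
      nlinarith

lemma cross_le {x y x' y' : ℝ} (hx : x ≤ x') (hy : 0 < y) (hy' : 0 < y')
    (h : x ^ 2 + y ^ 2 = x' ^ 2 + y' ^ 2) : x * y' ≤ x' * y := by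
  rcases hx.eq_or_lt with rfl | hx
  · have : y = y' := (pow_left_inj₀ hy.le hy'.le two_ne_zero).1 (by linarith)
    rw [this]
  · exact (cross_lt hx hy hy' h).le

/-- A point `(a, b)` outside `Bad` whose closest point on the half-strand has parameter `u` lies on
the normal of the corresponding part of the profile, on the near side of the centre if that part is
an arc; and its position relative to all normal lines at the junctions matches that of `u`. -/
lemma IsProfMin.cases {a b u : ℝ} (hW : 0 ≤ ss * a + cc * b) (hbad : ¬ Bad a b)
    (h : IsProfMin a b u) :
    (u ≤ u0 ∧ g0 a b = (u - u0) / ss) ∨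
    (u0 < u ∧ u ≤ 180 ∧ 0 < g0 a b ∧ g1 a b ≤ 0 ∧ ∃ l y, 0 < l ∧ 0 < y ∧
      (u - 147) ^ 2 + y ^ 2 = 65 ^ 2 ∧ a - 147 = l * (u - 147) ∧ b + 56 = l * y) ∨
    (180 < u ∧ u ≤ 238 ∧ 0 < g1 a b ∧ g2 a b ≤ 0 ∧ ∃ l y, 0 < l ∧ 0 < y ∧
      (u - 213) ^ 2 + y ^ 2 = 65 ^ 2 ∧ a - 213 = l * (u - 213) ∧ b - 56 = - (l * y)) ∨
    (238 < u ∧ u ≤ 258 ∧ 0 < g2 a b ∧ g3 a ≤ 0 ∧ ∃ l y, 0 < l ∧ 0 < y ∧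
      (u - 258) ^ 2 + y ^ 2 = 52 ^ 2 ∧ a - 258 = l * (u - 258) ∧ b + 52 = l * y) ∨
    (258 < u ∧ a = u) := by
  have hs := ss_pos
  have hc := cc_pos
  have hb := u0_bounds
  have hM := uM_bounds
  simp only [Bad, not_or, not_and, not_le] at hbad
  obtain ⟨-, hV1, hV2, hV3⟩ := hbad
  rcases prof_cases u with ⟨hu, hp, hd⟩ | ⟨hu, hu', y, hy, hcirc, hp, hd⟩ |
    ⟨hu, hu', y, hy, hcirc, hp, hd⟩ | ⟨hu, hu', y, hy, hcirc, hp, hd⟩ | ⟨hu, hp, hd⟩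
  · refine Or.inl ⟨hu, ?_⟩
    have key : ss * (a - u) + cc * (b - seg u) = 0 := by
      have e : ∀ t : ℝ, ss * ((a - u) + t * (cc / ss)) = ss * (a - u) + cc * t := by
        intro t; field_simp
      rcases h.1.eq_or_lt with h1 | h1
      · have h2 := h.deriv_nonpos hd
        have h3 : ss * ((a - u) + (b - prof u) * (cc / ss)) ≤ 0 :=
          mul_nonpos_of_nonneg_of_nonpos hs.le h2
        rw [e, hp] at h3
        have h4 : ss * u + cc * seg u = 0 := by
          rw [← h1, seg_uM]; unfold uM; ring
        linarith
      · rw [← e, ← hp, h.deriv_eq_zero h1 hd, mul_zero]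
    rw [eq_div_iff hs.ne']
    have e2 : ss * seg u = cc * u - mid := by unfold seg; field_simp
    have e3 : g0 a b * ss = ss * (ss * (u - 147) + cc * 56) + cc * (ss * seg u) := by
      unfold g0; linear_combination ss * key
    rw [e3, e2]
    unfold u0 mid
    linear_combination (u - 147) * cc_sq_add_ss_sq
  · right; left
    have h1 := h.deriv_eq_zero (by linarith) hd
    rw [hp] at h1
    have h2 : (a - 147) * y = (b + 56) * (u - 147) := by
      field_simp at h1; linear_combination h1
    set l := (b + 56) / y with hl
    have hb' : b + 56 = l * y := by rw [hl]; field_simp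
    have ha' : a - 147 = l * (u - 147) := by
      rw [hl]; field_simp; linarith
    have c1 : 0 < ss * (u - 147) + cc * y := by
      have := cross_lt (x := u0 - 147) (y := 65 * ss) (x' := u - 147) (y' := y) (by linarith)
        (by positivity) hy (by rw [u0_circle, hcirc])
      unfold u0 at this
      linarith
    have c2 : 56 * (u - 147) - 33 * y ≤ 0 := by
      have := cross_le (x := u - 147) (y := y) (x' := 33) (y' := 56) (by linarith)
        hy (by norm_num) (by rw [hcirc]; norm_num)
      linarith
    have e0 : g0 a b = l * (ss * (u - 147) + cc * y) := by
      unfold g0; rw [ha', hb']; ring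
    have e1 : g1 a b = l * (56 * (u - 147) - 33 * y) := by
      unfold g1; linear_combination 56 * ha' - 33 * hb'
    have hl0 : 0 < l := by
      by_contra! hneg
      have := hV1 (by rw [e0]; exact mul_nonpos_of_nonpos_of_nonneg hneg c1.le)
      rw [e1] at this
      nlinarith
    refine ⟨hu, hu', by rw [e0]; positivity, ?_, l, y, hl0, hy, hcirc, ha', hb'⟩
    rw [e1]; exact mul_nonpos_of_nonneg_of_nonpos hl0.le c2
  · right; right; left
    have h1 := h.deriv_eq_zero (by linarith) hd
    rw [hp] at h1
    have h2 : (a - 213) * y = -(b - 56) * (u - 213) := by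
      field_simp at h1; linear_combination h1
    set l := (56 - b) / y with hl
    have hb' : b - 56 = -(l * y) := by rw [hl]; field_simp; ring
    have ha' : a - 213 = l * (u - 213) := by
      rw [hl]; field_simp; linarith
    have c1 : 0 < 56 * (u - 213) + 33 * y := by
      have := cross_lt (x := -33) (y := 56) (x' := u - 213) (y' := y) (by linarith)
        (by norm_num) hy (by rw [hcirc]; norm_num)
      linarith
    have c2 : 12 * (u - 213) - 5 * y ≤ 0 := by
      have := cross_le (x := u - 213) (y := y) (x' := 25) (y' := 60) (by linarith)
        hy (by norm_num) (by rw [hcirc]; norm_num)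
      linarith
    have e0 : g1 a b = l * (56 * (u - 213) + 33 * y) := by
      unfold g1; linear_combination 56 * ha' - 33 * hb'
    have e1 : g2 a b = l * (12 * (u - 213) - 5 * y) := by
      unfold g2; linear_combination 12 * ha' + 5 * hb'
    have hl0 : 0 < l := by
      by_contra! hneg
      have := hV2 (by rw [e0]; exact mul_nonpos_of_nonpos_of_nonneg hneg c1.le)
      rw [e1] at this
      nlinarith
    refine ⟨hu, hu', by rw [e0]; positivity, ?_, l, y, hl0, hy, hcirc, ha', hb'⟩
    rw [e1]; exact mul_nonpos_of_nonneg_of_nonpos hl0.le c2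
  · right; right; right; left
    have h1 := h.deriv_eq_zero (by linarith) hd
    rw [hp] at h1
    have h2 : (a - 258) * y = (b + 52) * (u - 258) := by
      field_simp at h1; linear_combination h1
    set l := (b + 52) / y with hl
    have hb' : b + 52 = l * y := by rw [hl]; field_simp
    have ha' : a - 258 = l * (u - 258) := by
      rw [hl]; field_simp; linarith
    have c1 : 0 < 12 * (u - 258) + 5 * y := by
      have := cross_lt (x := -20) (y := 48) (x' := u - 258) (y' := y) (by linarith)
        (by norm_num) hy (by rw [hcirc]; norm_num)
      linarith
    have e0 : g2 a b = l * (12 * (u - 258) + 5 * y) := by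
      unfold g2; linear_combination 12 * ha' + 5 * hb'
    have hl0 : 0 < l := by
      by_contra! hneg
      have := hV3 (by rw [e0]; exact mul_nonpos_of_nonpos_of_nonneg hneg c1.le)
      rw [g3, ha'] at this
      nlinarith
    refine ⟨hu, hu', by rw [e0]; positivity, ?_, l, y, hl0, hy, hcirc, ha', hb'⟩
    rw [g3, ha']; exact mul_nonpos_of_nonneg_of_nonpos hl0.le (by linarith)
  · right; right; right; right
    have h1 := h.deriv_eq_zero (by linarith) hd
    exact ⟨hu, by linarith⟩

lemma circle_param_unique {X y X' y' l l' R : ℝ} (hl : 0 < l) (hl' : 0 < l')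
    (h : X ^ 2 + y ^ 2 = R ^ 2) (h' : X' ^ 2 + y' ^ 2 = R ^ 2) (hR : 0 < R)
    (h1 : l * X = l' * X') (h2 : l * y = l' * y') : X = X' := by
  have h3 : (l * R) ^ 2 = (l' * R) ^ 2 := by
    have e : (l * R) ^ 2 = (l * X) ^ 2 + (l * y) ^ 2 := by linear_combination -l ^ 2 * h
    rw [e, h1, h2]; linear_combination l' ^ 2 * h'
  have h4 : l * R = l' * R := (pow_left_inj₀ (by positivity) (by positivity) two_ne_zero).1 h3
  have h5 : l = l' := mul_right_cancel₀ hR.ne' h4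
  subst h5
  exact mul_left_cancel₀ hl.ne' h1

/-- Outside `Bad`, the closest point on the half-strand is unique. -/
lemma IsProfMin.unique {a b u w : ℝ} (hW : 0 ≤ ss * a + cc * b) (hbad : ¬ Bad a b)
    (hu : IsProfMin a b u) (hw : IsProfMin a b w) : u = w := by
  have hs := ss_pos
  have key : ∀ {t : ℝ}, t ≤ u0 → g0 a b = (t - u0) / ss → g0 a b ≤ 0 := by
    intro t ht h
    rw [h]; exact div_nonpos_of_nonpos_of_nonneg (by linarith) hs.le
  have hcu := hu.cases hW hbad
  have hcw := hw.cases hW hbad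
  simp only [Bad, not_or, not_and, not_le] at hbad
  obtain ⟨-, hV1, hV2, hV3⟩ := hbad
  have i1 : g0 a b ≤ 0 → g1 a b < 0 ∧ g2 a b < 0 ∧ g3 a < 0 := fun h =>
    ⟨hV1 h, hV2 (hV1 h).le, hV3 (hV2 (hV1 h).le).le⟩
  have i2 : g1 a b ≤ 0 → g2 a b < 0 ∧ g3 a < 0 := fun h => ⟨hV2 h, hV3 (hV2 h).le⟩
  rcases hcu with ⟨hu1, h⟩ | ⟨hu1, hu2, ha, hb, l, y, hl, hy, hc, e1, e2⟩ |
    ⟨hu1, hu2, ha, hb, l, y, hl, hy, hc, e1, e2⟩ | ⟨hu1, hu2, ha, hb, l, y, hl, hy, hc, e1, e2⟩ |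
    ⟨hu1, ha⟩ <;>
  rcases hcw with ⟨hw1, h'⟩ | ⟨hw1, hw2, ha', hb', l', y', hl', hy', hc', e1', e2'⟩ |
    ⟨hw1, hw2, ha', hb', l', y', hl', hy', hc', e1', e2'⟩ |
    ⟨hw1, hw2, ha', hb', l', y', hl', hy', hc', e1', e2'⟩ | ⟨hw1, ha'⟩
  · rw [h] at h'
    have := (div_left_inj' hs.ne').1 h'
    linarith
  · linarith [key hu1 h]
  · linarith [(i1 (key hu1 h)).1]
  · linarith [(i1 (key hu1 h)).2.1]
  · have := (i1 (key hu1 h)).2.2; unfold g3 at this; linarith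
  · linarith [key hw1 h']
  · linarith [circle_param_unique hl hl' hc hc' (by norm_num) (by linarith) (by linarith)]
  · linarith
  · linarith [(i2 hb).1]
  · have := (i2 hb).2; unfold g3 at this; linarith
  · linarith [(i1 (key hw1 h')).1]
  · linarith
  · linarith [circle_param_unique hl hl' hc hc' (by norm_num) (by linarith) (by linarith)]
  · linarith
  · have := hV3 hb; unfold g3 at this; linarith
  · linarith [(i1 (key hw1 h')).2.1]
  · linarith [(i2 hb').1]
  · linarith
  · linarith [circle_param_unique hl hl' hc hc' (by norm_num) (by linarith) (by linarith)]
  · unfold g3 at hb; linarith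
  · have := (i1 (key hw1 h')).2.2; unfold g3 at this; linarith
  · have := (i2 hb').2; unfold g3 at this; linarith
  · have := hV3 hb'; unfold g3 at this; linarith
  · unfold g3 at hb'; linarith
  · linarith

/-! ### Sampling bounds along a half-strand -/

lemma sq_le_of_halfPlane {p q k x y : ℝ} (hk : 0 ≤ k) (h : k ≤ p * x + q * y) :
    k ^ 2 ≤ (p ^ 2 + q ^ 2) * (x ^ 2 + y ^ 2) := by
  have : k ^ 2 ≤ (p * x + q * y) ^ 2 := by gcongr
  nlinarith [sq_nonneg (p * y - q * x)]

lemma sq_le_edge {u v a b k : ℝ} (hk : 0 ≤ k) (h : ss * a - cc * b ≤ 0)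
    (h' : k ≤ ss * u - cc * v) : k ^ 2 ≤ (a - u) ^ 2 + (b - v) ^ 2 := by
  have := sq_le_of_halfPlane (p := -ss) (q := cc) (x := a - u) (y := b - v) hk (by linarith)
  linear_combination this + ((a - u) ^ 2 + (b - v) ^ 2) * cc_sq_add_ss_sq

lemma sq_le_g0 {u v a b k : ℝ} (hk : 0 ≤ k) (h : g0 a b ≤ 0)
    (h' : k ≤ g0 u v) : k ^ 2 ≤ (a - u) ^ 2 + (b - v) ^ 2 := by
  unfold g0 at *
  have := sq_le_of_halfPlane (p := -ss) (q := -cc) (x := a - u) (y := b - v) hk (by linarith)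
  linear_combination this + ((a - u) ^ 2 + (b - v) ^ 2) * cc_sq_add_ss_sq

lemma sq_le_g1 {u v a b k : ℝ} (hk : 0 ≤ k) (h : 0 ≤ g1 a b)
    (h' : 65 * k ≤ - g1 u v) : k ^ 2 ≤ (a - u) ^ 2 + (b - v) ^ 2 := by
  unfold g1 at *
  have := sq_le_of_halfPlane (p := 56) (q := -33) (x := a - u) (y := b - v) (k := 65 * k)
    (by linarith) (by linarith)
  linarith

lemma sq_le_g2 {u v a b k : ℝ} (hk : 0 ≤ k) (h : 0 ≤ g2 a b)
    (h' : 13 * k ≤ - g2 u v) : k ^ 2 ≤ (a - u) ^ 2 + (b - v) ^ 2 := by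
  unfold g2 at *
  have := sq_le_of_halfPlane (p := 12) (q := 5) (x := a - u) (y := b - v) (k := 13 * k)
    (by linarith) (by linarith)
  linarith

lemma sq_le_g3 {u v a b k : ℝ} (hk : 0 ≤ k) (h : 0 ≤ g3 a)
    (h' : k ≤ - g3 u) : k ^ 2 ≤ (a - u) ^ 2 + (b - v) ^ 2 := by
  unfold g3 at *
  have := sq_le_of_halfPlane (p := 1) (q := 0) (x := a - u) (y := b - v) (k := k)
    (by linarith) (by linarith)
  linarith

lemma le_of_cone1 {a b : ℝ} (h0 : g0 a b ≤ 0) (h1 : 0 ≤ g1 a b) : b ≤ -56 := by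
  have := ss_pos
  have := cc_pos
  unfold g0 g1 at *
  by_contra! h
  have h2 : 0 ≤ a - 147 := by linarith
  nlinarith [mul_pos cc_pos (show 0 < b + 56 by linarith)]

lemma ge_of_cone2 {a b : ℝ} (h0 : g1 a b ≤ 0) (h1 : 0 ≤ g2 a b) : 56 ≤ b := by
  unfold g1 g2 at *
  by_contra! h
  linarith

lemma le_of_cone3 {a b : ℝ} (h0 : g2 a b ≤ 0) (h1 : 0 ≤ g3 a) : b ≤ -52 := by
  unfold g2 g3 at *
  linarith

lemma sq_le_below {u v a b k c : ℝ} (hk : 0 ≤ k) (h : b ≤ c) (h' : k ≤ v - c) :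
    k ^ 2 ≤ (a - u) ^ 2 + (b - v) ^ 2 := by
  nlinarith [sq_nonneg (a - u)]

lemma sq_le_above {u v a b k c : ℝ} (hk : 0 ≤ k) (h : c ≤ b) (h' : k ≤ c - v) :
    k ^ 2 ≤ (a - u) ^ 2 + (b - v) ^ 2 := by
  nlinarith [sq_nonneg (a - u)]

lemma ss_mul_mid_bounds : 35.29 < ss * mid ∧ ss * mid < 35.31 := by
  obtain ⟨s1, s2⟩ := ss_bounds
  obtain ⟨m1, m2⟩ := mid_bounds
  constructor <;> nlinarith

lemma two_cc_ss_bounds : 0.7071 < 2 * cc * ss ∧ 2 * cc * ss < 0.7072 := by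
  obtain ⟨c1, c2⟩ := cc_bounds
  obtain ⟨s1, s2⟩ := ss_bounds
  constructor <;> nlinarith

/-- On the segment, up to its junction with the first arc, the sample point `(114, 0)` is close
enough. Here `0.5184 = 0.72 ^ 2`, and the summand `1` leaves room for a strict inequality between
infima. -/
lemma sampling_seg {u a b : ℝ} (hu : uM ≤ u) (hu' : u ≤ u0) (hbad : Bad a b) :
    (u - 114) ^ 2 + seg u ^ 2 + 1 ≤ 0.5184 * ((a - u) ^ 2 + (b - seg u) ^ 2) := by
  obtain ⟨c1, c2⟩ := cc_bounds
  obtain ⟨s1, s2⟩ := ss_bounds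
  obtain ⟨m1, m2⟩ := mid_bounds
  obtain ⟨u1, u2⟩ := u0_bounds
  obtain ⟨M1, M2⟩ := uM_bounds
  have e : cc * u - ss * seg u = mid := by
    have := ss_pos
    unfold seg; field_simp; ring
  -- the height above the edge of the octant, as a coordinate along the segment
  set Y := ss * u + cc * seg u with hY
  have hY0 : Y = (u - uM) / ss := by
    have := ss_pos
    rw [hY]; unfold seg uM; field_simp
    linear_combination u * cc_sq_add_ss_sq
  have hY1 : 0 ≤ Y := by rw [hY0]; exact div_nonneg (by linarith) (by linarith)
  have hY2 : Y ≤ 4.6 := by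
    rw [hY0, div_le_iff₀ (by linarith)]; linarith
  have eu : u = cc * mid + ss * Y := by rw [hY, ← e]; linear_combination -u * cc_sq_add_ss_sq
  have ev : seg u = cc * Y - ss * mid := by
    rw [hY, ← e]; linear_combination -seg u * cc_sq_add_ss_sq
  obtain ⟨p1, p2⟩ := two_cc_ss_bounds
  obtain ⟨k3, k2⟩ := ss_mul_mid_bounds
  have eu' : u = uM + ss * Y := by rw [eu]; unfold uM; ring
  have q1 : 0 ≤ ss * Y := mul_nonneg (by linarith) hY1
  have q2 : cc * Y ≤ 4.25 := by
    have := mul_le_mul c2.le hY2 hY1 (by norm_num)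
    linarith
  have q3 : 0 ≤ cc * Y := mul_nonneg (by linarith) hY1
  have hv1 : seg u ≤ -31 := by linarith
  have hv2 : -35.31 ≤ seg u := by linarith
  have k1 : (u - 114) ^ 2 ≤ 28.79 ^ 2 := sq_le_sq' (by linarith) (by linarith)
  have k4 : seg u ^ 2 ≤ 35.31 ^ 2 := sq_le_sq' (by linarith) (by linarith)
  have hd : (u - 114) ^ 2 + seg u ^ 2 ≤ 2076 := by linarith
  rcases hbad with h | ⟨h, h'⟩ | ⟨h, h'⟩ | ⟨h, h'⟩
  · have hw : 65.22 - 0.7072 * Y ≤ ss * u - cc * seg u := by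
      rw [← two_cc_ss_mul, e, ← hY]
      have := mul_le_mul_of_nonneg_right p1.le (show 0 ≤ mid - Y by linarith)
      linarith
    have h3 := sq_le_edge (u := u) (v := seg u) (by linarith) h hw
    have hd' : (u - 114) ^ 2 + seg u ^ 2 ≤ 2076 - 80 * Y + Y ^ 2 := by
      have e2 : (u - 114) ^ 2 + seg u ^ 2 =
          Y ^ 2 + ((uM - 114) ^ 2 + (ss * mid) ^ 2) -
          2 * (ss * (114 - uM) + cc * (ss * mid)) * Y := by
        rw [ev, eu']; linear_combination Y ^ 2 * cc_sq_add_ss_sq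
      have k1 : (uM - 114) ^ 2 ≤ 28.79 ^ 2 := sq_le_sq' (by linarith) (by linarith)
      have k4 : (ss * mid) ^ 2 ≤ 35.31 ^ 2 := sq_le_sq' (by linarith) (by linarith)
      have k5 : 40 ≤ ss * (114 - uM) + cc * (ss * mid) := by
        have j1 := mul_le_mul s1.le (show 28.77 ≤ 114 - uM by linarith) (by norm_num) (by linarith)
        have j2 := mul_le_mul c1.le k3.le (by norm_num) (by linarith)
        linarith
      have k6 := mul_le_mul_of_nonneg_right k5 hY1
      linarith
    clear_value Y
    clear * - h3 hd' hY1 hY2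
    nlinarith
  · have h3 : 0 ≤ (33 * cc - 56 * ss) * Y := mul_nonneg (by linarith) hY1
    have := sq_le_g1 (u := u) (v := seg u) (k := 63.7) (by norm_num) h'
      (by unfold g1; rw [ev, eu']; linarith)
    linarith
  · have := sq_le_g2 (u := u) (v := seg u) (k := 100) (by norm_num) h' (by unfold g2; linarith)
    linarith
  · have := sq_le_g3 (u := u) (v := seg u) (b := b) (k := 100) (by norm_num) h' (by unfold g3; linarith)
    linarith

/-- On the first arc, before the sample point `(114, 0)`. -/
lemma sampling_arc1_first {x y a b : ℝ} (hx : -(65 * cc) ≤ x) (hx' : x ≤ -33) (hy : 0 < y)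
    (h : x ^ 2 + y ^ 2 = 65 ^ 2) (hbad : Bad a b) :
    (x + 33) ^ 2 + (y - 56) ^ 2 + 1 ≤ 0.5184 * ((a - (x + 147)) ^ 2 + (b - (y - 56)) ^ 2) := by
  obtain ⟨c1, c2⟩ := cc_bounds
  obtain ⟨s1, s2⟩ := ss_bounds
  have hy1 : y ≤ 56 := by nlinarith
  have hy2 : 24.87 ≤ y := by
    by_contra! h
    nlinarith
  have hxy : 300 ≤ -4 * x + 3 * y := by
    by_contra! h
    nlinarith [mul_nonneg (show 0 ≤ x + 63 by linarith) (show 0 ≤ -33 - x by linarith)]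
  have hd : (x + 33) ^ 2 + (y - 56) ^ 2 ≤ 1705 := by nlinarith
  rcases hbad with h0 | ⟨h0, h1⟩ | ⟨h0, h1⟩ | ⟨h0, h1⟩
  · have h2 := sq_le_edge (u := x + 147) (v := y - 56) (k := ss * x - cc * y + 107.9)
      (by nlinarith) h0 (by linarith)
    have h3 : (104 : ℝ) * (ss * x - cc * y + 107.9) - 52 ^ 2 ≤ (ss * x - cc * y + 107.9) ^ 2 := by
      nlinarith [sq_nonneg (ss * x - cc * y + 107.9 - 52)]
    have h4 : 0.382684 * x ≤ ss * x := by nlinarith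
    have h5 : cc * y ≤ 0.92388 * y := by nlinarith
    have h6 : (x + 33) ^ 2 + (y - 56) ^ 2 = 8450 + 66 * x - 112 * y := by linear_combination h
    rw [h6]
    linarith
  · have h2 : 300 ≤ 4 * (a - (x + 147)) + (-3) * (b - (y - 56)) := by
      unfold g0 g1 at *
      nlinarith
    have := sq_le_of_halfPlane (by norm_num) h2
    linarith
  · have := sq_le_g2 (u := x + 147) (v := y - 56) (k := 100) (by norm_num) h1
      (by unfold g2; linarith)
    linarith
  · have := sq_le_g3 (u := x + 147) (v := y - 56) (b := b) (k := 100) (by norm_num) h1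
      (by unfold g3; linarith)
    linarith

/-- On the first arc, between the sample point `(114, 0)` and the apex. -/
lemma sampling_arc1_second {x y a b : ℝ} (hx : -33 ≤ x) (hx' : x ≤ 0) (hy : 0 < y)
    (h : x ^ 2 + y ^ 2 = 65 ^ 2) (hbad : Bad a b) :
    (x + 33) ^ 2 + (y - 56) ^ 2 + 1 ≤ 0.5184 * ((a - (x + 147)) ^ 2 + (b - (y - 56)) ^ 2) := by
  obtain ⟨c1, c2⟩ := cc_bounds
  obtain ⟨s1, s2⟩ := ss_bounds
  have hy1 : y ≤ 65 := by nlinarith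
  have hy2 : 56 ≤ y := by nlinarith
  have hxy : 715 + 3 * x ≤ 11 * y := by
    by_contra! h
    nlinarith [mul_nonneg (show 0 ≤ x + 33 by linarith) (show 0 ≤ - x by linarith)]
  have hd : (x + 33) ^ 2 + (y - 56) ^ 2 ≤ 1170 := by nlinarith
  rcases hbad with h0 | ⟨h0, h1⟩ | ⟨h0, h1⟩ | ⟨h0, h1⟩
  · have h2 := sq_le_edge (u := x + 147) (v := y - 56) (k := ss * x - cc * y + 107.99)
      (by nlinarith) h0 (by linarith)
    have h3 : (95.8 : ℝ) * (ss * x - cc * y + 107.99) - 47.9 ^ 2 ≤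
        (ss * x - cc * y + 107.99) ^ 2 := by
      nlinarith [sq_nonneg (ss * x - cc * y + 107.99 - 47.9)]
    have h4 : 0.382684 * x ≤ ss * x := by nlinarith
    have h5 : cc * y ≤ 0.92388 * y := by nlinarith
    have h6 : (x + 33) ^ 2 + (y - 56) ^ 2 = 8450 + 66 * x - 112 * y := by linear_combination h
    rw [h6]
    linarith
  · have := sq_le_below (u := x + 147) (v := y - 56) (a := a) (k := 56) (by norm_num)
      (le_of_cone1 h0 h1) (by linarith)
    linarith
  · have := sq_le_g2 (u := x + 147) (v := y - 56) (k := 48) (by norm_num) h1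
      (by unfold g2; linarith)
    linarith
  · have := sq_le_g3 (u := x + 147) (v := y - 56) (b := b) (k := 100) (by norm_num) h1
      (by unfold g3; linarith)
    linarith

/-- On the first arc, between the apex and the sample point `(180, 0)`. -/
lemma sampling_arc1_third {x y a b : ℝ} (hx : 0 ≤ x) (hx' : x ≤ 33) (hy : 0 < y)
    (h : x ^ 2 + y ^ 2 = 65 ^ 2) (hbad : Bad a b) :
    (x - 33) ^ 2 + (y - 56) ^ 2 + 1 ≤ 0.5184 * ((a - (x + 147)) ^ 2 + (b - (y - 56)) ^ 2) := by
  obtain ⟨c1, c2⟩ := cc_bounds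
  obtain ⟨s1, s2⟩ := ss_bounds
  have hy1 : y ≤ 65 := by nlinarith
  have hy2 : 56 ≤ y := by nlinarith
  have hd : (x - 33) ^ 2 + (y - 56) ^ 2 ≤ 1170 := by nlinarith
  rcases hbad with h0 | ⟨h0, h1⟩ | ⟨h0, h1⟩ | ⟨h0, h1⟩
  · have := sq_le_edge (u := x + 147) (v := y - 56) (k := 47.9)
      (by norm_num) h0 (by nlinarith)
    linarith
  · have := sq_le_g0 (u := x + 147) (v := y - 56) (k := 51) (by norm_num) h0
      (by unfold g0; nlinarith)
    linarith
  · have := sq_le_g2 (u := x + 147) (v := y - 56) (k := 48) (by norm_num) h1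
      (by unfold g2; linarith)
    linarith
  · have := sq_le_g3 (u := x + 147) (v := y - 56) (b := b) (k := 78) (by norm_num) h1
      (by unfold g3; linarith)
    linarith

/-- On the last two arcs, each half being close to one of the sample points `(180, 0)`,
`(258, 0)`. -/
lemma sampling_arc23 {u v a b : ℝ} (hu : 180 ≤ u) (hu' : u ≤ 258) (hv : -9 ≤ v) (hv' : v ≤ 0)
    (hbad : Bad a b) :
    (u ≤ 219 → (u - 180) ^ 2 + v ^ 2 + 1 ≤ 0.5184 * ((a - u) ^ 2 + (b - v) ^ 2)) ∧
    (219 ≤ u → (u - 258) ^ 2 + v ^ 2 + 1 ≤ 0.5184 * ((a - u) ^ 2 + (b - v) ^ 2)) := by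
  obtain ⟨c1, c2⟩ := cc_bounds
  obtain ⟨s1, s2⟩ := ss_bounds
  have hd1 : u ≤ 219 → (u - 180) ^ 2 + v ^ 2 ≤ 1602 := fun h => by nlinarith
  have hd2 : 219 ≤ u → (u - 258) ^ 2 + v ^ 2 ≤ 1602 := fun h => by nlinarith
  have fin : 56 ^ 2 ≤ (a - u) ^ 2 + (b - v) ^ 2 →
      (u ≤ 219 → (u - 180) ^ 2 + v ^ 2 + 1 ≤ 0.5184 * ((a - u) ^ 2 + (b - v) ^ 2)) ∧
      (219 ≤ u → (u - 258) ^ 2 + v ^ 2 + 1 ≤ 0.5184 * ((a - u) ^ 2 + (b - v) ^ 2)) :=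
    fun h => ⟨fun h' => by linarith [hd1 h'], fun h' => by linarith [hd2 h']⟩
  rcases hbad with h0 | ⟨h0, h1⟩ | ⟨h0, h1⟩ | ⟨h0, h1⟩
  · exact fin (sq_le_edge (by norm_num) h0 (by nlinarith))
  · exact fin (sq_le_g0 (by norm_num) h0 (by unfold g0; nlinarith))
  · exact fin (sq_le_above (by norm_num) (ge_of_cone2 h0 h1) (by linarith))
  · have hb := le_of_cone3 h0 h1
    have h2 : (258 - u) ^ 2 ≤ (a - u) ^ 2 := by unfold g3 at h1; nlinarith
    have h3 : 43 ^ 2 ≤ (b - v) ^ 2 := by nlinarith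
    refine ⟨fun h => ?_, fun h => ?_⟩ <;> nlinarith

lemma prof_bounds_of_mem {u : ℝ} (h : 180 ≤ u) : -9 ≤ prof u ∧ prof u ≤ 0 := by
  have := u0_bounds
  rcases prof_cases u with ⟨hu, hp, -⟩ | ⟨hu, hu', y, hy, hc, hp, -⟩ |
    ⟨hu, hu', y, hy, hc, hp, -⟩ | ⟨hu, hu', y, hy, hc, hp, -⟩ | ⟨hu, hp, -⟩
  · linarith
  · have h1 : u = 180 := by linarith
    subst h1
    have : y = 56 := (pow_left_inj₀ hy.le (by positivity) two_ne_zero).1 (by linarith)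
    rw [hp, this]; norm_num
  · rw [hp]; constructor <;> nlinarith
  · rw [hp]; constructor <;> nlinarith
  · rw [hp]; norm_num

/-- Every point of the half-strand up to the last sample point is close to one of the three sample
points, in comparison with its distance to `Bad`. -/
lemma exists_sample_of_prof {u : ℝ} (hu : uM ≤ u) (hu' : u ≤ 258) :
    ∃ t : ℝ, (t = 114 ∨ t = 180 ∨ t = 258) ∧ ∀ a b, Bad a b →
      (u - t) ^ 2 + prof u ^ 2 + 1 ≤ 0.5184 * ((a - u) ^ 2 + (b - prof u) ^ 2) := by
  rcases le_or_gt 180 u with h | h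
  · obtain ⟨h1, h2⟩ := prof_bounds_of_mem h
    rcases le_total u 219 with h3 | h3
    · exact ⟨180, by simp, fun a b hb => (sampling_arc23 h hu' h1 h2 hb).1 h3⟩
    · exact ⟨258, by simp, fun a b hb => (sampling_arc23 h hu' h1 h2 hb).2 h3⟩
  rcases prof_cases u with ⟨hu, hp, -⟩ | ⟨hu, hu', y, hy, hc, hp, -⟩ |
    ⟨hu, hu', -⟩ | ⟨hu, hu', -⟩ | ⟨hu, hp, -⟩
  · rw [hp]; exact ⟨114, by simp, fun a b hb => sampling_seg ‹_› hu hb⟩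
  · have e : prof u = y - 56 := by rw [hp]; ring
    have e2 : u - 147 + 147 = u := by ring
    have hx : -(65 * cc) ≤ u - 147 := by unfold u0 at hu; linarith
    rcases le_total u 114 with h1 | h1
    · refine ⟨114, by simp, fun a b hb => ?_⟩
      have := sampling_arc1_first hx (by linarith) hy hc hb
      rw [e2, ← e] at this; linarith
    rcases le_total u 147 with h1 | h1
    · refine ⟨114, by simp, fun a b hb => ?_⟩
      have := sampling_arc1_second (by linarith) (by linarith) hy hc hb
      rw [e2, ← e] at this; linarith
    · refine ⟨180, by simp, fun a b hb => ?_⟩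
      have := sampling_arc1_third (by linarith) (by linarith) hy hc hb
      rw [e2, ← e] at this; linarith
  · linarith
  · linarith
  · linarith

lemma not_bad_prof {u : ℝ} (hu : uM ≤ u) : ¬ Bad u (prof u) := by
  intro h
  rcases le_or_gt u 258 with h1 | h1
  · obtain ⟨t, -, ht⟩ := exists_sample_of_prof hu h1
    have := ht u (prof u) h
    simp only [sub_self] at this
    nlinarith [sq_nonneg (u - t), sq_nonneg (prof u)]
  · have hp : prof u = 0 := by
      rcases prof_cases u with ⟨hu, -⟩ | ⟨-, hu, -⟩ | ⟨-, hu, -⟩ | ⟨-, hu, -⟩ | ⟨-, hp, -⟩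
      · linarith [u0_bounds.2]
      · linarith
      · linarith
      · linarith
      · exact hp
    have := ss_pos
    have := cc_pos
    rw [hp] at h
    simp only [Bad, g0, g1, g2, g3] at h
    rcases h with h | ⟨h, h'⟩ | ⟨h, h'⟩ | ⟨h, h'⟩ <;> nlinarith

lemma prof_upper {u : ℝ} (hu : uM ≤ u) : 0 < ss * u - cc * prof u := by
  by_contra! h
  exact not_bad_prof hu (Or.inl h)

/-- A half-strand meets the edge of the octant only in its first point. -/
lemma prof_lower {u : ℝ} (hu : uM < u) : 0 < ss * u + cc * prof u := by
  obtain ⟨c1, c2⟩ := cc_bounds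
  obtain ⟨s1, s2⟩ := ss_bounds
  obtain ⟨u1, u2⟩ := u0_bounds
  rcases le_or_gt 180 u with h | h
  · have := prof_bounds_of_mem h
    nlinarith
  rcases prof_cases u with ⟨hu, hp, -⟩ | ⟨hu, hu', y, hy, hc, hp, -⟩ |
    ⟨hu, hu', -⟩ | ⟨hu, hu', -⟩ | ⟨hu, hp, -⟩
  · have : ss * u + cc * seg u = (u - uM) / ss := by
      have := ss_pos
      unfold seg uM; field_simp
      linear_combination u * cc_sq_add_ss_sq
    rw [hp, this]
    exact div_pos (by linarith) (by linarith)
  · rw [hp]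
    have hx : -(65 * cc) ≤ u - 147 := by unfold u0 at hu; linarith
    have hy2 : 24.8 ≤ y := by
      by_contra! h
      nlinarith
    nlinarith
  · linarith
  · linarith
  · linarith

lemma prof_lower_uM : ss * uM + cc * prof uM = 0 := by
  have h : prof uM = seg uM := glue_of_le (by linarith [uM_bounds.2, u0_bounds.1])
  rw [h, seg_uM]; unfold uM; ring

/-! ### The medial axis of a compact set -/

section General

variable {d : ℕ} {C : Set (EuclideanSpace ℝ (Fin d))}

lemma exists_isClosestPoint (hC : IsCompact C) (hne : C.Nonempty) (x : EuclideanSpace ℝ (Fin d)) :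
    ∃ p, IsClosestPoint C x p := by
  obtain ⟨p, hp, h⟩ := hC.exists_isMinOn hne (f := fun q => dist x q) (by fun_prop)
  exact ⟨p, hp, fun q hq => h hq⟩

lemma exists_two_closest (hC : IsCompact C) (hne : C.Nonempty) {x : EuclideanSpace ℝ (Fin d)}
    (hx : x ∈ medialAxis C) :
    ∃ p q, IsClosestPoint C x p ∧ IsClosestPoint C x q ∧ p ≠ q := by
  obtain ⟨p, hp⟩ := exists_isClosestPoint hC hne x
  by_contra! h
  exact hx ⟨p, hp, fun q hq => (h p q hp hq).symm⟩

lemma isClosestPoint_image (φ : EuclideanSpace ℝ (Fin d) ≃ᵢ EuclideanSpace ℝ (Fin d))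
    {x p : EuclideanSpace ℝ (Fin d)} :
    IsClosestPoint (φ '' C) (φ x) (φ p) ↔ IsClosestPoint C x p := by
  simp [IsClosestPoint, φ.injective.mem_set_image, φ.dist_eq]

lemma medialAxis_image (φ : EuclideanSpace ℝ (Fin d) ≃ᵢ EuclideanSpace ℝ (Fin d)) :
    medialAxis (φ '' C) = φ '' medialAxis C := by
  have key : ∀ x, φ x ∈ medialAxis (φ '' C) ↔ x ∈ medialAxis C := by
    intro x
    refine not_congr ⟨?_, ?_⟩
    · rintro ⟨q, hq, hu⟩
      obtain ⟨p, rfl⟩ := φ.surjective q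
      exact ⟨p, (isClosestPoint_image φ).1 hq,
        fun y hy => φ.injective (hu _ ((isClosestPoint_image φ).2 hy))⟩
    · rintro ⟨p, hp, hu⟩
      refine ⟨φ p, (isClosestPoint_image φ).2 hp, fun y hy => ?_⟩
      obtain ⟨y, rfl⟩ := φ.surjective y
      rw [hu y ((isClosestPoint_image φ).1 hy)]
  ext y
  obtain ⟨x, rfl⟩ := φ.surjective y
  rw [key, φ.injective.mem_set_image]

lemma localFeatureSize_image (φ : EuclideanSpace ℝ (Fin d) ≃ᵢ EuclideanSpace ℝ (Fin d))
    (p : EuclideanSpace ℝ (Fin d)) :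
    localFeatureSize (φ '' C) (φ p) = localFeatureSize C p := by
  rw [localFeatureSize, medialAxis_image, Metric.infEDist_image φ.isometry, localFeatureSize]

lemma localFeatureSize_pos {p : EuclideanSpace ℝ (Fin d)}
    (h : ∀ᶠ x in 𝓝 p, x ∉ medialAxis C) : 0 < localFeatureSize C p := by
  rw [pos_iff_ne_zero]
  intro h0
  have h1 : p ∈ closure (medialAxis C) := Metric.mem_closure_iff_infEDist_zero.2 h0
  rw [mem_closure_iff_frequently] at h1
  obtain ⟨x, hx, hx'⟩ := (h1.and_eventually h).exists
  exact hx' hx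

/-- On a compact set along which the local feature size is positive, it is bounded below. -/
lemma exists_le_localFeatureSize {D : Set (EuclideanSpace ℝ (Fin d))} (hD : IsCompact D)
    (h : ∀ p ∈ D, 0 < localFeatureSize C p) :
    ∃ δ : ℝ, 0 < δ ∧ ∀ p ∈ D, ENNReal.ofReal δ ≤ localFeatureSize C p := by
  rcases D.eq_empty_or_nonempty with rfl | hne
  · exact ⟨1, one_pos, by simp⟩
  obtain ⟨p, hp, hmin⟩ := hD.exists_isMinOn hne (f := localFeatureSize C)
    (Metric.continuous_infEDist.continuousOn)
  have hpos := h p hp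
  obtain ⟨r, hr0, hr⟩ := ENNReal.lt_iff_exists_nnreal_btwn.1 hpos
  refine ⟨r, by exact_mod_cast hr0, fun q hq => ?_⟩
  rw [ENNReal.ofReal_coe_nnreal]
  exact hr.le.trans (hmin hq)

end General

/-! ### The medial axis near a crossing -/

/-- The union of the eight half-strands around the origin, unbounded in the outward direction: the
preimage of the graph of the profile under the fold. -/
def strands : Set Plane := {z | uM ≤ uco z ∧ vco z = prof (uco z)}

lemma IsProfMin.eq_uM {a b u : ℝ} (hW : ss * a + cc * b = 0) (hbad : ¬ Bad a b)
    (h : IsProfMin a b u) : u = uM := by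
  have hs := ss_pos
  obtain ⟨c1, c2⟩ := cc_bounds
  obtain ⟨s1, s2⟩ := ss_bounds
  have hg : g0 a b = -147 * ss + 56 * cc := by unfold g0; linarith
  have hg0 : g0 a b ≤ 0 := by rw [hg]; linarith
  have hc := h.cases hW.ge hbad
  simp only [Bad, not_or, not_and, not_le] at hbad
  obtain ⟨-, hV1, hV2, hV3⟩ := hbad
  have h1 := hV1 hg0
  have h2 := hV2 h1.le
  have h3 := hV3 h2.le
  rcases hc with ⟨-, h⟩ | ⟨-, -, h, -⟩ | ⟨-, -, h, -⟩ | ⟨-, -, h, -⟩ | ⟨h, rfl⟩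
  · rw [hg, eq_div_iff hs.ne'] at h
    unfold uM mid
    unfold u0 at h
    linear_combination -h - 147 * cc_sq_add_ss_sq
  · linarith
  · linarith
  · linarith
  · unfold g3 at h3; linarith

lemma norm_sq_fold (z : Plane) : dist z 0 ^ 2 = uco z ^ 2 + vco z ^ 2 := by
  rw [dist_sq_eq, uco_sq_add_vco_sq]; simp

/-- If a compact set agrees with `strands` in a large disc, then its medial axis points that are
sufficiently far from the boundary of the disc are folded into `Bad`. -/
lemma bad_of_mem_medialAxis {C : Set Plane} (hC : IsCompact C) {ρ : ℝ}
    (hloc : ∀ z, dist z 0 < ρ → (z ∈ C ↔ z ∈ strands)) {x p : Plane} (hp : p ∈ C)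
    (hx : x ∈ medialAxis C) (hxp : dist x 0 + dist x p < ρ) : Bad (uco x) (vco x) := by
  by_contra hbad
  obtain ⟨q, q', hq, hq', hne⟩ := exists_two_closest hC ⟨p, hp⟩ hx
  have near : ∀ q, IsClosestPoint C x q →
      q ∈ strands ∧ IsProfMin (uco x) (vco x) (uco q) ∧
        dist x q ^ 2 = (uco x - uco q) ^ 2 + (vco x - vco q) ^ 2 := by
    intro q hq
    have hxq : dist x 0 + dist x q < ρ := by linarith [hq.2 p hp]
    have hq0 : dist q 0 < ρ := by linarith [dist_triangle q x 0, dist_comm x q]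
    have hqs : q ∈ strands := (hloc q hq0).1 hq.1
    have hd : dist x q ^ 2 = (uco x - uco q) ^ 2 + (vco x - vco q) ^ 2 := by
      refine le_antisymm ?_ (fold_dist_le x q)
      obtain ⟨z, hz1, hz2, hz3⟩ := exists_fold_preimage x (fold_lower q) (fold_upper q)
      have hz0 : dist z 0 = dist q 0 := by
        refine (pow_left_inj₀ dist_nonneg dist_nonneg two_ne_zero).1 ?_
        rw [norm_sq_fold, norm_sq_fold, hz1, hz2]
      have hzC : z ∈ C := (hloc z (hz0 ▸ hq0)).2 (by
        simp only [strands, mem_ofPred_eq, hz1, hz2]; exact hqs)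
      rw [← hz3]
      exact pow_le_pow_left₀ dist_nonneg (hq.2 z hzC) 2
    refine ⟨hqs, ⟨hqs.1, fun w hw => ?_⟩, hd⟩
    have hw' : 0 ≤ ss * w + cc * prof w := by
      rcases hw.eq_or_lt with rfl | h
      · exact prof_lower_uM.ge
      · exact (prof_lower h).le
    obtain ⟨z, hz1, hz2, hz3⟩ := exists_fold_preimage x hw' (prof_upper hw).le
    rw [← hqs.2, ← hd, ← hz3]
    refine pow_le_pow_left₀ dist_nonneg ?_ 2
    by_cases hz0 : dist z 0 < ρ
    · exact hq.2 z ((hloc z hz0).2 (by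
        simp only [strands, mem_ofPred_eq, hz1, hz2]; exact ⟨hw, trivial⟩))
    · linarith [dist_triangle z x 0, dist_comm x z]
  obtain ⟨h1, h2, h3⟩ := near q hq
  obtain ⟨h1', h2', h3'⟩ := near q' hq'
  have hu : uco q = uco q' := h2.unique (fold_lower x) hbad h2'
  have hv : vco q = vco q' := by rw [h1.2, h1'.2, hu]
  refine hne (fold_rigid hu hv h3 h3' ?_ ?_ ?_)
  · by_contra! h
    exact hbad (Or.inl h)
  · rw [h1.2]; exact prof_upper h1.1
  · rcases (fold_lower x).eq_or_lt with h | h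
    · right
      rw [h1.2, h2.eq_uM h.symm hbad, prof_lower_uM]
    · exact Or.inl h

lemma isClosed_bad : IsClosed {z : Plane | Bad (uco z) (vco z)} := by
  have := continuous_uco
  have := continuous_vco
  have e : IsClosed {z : Plane | ss * uco z - cc * vco z ≤ 0} :=
    isClosed_le (by fun_prop) (by fun_prop)
  have e0 : IsClosed {z : Plane | g0 (uco z) (vco z) ≤ 0} := by
    unfold g0; exact isClosed_le (by fun_prop) (by fun_prop)
  have e1 : IsClosed {z : Plane | 0 ≤ g1 (uco z) (vco z)} := by
    unfold g1; exact isClosed_le (by fun_prop) (by fun_prop)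
  have e1' : IsClosed {z : Plane | g1 (uco z) (vco z) ≤ 0} := by
    unfold g1; exact isClosed_le (by fun_prop) (by fun_prop)
  have e2 : IsClosed {z : Plane | 0 ≤ g2 (uco z) (vco z)} := by
    unfold g2; exact isClosed_le (by fun_prop) (by fun_prop)
  have e2' : IsClosed {z : Plane | g2 (uco z) (vco z) ≤ 0} := by
    unfold g2; exact isClosed_le (by fun_prop) (by fun_prop)
  have e3 : IsClosed {z : Plane | 0 ≤ g3 (uco z)} := by
    unfold g3; exact isClosed_le (by fun_prop) (by fun_prop)
  exact e.union ((e0.inter e1).union ((e1'.inter e2).union (e2'.inter e3)))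

lemma eventually_notMem_medialAxis_strands {C : Set Plane} (hC : IsCompact C) {ρ : ℝ}
    (hloc : ∀ z, dist z 0 < ρ → (z ∈ C ↔ z ∈ strands)) {p : Plane} (hp : p ∈ strands)
    (hp0 : dist p 0 < ρ) : ∀ᶠ x in 𝓝 p, x ∉ medialAxis C := by
  have h1 : ∀ᶠ x in 𝓝 p, ¬ Bad (uco x) (vco x) :=
    isClosed_bad.isOpen_compl.mem_nhds (by
      simp only [mem_compl_iff, mem_ofPred_eq, hp.2]; exact not_bad_prof hp.1)
  have h2 : ∀ᶠ x in 𝓝 p, dist x 0 + dist x p < ρ := by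
    have : Tendsto (fun x : Plane => dist x 0 + dist x p) (𝓝 p) (𝓝 (dist p 0 + dist p p)) :=
      Continuous.tendsto (by fun_prop) p
    exact this.eventually_lt_const (by simpa using hp0)
  filter_upwards [h1, h2] with x hx1 hx2 hx3
  exact hx1 (bad_of_mem_medialAxis hC hloc ((hloc p hp0).2 hp) hx3 hx2)

/-- Along the critical part of the strands, one of the sample points on the rays is close enough
for sampling with parameter `0.72`. -/
lemma exists_sample_of_strands {C : Set Plane} (hC : IsCompact C) {ρ : ℝ} (hρ : 1000 ≤ ρ)
    (hloc : ∀ z, dist z 0 < ρ → (z ∈ C ↔ z ∈ strands)) {p : Plane} (hp : p ∈ strands)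
    (hp0 : uco p ≤ 258) :
    ∃ s, (uco s = 114 ∨ uco s = 180 ∨ uco s = 258) ∧ vco s = 0 ∧
      edist p s < ENNReal.ofReal 0.72 * localFeatureSize C p := by
  obtain ⟨t, ht, hq⟩ := exists_sample_of_prof hp.1 hp0
  have hM := uM_bounds
  have hs := ss_pos
  have ht0 : 0 < t := by rcases ht with rfl | rfl | rfl <;> norm_num
  obtain ⟨s, hs1, hs2, hs3⟩ := exists_fold_preimage p (a := t) (b := 0) (by simp; positivity)
    (by simp; positivity)
  refine ⟨s, by rw [hs1]; exact ht, hs2, ?_⟩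
  rw [sub_zero] at hs3
  set D := dist p s with hD
  have hpn : dist p 0 < 300 := by
    have h1 := norm_sq_fold p
    have h2 : |vco p| ≤ |uco p * 0.5| := by
      have := fold_lower p
      have := fold_upper p
      obtain ⟨c1, c2⟩ := cc_bounds
      obtain ⟨s1, s2⟩ := ss_bounds
      have := hp.1
      rw [abs_of_nonneg (a := uco p * 0.5) (by linarith), abs_le]
      constructor <;> nlinarith
    have h3 := sq_le_sq.2 h2
    have h4 : uco p ^ 2 ≤ 258 ^ 2 := pow_le_pow_left₀ (by linarith [hp.1]) hp0 2
    nlinarith [dist_nonneg (x := p) (y := 0)]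
  have hpC : p ∈ C := (hloc p (by linarith)).2 hp
  have key : ∀ x ∈ medialAxis C, D ^ 2 + 1 ≤ 0.5184 * dist p x ^ 2 := by
    intro x hx
    rcases le_or_gt (dist p 0) (dist p x) with h | h
    · -- the centre of the crossing lies in `Bad`
      have h1 := hq 0 0 (Or.inl (by simp))
      have h2 := norm_sq_fold p
      have h3 := pow_le_pow_left₀ dist_nonneg h 2
      rw [hs3, hp.2]
      rw [hp.2] at h2
      linarith
    · have hx0 : dist x 0 + dist x p < ρ := by
        have := dist_triangle x p 0
        rw [dist_comm x p] at *
        linarith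
      have h1 := hq _ _ (bad_of_mem_medialAxis hC hloc hpC hx hx0)
      have h2 := fold_dist_le x p
      rw [dist_comm x p] at h2
      rw [hs3, hp.2]
      rw [hp.2] at h2
      linarith
  have hK : ENNReal.ofReal (√(D ^ 2 + 1) / 0.72) ≤ localFeatureSize C p := by
    rw [localFeatureSize, Metric.le_infEDist]
    intro x hx
    rw [edist_dist]
    refine ENNReal.ofReal_le_ofReal ?_
    rw [div_le_iff₀ (by norm_num), Real.sqrt_le_left (by positivity)]
    have := key x hx
    linarith
  calc edist p s = ENNReal.ofReal D := edist_dist p s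
    _ < ENNReal.ofReal (√(D ^ 2 + 1)) := by
        rw [ENNReal.ofReal_lt_ofReal_iff_of_nonneg dist_nonneg]
        exact Real.lt_sqrt_of_sq_lt (by linarith)
    _ = ENNReal.ofReal 0.72 * ENNReal.ofReal (√(D ^ 2 + 1) / 0.72) := by
        rw [← ENNReal.ofReal_mul (by norm_num)]
        congr 1; ring
    _ ≤ _ := by gcongr

/-! ### Simple arcs, closed curves and their components -/

section Arcs

variable {d : ℕ} {K K' : Set (EuclideanSpace ℝ (Fin d))} {p q r : EuclideanSpace ℝ (Fin d)}

/-- `K` is a simple arc from `p` to `q`: the injective continuous image of a nondegenerate interval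
whose endpoints are sent to `p` and `q`. -/
def IsSimpleArc (K : Set (EuclideanSpace ℝ (Fin d))) (p q : EuclideanSpace ℝ (Fin d)) : Prop :=
  ∃ (γ : ℝ → EuclideanSpace ℝ (Fin d)) (a b : ℝ), a < b ∧ ContinuousOn γ (Icc a b) ∧
    InjOn γ (Icc a b) ∧ γ a = p ∧ γ b = q ∧ γ '' Icc a b = K

lemma IsSimpleArc.symm (h : IsSimpleArc K p q) : IsSimpleArc K q p := by
  obtain ⟨γ, a, b, hab, hc, hi, rfl, rfl, rfl⟩ := h
  have hm : MapsTo Neg.neg (Icc (-b) (-a)) (Icc a b) := fun x hx =>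
    ⟨by linarith [hx.2], by linarith [hx.1]⟩
  refine ⟨fun u => γ (-u), -b, -a, by linarith, hc.comp continuousOn_neg hm,
    hi.comp neg_injective.injOn hm, by simp, by simp, ?_⟩
  rw [show (fun u => γ (-u)) = γ ∘ Neg.neg from rfl, image_comp]
  simp

lemma IsSimpleArc.left_mem (h : IsSimpleArc K p q) : p ∈ K := by
  obtain ⟨γ, a, b, hab, hc, hi, rfl, rfl, rfl⟩ := h
  exact mem_image_of_mem _ ⟨le_rfl, hab.le⟩

lemma IsSimpleArc.right_mem (h : IsSimpleArc K p q) : q ∈ K := h.symm.left_mem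

lemma IsSimpleArc.image (h : IsSimpleArc K p q)
    {φ : EuclideanSpace ℝ (Fin d) → EuclideanSpace ℝ (Fin d)} (hφ : Isometry φ) :
    IsSimpleArc (φ '' K) (φ p) (φ q) := by
  obtain ⟨γ, a, b, hab, hc, hi, rfl, rfl, rfl⟩ := h
  exact ⟨φ ∘ γ, a, b, hab, hφ.continuous.comp_continuousOn hc, hφ.injective.comp_injOn hi, rfl, rfl,
    image_comp _ _ _⟩

/-- The two paths of consecutive simple arcs combine to a path that is injective as long as its
endpoints are not compared with each other. -/
lemma exists_concat (h : IsSimpleArc K p q) (h' : IsSimpleArc K' q r)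
    (hKK : ∀ x ∈ K, x ∈ K' → x = q ∨ (x = p ∧ x = r)) :
    ∃ (γ : ℝ → EuclideanSpace ℝ (Fin d)) (ℓ : ℝ), 0 < ℓ ∧ ContinuousOn γ (Icc 0 ℓ) ∧
      InjOn γ (Ico 0 ℓ) ∧ γ 0 = p ∧ γ ℓ = r ∧ γ '' Icc 0 ℓ = K ∪ K' ∧
      ∀ u ∈ Ico 0 ℓ, γ u = r → r ∈ K := by
  obtain ⟨γ, a, b, hab, hc, hi, rfl, hb, rfl⟩ := h
  obtain ⟨γ', a', b', hab', hc', hi', ha', rfl, rfl⟩ := h'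
  set m := b - a with hm
  set ℓ := m + (b' - a') with hℓ
  set f : ℝ → EuclideanSpace ℝ (Fin d) :=
    fun u => if u ≤ m then γ (u + a) else γ' (u - m + a') with hf
  have f1 : ∀ u, u ≤ m → f u = γ (u + a) := fun u hu => if_pos hu
  have f2 : ∀ u, m ≤ u → f u = γ' (u - m + a') := by
    intro u hu
    rcases hu.eq_or_lt with rfl | h
    · rw [f1 _ le_rfl]; simp [hm, hb, ha']
    · exact if_neg (not_le.2 h)
  have m1 : ∀ u ∈ Icc 0 m, u + a ∈ Icc a b := fun u hu =>
    ⟨by linarith [hu.1], by linarith [hu.2]⟩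
  have m2 : ∀ u ∈ Icc m ℓ, u - m + a' ∈ Icc a' b' := fun u hu =>
    ⟨by linarith [hu.1], by linarith [hu.2]⟩
  have hU : Icc 0 ℓ = Icc 0 m ∪ Icc m ℓ :=
    (Icc_union_Icc_eq_Icc (by linarith) (by linarith)).symm
  have cross : ∀ u ∈ Icc 0 m, ∀ w ∈ Ico m ℓ, f u = f w → u = w := by
    intro u hu w hw h
    have h1 : f u = γ (u + a) := f1 u hu.2
    have h2 : f w = γ' (w - m + a') := f2 w hw.1
    have hw' := m2 w ⟨hw.1, hw.2.le⟩
    rcases hKK (f u) (h1 ▸ mem_image_of_mem _ (m1 u hu))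
      (h ▸ h2 ▸ mem_image_of_mem _ hw') with h3 | ⟨-, h3⟩
    · have e1 : u + a = b := hi (m1 u hu) ⟨hab.le, le_rfl⟩ (by rw [← h1, h3, hb])
      have e2 : w - m + a' = a' := hi' hw' ⟨le_rfl, hab'.le⟩ (by rw [← h2, ← h, h3, ha'])
      linarith
    · have e2 : w - m + a' = b' := hi' hw' ⟨hab'.le, le_rfl⟩ (by rw [← h2, ← h, h3])
      linarith [hw.2]
  refine ⟨f, ℓ, by linarith, ?_, ?_, ?_, ?_, ?_, ?_⟩
  · rw [hU]
    refine ContinuousOn.union_of_isClosed ?_ ?_ isClosed_Icc isClosed_Icc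
    · exact (hc.comp (f := fun u => u + a) (by fun_prop) m1).congr fun u hu => f1 u hu.2
    · exact (hc'.comp (f := fun u => u - m + a') (by fun_prop) m2).congr fun u hu => f2 u hu.1
  · intro u hu w hw h
    rcases le_total u m with h1 | h1 <;> rcases le_total w m with h2 | h2
    · rw [f1 u h1, f1 w h2] at h
      linarith [hi (m1 u ⟨hu.1, h1⟩) (m1 w ⟨hw.1, h2⟩) h]
    · exact cross u ⟨hu.1, h1⟩ w ⟨h2, hw.2⟩ h
    · exact (cross w ⟨hw.1, h2⟩ u ⟨h1, hu.2⟩ h.symm).symm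
    · rw [f2 u h1, f2 w h2] at h
      linarith [hi' (m2 u ⟨h1, hu.2.le⟩) (m2 w ⟨h2, hw.2.le⟩) h]
  · rw [f1 0 (by linarith), zero_add]
  · rw [f2 ℓ (by linarith)]; congr 1; linarith
  · rw [hU, image_union]
    congr 1
    · rw [image_congr (g := γ ∘ fun u => u + a) fun u hu => f1 u hu.2, image_comp]
      simp [hm]
    · rw [image_congr (g := γ' ∘ fun u => u - m + a') fun u hu => f2 u hu.1, image_comp]
      have : (fun u : ℝ => u - m + a') '' Icc m ℓ = Icc a' b' := by
        rw [show (fun u : ℝ => u - m + a') = (fun u => u + a') ∘ (fun u => u - m) from rfl,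
          image_comp]
        simp [hℓ]
      rw [this]
  · intro u hu h
    rcases le_total u m with h1 | h1
    · rw [← h, f1 u h1]; exact mem_image_of_mem _ (m1 u ⟨hu.1, h1⟩)
    · rw [f2 u h1] at h
      linarith [hi' (m2 u ⟨h1, hu.2.le⟩) ⟨hab'.le, le_rfl⟩ h, hu.2]

/-- Two simple arcs that meet only in a common endpoint form a simple arc. -/
lemma IsSimpleArc.concat (h : IsSimpleArc K p q) (h' : IsSimpleArc K' q r)
    (hKK : ∀ x ∈ K, x ∈ K' → x = q) : IsSimpleArc (K ∪ K') p r := by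
  have hqr : q ≠ r := by
    obtain ⟨γ, a, b, hab, hc, hi, rfl, rfl, rfl⟩ := h'
    intro e
    exact hab.ne (hi ⟨le_rfl, hab.le⟩ ⟨hab.le, le_rfl⟩ e)
  obtain ⟨γ, ℓ, hℓ, hc, hi, h0, h1, hK, hr⟩ := exists_concat h h' fun x hx hx' =>
    Or.inl (hKK x hx hx')
  have hrK : r ∉ K := fun hrK => hqr (hKK r hrK h'.right_mem).symm
  refine ⟨γ, 0, ℓ, hℓ, hc, ?_, h0, h1, hK⟩
  intro u hu w hw e
  rcases hu.2.eq_or_lt with hu' | hu' <;> rcases hw.2.eq_or_lt with hw' | hw'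
  · rw [hu', hw']
  · exact absurd (hr w ⟨hw.1, hw'⟩ (by rw [← e, hu', h1])) hrK
  · exact absurd (hr u ⟨hu.1, hu'⟩ (by rw [e, hw', h1])) hrK
  · exact hi ⟨hu.1, hu'⟩ ⟨hw.1, hw'⟩ e

/-- Two simple arcs with the same endpoints that do not meet elsewhere form a closed curve. -/
lemma IsSimpleArc.isClosedCurve_union (h : IsSimpleArc K p q) (h' : IsSimpleArc K' q p)
    (hKK : ∀ x ∈ K, x ∈ K' → x = p ∨ x = q) : IsClosedCurve (K ∪ K') := by
  obtain ⟨γ, ℓ, hℓ, hc, hi, h0, h1, hK, -⟩ := exists_concat h h' fun x hx hx' =>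
    (hKK x hx hx').symm.imp_right fun e => ⟨e, e⟩
  have : Fact (0 < ℓ) := ⟨hℓ⟩
  have hcont : Continuous (AddCircle.liftIco ℓ 0 γ) :=
    AddCircle.liftIco_zero_continuous (h0.trans h1.symm) hc
  have hinj : Function.Injective (AddCircle.liftIco ℓ 0 γ) := by
    intro x y e
    obtain ⟨u, hu, rfl⟩ := AddCircle.eq_coe_Ico x
    obtain ⟨w, hw, rfl⟩ := AddCircle.eq_coe_Ico y
    rw [AddCircle.liftIco_zero_coe_apply hu, AddCircle.liftIco_zero_coe_apply hw] at e
    rw [hi hu hw e]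
  have hrange : range (AddCircle.liftIco ℓ 0 γ) = K ∪ K' := by
    rw [← hK]
    apply Subset.antisymm
    · rintro _ ⟨x, rfl⟩
      obtain ⟨u, hu, rfl⟩ := AddCircle.eq_coe_Ico x
      rw [AddCircle.liftIco_zero_coe_apply hu]
      exact mem_image_of_mem _ ⟨hu.1, hu.2.le⟩
    · rintro _ ⟨u, hu, rfl⟩
      rcases hu.2.eq_or_lt with rfl | h
      · exact ⟨((0 : ℝ) : AddCircle u), by
          rw [AddCircle.liftIco_zero_coe_apply ⟨le_rfl, hℓ⟩, h0, h1]⟩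
      · exact ⟨(u : AddCircle ℓ), AddCircle.liftIco_zero_coe_apply ⟨hu.1, h⟩⟩
  let e := AddCircle.homeomorphCircle hℓ.ne'
  exact ⟨AddCircle.liftIco ℓ 0 γ ∘ e.symm, hcont.comp e.symm.continuous,
    hinj.comp e.symm.injective, by rw [e.symm.surjective.range_comp, hrange]⟩

/-- A chain of simple arcs, in which only consecutive arcs meet, is a simple arc. -/
lemma isSimpleArc_iUnion {Λ : ℕ → Set (EuclideanSpace ℝ (Fin d))}
    {m : ℕ → EuclideanSpace ℝ (Fin d)} {n : ℕ}
    (h : ∀ i ≤ n, IsSimpleArc (Λ i) (m i) (m (i + 1)))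
    (hd : ∀ i j, i < j → j ≤ n → ∀ x ∈ Λ i, x ∈ Λ j → j = i + 1 ∧ x = m j) :
    IsSimpleArc (⋃ i ∈ Iic n, Λ i) (m 0) (m (n + 1)) := by
  induction n with
  | zero => simpa using h 0 le_rfl
  | succ n ih =>
    have h1 := ih (fun i hi => h i (by omega)) (fun i j hij hj => hd i j hij (by omega))
    have : ⋃ i ∈ Iic (n + 1), Λ i = (⋃ i ∈ Iic n, Λ i) ∪ Λ (n + 1) := by
      ext x
      simp only [mem_iUnion, mem_Iic, mem_union, exists_prop, Nat.le_succ_iff, or_and_right,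
        exists_or, exists_eq_left]
    rw [this]
    refine h1.concat (h (n + 1) le_rfl) fun x hx hx' => ?_
    simp only [mem_iUnion, mem_Iic, exists_prop] at hx
    obtain ⟨i, hi, hx⟩ := hx
    exact (hd i (n + 1) (by omega) le_rfl x hx hx').2

/-- A cyclic family of simple arcs, in which only consecutive arcs meet, forms a closed curve. -/
lemma isClosedCurve_iUnion {Λ : ℕ → Set (EuclideanSpace ℝ (Fin d))}
    {m : ℕ → EuclideanSpace ℝ (Fin d)} {n : ℕ}
    (h : ∀ i ≤ n + 1, IsSimpleArc (Λ i) (m i) (m (i + 1))) (hm : m (n + 2) = m 0)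
    (hd : ∀ i j, i < j → j ≤ n + 1 → ∀ x ∈ Λ i, x ∈ Λ j →
      (j = i + 1 ∧ x = m j) ∨ (i = 0 ∧ j = n + 1 ∧ x = m 0)) :
    IsClosedCurve (⋃ i ∈ Iic (n + 1), Λ i) := by
  have h1 : IsSimpleArc (⋃ i ∈ Iic n, Λ i) (m 0) (m (n + 1)) := by
    refine isSimpleArc_iUnion (fun i hi => h i (by omega)) fun i j hij hj x hx hx' => ?_
    rcases hd i j hij (by omega) x hx hx' with h | ⟨-, h, -⟩
    · exact h
    · omega
  have : ⋃ i ∈ Iic (n + 1), Λ i = (⋃ i ∈ Iic n, Λ i) ∪ Λ (n + 1) := by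
    ext x
    simp only [mem_iUnion, mem_Iic, mem_union, exists_prop, Nat.le_succ_iff, or_and_right,
      exists_or, exists_eq_left]
  rw [this]
  refine h1.isClosedCurve_union (hm ▸ h (n + 1) le_rfl) fun x hx hx' => ?_
  simp only [mem_iUnion, mem_Iic, exists_prop] at hx
  obtain ⟨i, hi, hx⟩ := hx
  rcases hd i (n + 1) (by omega) le_rfl x hx hx' with h | ⟨-, -, h⟩
  · exact Or.inr h.2
  · exact Or.inl h

lemma IsClosedCurve.image (h : IsClosedCurve K)
    {φ : EuclideanSpace ℝ (Fin d) → EuclideanSpace ℝ (Fin d)} (hφ : Isometry φ) :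
    IsClosedCurve (φ '' K) := by
  obtain ⟨γ, hc, hi, rfl⟩ := h
  exact ⟨φ ∘ γ, hφ.continuous.comp hc, hφ.injective.comp hi, range_comp _ _⟩

lemma IsClosedCurve.isCompact (h : IsClosedCurve K) : IsCompact K := by
  obtain ⟨γ, hc, -, rfl⟩ := h
  exact isCompact_range hc

lemma isPreconnected_range_circle {γ : Circle → EuclideanSpace ℝ (Fin d)} (hc : Continuous γ) :
    IsPreconnected (range γ) := by
  have : range γ = range (fun t : ℝ => γ (Circle.exp t)) := by
    rw [show (fun t : ℝ => γ (Circle.exp t)) = γ ∘ Circle.exp from rfl,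
      Circle.exp_surjective.range_comp]
  rw [this]
  exact isPreconnected_range (by fun_prop)

lemma IsClosedCurve.isPreconnected (h : IsClosedCurve K) : IsPreconnected K := by
  obtain ⟨γ, hc, -, rfl⟩ := h
  exact isPreconnected_range_circle hc

lemma IsClosedCurve.nonempty (h : IsClosedCurve K) : K.Nonempty := by
  obtain ⟨γ, -, -, rfl⟩ := h
  exact range_nonempty γ

lemma IsClosedCurve.connectedComponentIn_eq (h : IsClosedCurve K) {a : EuclideanSpace ℝ (Fin d)}
    (ha : a ∈ K) : connectedComponentIn K a = K :=
  h.isPreconnected.connectedComponentIn ha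

variable {ι : Type*} [Finite ι] {F : ι → Set (EuclideanSpace ℝ (Fin d))}

lemma subset_of_isPreconnected_of_disjoint (hK : ∀ i, IsClosedCurve (F i))
    (hd : ∀ i j, i ≠ j → Disjoint (F i) (F j)) {T : Set (EuclideanSpace ℝ (Fin d))}
    (hT : IsPreconnected T) (hTF : T ⊆ ⋃ i, F i) {i : ι} (hi : (T ∩ F i).Nonempty) : T ⊆ F i := by
  have hc : ∀ j, IsClosed (F j) := fun j => (hK j).isCompact.isClosed
  have hcl : IsClosed (⋃ j : {j // j ≠ i}, F j) := isClosed_iUnion_of_finite fun j => hc j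
  intro x hx
  by_contra hxi
  obtain ⟨j, hj⟩ := mem_iUnion.1 (hTF hx)
  have hx' : x ∈ ⋃ j : {j // j ≠ i}, F j :=
    mem_iUnion.2 ⟨⟨j, fun e => hxi (e ▸ hj)⟩, hj⟩
  obtain ⟨y, -, hy, hy'⟩ := isPreconnected_closed_iff.1 hT (F i) _ (hc i) hcl (fun z hz => by
    obtain ⟨k, hk⟩ := mem_iUnion.1 (hTF hz)
    by_cases e : k = i
    · exact Or.inl (e ▸ hk)
    · exact Or.inr (mem_iUnion.2 ⟨⟨k, e⟩, hk⟩)) hi ⟨x, hx, hx'⟩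
  obtain ⟨⟨k, hk⟩, hy'⟩ := mem_iUnion.1 hy'
  exact disjoint_left.1 (hd i k hk.symm) hy hy'

/-- The components of a union of disjoint closed curves are these curves. -/
lemma connectedComponentIn_iUnion (hK : ∀ i, IsClosedCurve (F i))
    (hd : ∀ i j, i ≠ j → Disjoint (F i) (F j)) {i : ι} {a : EuclideanSpace ℝ (Fin d)}
    (ha : a ∈ F i) : connectedComponentIn (⋃ i, F i) a = F i := by
  have hF : F i ⊆ ⋃ i, F i := subset_iUnion F i
  refine Subset.antisymm ?_ ((hK i).isPreconnected.subset_connectedComponentIn ha hF)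
  exact subset_of_isPreconnected_of_disjoint hK hd isPreconnected_connectedComponentIn
    (connectedComponentIn_subset _ _) ⟨a, mem_connectedComponentIn (hF ha), ha⟩

lemma not_isPreconnected_iUnion (hK : ∀ i, IsClosedCurve (F i))
    (hd : ∀ i j, i ≠ j → Disjoint (F i) (F j)) {i j : ι} (hij : i ≠ j) :
    ¬ IsPreconnected (⋃ i, F i) := by
  intro h
  obtain ⟨x, hx⟩ := (hK i).nonempty
  obtain ⟨y, hy⟩ := (hK j).nonempty
  have := subset_of_isPreconnected_of_disjoint hK hd h Subset.rfl (i := i)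
    ⟨x, mem_iUnion.2 ⟨i, hx⟩, hx⟩ (mem_iUnion.2 ⟨j, hy⟩)
  exact disjoint_left.1 (hd i j hij) this hy

end Arcs

/-! ### The eight rays of a crossing -/

/-- The upper left entries of the eight symmetries of the square. These map the octant `0 ≤ y ≤ x`
to the octants in counterclockwise order: the `k`-th symmetry has rows `(al k, be k)` and
`(ga k, de k)`. -/
def al : Fin 8 → ℝ := ![1, 0, 0, -1, -1, 0, 0, 1]

/-- The upper right entries of the symmetries of the square; see `al`. -/
def be : Fin 8 → ℝ := ![0, 1, -1, 0, 0, -1, 1, 0]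

/-- The lower left entries of the symmetries of the square; see `al`. -/
def ga : Fin 8 → ℝ := ![0, 1, 1, 0, 0, -1, -1, 0]

/-- The lower right entries of the symmetries of the square; see `al`. -/
def de : Fin 8 → ℝ := ![1, 0, 0, 1, -1, 0, 0, -1]

/-- The point with coordinates `u` along the bisector of the `k`-th octant and `v` orthogonally to
it, as an image of the corresponding point of the first octant. -/
noncomputable def pt (k : Fin 8) (u v : ℝ) : Plane :=
  !₂[al k * (cc * u - ss * v) + be k * (ss * u + cc * v),
    ga k * (cc * u - ss * v) + de k * (ss * u + cc * v)]

lemma pt_zero (k : Fin 8) (u v : ℝ) :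
    pt k u v 0 = al k * (cc * u - ss * v) + be k * (ss * u + cc * v) := rfl

lemma pt_one (k : Fin 8) (u v : ℝ) :
    pt k u v 1 = ga k * (cc * u - ss * v) + de k * (ss * u + cc * v) := rfl

lemma octant_le {u v : ℝ} (h2 : 0 ≤ ss * u - cc * v) : ss * u + cc * v ≤ cc * u - ss * v := by
  have := two_cc_ss_mul u v
  have := mul_pos cc_pos ss_pos
  by_contra! h
  nlinarith

lemma octant_lt {u v : ℝ} (h2 : 0 < ss * u - cc * v) : ss * u + cc * v < cc * u - ss * v := by
  have := two_cc_ss_mul u v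
  have := mul_pos cc_pos ss_pos
  by_contra! h
  nlinarith

lemma max_min_pt (k : Fin 8) {u v : ℝ} (h1 : 0 ≤ ss * u + cc * v) (h2 : 0 ≤ ss * u - cc * v) :
    max |pt k u v 0| |pt k u v 1| = cc * u - ss * v ∧
      min |pt k u v 0| |pt k u v 1| = ss * u + cc * v := by
  have h := octant_le h2
  rw [pt_zero, pt_one]
  generalize cc * u - ss * v = X at *
  generalize ss * u + cc * v = Y at *
  have hX := h1.trans h
  fin_cases k <;> simp [al, be, ga, de, abs_of_nonneg h1, abs_of_nonneg hX, h]

lemma uco_pt (k : Fin 8) {u v : ℝ} (h1 : 0 ≤ ss * u + cc * v) (h2 : 0 ≤ ss * u - cc * v) :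
    uco (pt k u v) = u := by
  obtain ⟨e1, e2⟩ := max_min_pt k h1 h2
  rw [uco, e1, e2]; linear_combination u * cc_sq_add_ss_sq

lemma vco_pt (k : Fin 8) {u v : ℝ} (h1 : 0 ≤ ss * u + cc * v) (h2 : 0 ≤ ss * u - cc * v) :
    vco (pt k u v) = v := by
  obtain ⟨e1, e2⟩ := max_min_pt k h1 h2
  rw [vco, e1, e2]; linear_combination v * cc_sq_add_ss_sq

lemma exists_eq_pt (z : Plane) : ∃ k, z = pt k (uco z) (vco z) := by
  have key : ∀ k, z 0 = al k * max |z 0| |z 1| + be k * min |z 0| |z 1| →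
      z 1 = ga k * max |z 0| |z 1| + de k * min |z 0| |z 1| → z = pt k (uco z) (vco z) := by
    intro k h0 h1
    refine Plane.ext ?_ ?_
    · rw [pt_zero, ← max_abs_eq, ← min_abs_eq]; exact h0
    · rw [pt_one, ← max_abs_eq, ← min_abs_eq]; exact h1
  rcases le_total |z 0| |z 1| with h | h
  · rw [max_eq_right h, min_eq_left h] at key
    rcases le_total 0 (z 0) with h0 | h0 <;> rcases le_total 0 (z 1) with h1 | h1
    · exact ⟨1, key 1 (by simp [al, be, abs_of_nonneg h0]) (by simp [ga, de, abs_of_nonneg h1])⟩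
    · exact ⟨6, key 6 (by simp [al, be, abs_of_nonneg h0]) (by simp [ga, de, abs_of_nonpos h1])⟩
    · exact ⟨2, key 2 (by simp [al, be, abs_of_nonpos h0]) (by simp [ga, de, abs_of_nonneg h1])⟩
    · exact ⟨5, key 5 (by simp [al, be, abs_of_nonpos h0]) (by simp [ga, de, abs_of_nonpos h1])⟩
  · rw [max_eq_left h, min_eq_right h] at key
    rcases le_total 0 (z 0) with h0 | h0 <;> rcases le_total 0 (z 1) with h1 | h1
    · exact ⟨0, key 0 (by simp [al, be, abs_of_nonneg h0]) (by simp [ga, de, abs_of_nonneg h1])⟩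
    · exact ⟨7, key 7 (by simp [al, be, abs_of_nonneg h0]) (by simp [ga, de, abs_of_nonpos h1])⟩
    · exact ⟨3, key 3 (by simp [al, be, abs_of_nonpos h0]) (by simp [ga, de, abs_of_nonneg h1])⟩
    · exact ⟨4, key 4 (by simp [al, be, abs_of_nonpos h0]) (by simp [ga, de, abs_of_nonpos h1])⟩

lemma pt_injective {k l : Fin 8} {u v : ℝ} (h1 : 0 < ss * u + cc * v) (h2 : 0 < ss * u - cc * v)
    (h : pt k u v = pt l u v) : k = l := by
  have h0 : pt k u v 0 = pt l u v 0 := by rw [h]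
  have h1' : pt k u v 1 = pt l u v 1 := by rw [h]
  have hXY := octant_lt h2
  rw [pt_zero, pt_zero] at h0
  rw [pt_one, pt_one] at h1'
  generalize cc * u - ss * v = X at *
  generalize ss * u + cc * v = Y at *
  clear h h2
  fin_cases k <;> fin_cases l <;>
    first
    | rfl
    | (exfalso; simp [al, be, ga, de] at h0 h1'; linarith)

lemma dist_pt (k : Fin 8) (u v : ℝ) : dist (pt k u v) 0 ^ 2 = u ^ 2 + v ^ 2 := by
  have : (u ^ 2 + v ^ 2) * (cc ^ 2 + ss ^ 2) = u ^ 2 + v ^ 2 := by rw [cc_sq_add_ss_sq, mul_one]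
  rw [dist_sq_eq, pt_zero, pt_one, ← this]
  fin_cases k <;> simp [al, be, ga, de] <;> ring

lemma continuous_pt (k : Fin 8) : Continuous fun w : ℝ × ℝ => pt k w.1 w.2 := by
  unfold pt
  refine (PiLp.continuous_toLp 2 _).comp (continuous_pi fun i => ?_)
  fin_cases i <;> simp <;> fun_prop

/-! ### The strands of a crossing -/

lemma abs_prof_le {u : ℝ} (h : uM ≤ u) : |prof u| ≤ u * 0.5 := by
  have h1 := prof_upper h
  have h2 : 0 ≤ ss * u + cc * prof u := by
    rcases h.eq_or_lt with rfl | h'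
    · exact prof_lower_uM.ge
    · exact (prof_lower h').le
  obtain ⟨c1, c2⟩ := cc_bounds
  obtain ⟨s1, s2⟩ := ss_bounds
  have := uM_bounds
  rw [abs_le]
  constructor <;> nlinarith

/-- A sign distinguishes the two states of a crossing: the strands join the rays across the
coordinate axes for `ε = 1` and across the diagonals for `ε = -1`. -/
def IsSign (ε : ℝ) : Prop := ε = 1 ∨ ε = -1

section State

variable {ε δ : ℝ}

lemma state_lower (hε : IsSign ε) {u : ℝ} (h : uM ≤ u) : 0 ≤ ss * u + cc * (ε * prof u) := by
  rcases hε with rfl | rfl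
  · rcases h.eq_or_lt with rfl | h'
    · linarith [prof_lower_uM]
    · linarith [prof_lower h']
  · linarith [prof_upper h]

lemma state_upper (hε : IsSign ε) {u : ℝ} (h : uM ≤ u) : 0 ≤ ss * u - cc * (ε * prof u) := by
  rcases hε with rfl | rfl
  · linarith [prof_upper h]
  · rcases h.eq_or_lt with rfl | h'
    · linarith [prof_lower_uM]
    · linarith [prof_lower h']

lemma state_lower_pos (hε : IsSign ε) {u : ℝ} (h : uM < u) : 0 < ss * u + cc * (ε * prof u) := by
  rcases hε with rfl | rfl
  · linarith [prof_lower h]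
  · linarith [prof_upper h.le]

lemma state_upper_pos (hε : IsSign ε) {u : ℝ} (h : uM < u) : 0 < ss * u - cc * (ε * prof u) := by
  rcases hε with rfl | rfl
  · linarith [prof_upper h.le]
  · linarith [prof_lower h]

/-- The half-strand of a crossing in state `ε` that goes outwards into the `k`-th octant, cut off
at the radius `1000`. -/
def halfStrand (ε : ℝ) (k : Fin 8) : Set Plane := (fun u => pt k u (ε * prof u)) '' Icc uM 1000

lemma IsSign.sq (hε : IsSign ε) : ε ^ 2 = 1 := by rcases hε with rfl | rfl <;> norm_num

lemma prof_of_ge {u : ℝ} (h : 258 ≤ u) : prof u = 0 := by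
  have := u0_bounds
  rcases prof_cases u with ⟨h', -⟩ | ⟨-, h', -⟩ | ⟨-, h', -⟩ | ⟨-, h', y, hy, hc, e, -⟩ | ⟨-, h', -⟩
  · linarith
  · linarith
  · linarith
  · obtain rfl : u = 258 := le_antisymm h' h
    rw [e, (pow_left_inj₀ hy.le (by norm_num : (0 : ℝ) ≤ 52) two_ne_zero).1 (by linarith)]
    norm_num
  · exact h'

lemma prof_eq_zero {u : ℝ} (h : u = 114 ∨ u = 180 ∨ u = 258) : prof u = 0 := by
  have := u0_bounds
  rcases h with h | h | h
  · rcases prof_cases u with ⟨h', -⟩ | ⟨-, h', y, hy, hc, e, -⟩ | ⟨h', -⟩ | ⟨h', -⟩ | ⟨h', -⟩ <;>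
      try linarith
    rw [e, (pow_left_inj₀ hy.le (by norm_num : (0 : ℝ) ≤ 56) two_ne_zero).1 (by rw [h] at hc; linarith)]
    norm_num
  · rcases prof_cases u with ⟨h', -⟩ | ⟨-, h', y, hy, hc, e, -⟩ | ⟨h', -⟩ | ⟨h', -⟩ | ⟨h', -⟩ <;>
      try linarith
    rw [e, (pow_left_inj₀ hy.le (by norm_num : (0 : ℝ) ≤ 56) two_ne_zero).1 (by rw [h] at hc; linarith)]
    norm_num
  · exact prof_of_ge h.ge

/-- The middle of the strand that goes into the `k`-th octant. -/
noncomputable def midpt (ε : ℝ) (k : Fin 8) : Plane := pt k uM (ε * prof uM)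

lemma isSimpleArc_halfStrand (hε : IsSign ε) (k : Fin 8) :
    IsSimpleArc (halfStrand ε k) (midpt ε k) (pt k 1000 0) := by
  have := uM_bounds
  refine ⟨_, uM, 1000, by linarith, ?_, ?_, rfl, ?_, rfl⟩
  · have := continuous_prof
    exact ((continuous_pt k).comp (f := fun u => (u, ε * prof u)) (by fun_prop)).continuousOn
  · intro u hu w hw h
    have h' := congrArg uco h
    rwa [uco_pt k (state_lower hε hu.1) (state_upper hε hu.1),
      uco_pt k (state_lower hε hw.1) (state_upper hε hw.1)] at h'
  · rw [prof_of_ge (by norm_num), mul_zero]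

lemma halfStrand_inter (hε : IsSign ε) {k l : Fin 8} (hkl : k ≠ l) {z : Plane}
    (hk : z ∈ halfStrand ε k) (hl : z ∈ halfStrand ε l) : z = midpt ε k ∧ z = midpt ε l := by
  obtain ⟨u, hu, rfl⟩ := hk
  obtain ⟨w, hw, h⟩ := hl
  have h' := congrArg uco h
  simp only at h h'
  rw [uco_pt k (state_lower hε hu.1) (state_upper hε hu.1),
    uco_pt l (state_lower hε hw.1) (state_upper hε hw.1)] at h'
  subst h'
  rcases hu.1.eq_or_lt with rfl | h1
  · exact ⟨rfl, h.symm⟩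
  · exact absurd (pt_injective (state_lower_pos hε h1) (state_upper_pos hε h1) h).symm hkl

lemma mem_halfStrand_iff (hε : IsSign ε) {z : Plane} (hz : dist z 0 ≤ 1000) :
    (∃ k, z ∈ halfStrand ε k) ↔ uM ≤ uco z ∧ vco z = ε * prof (uco z) := by
  constructor
  · rintro ⟨k, u, hu, rfl⟩
    simp only
    rw [uco_pt k (state_lower hε hu.1) (state_upper hε hu.1),
      vco_pt k (state_lower hε hu.1) (state_upper hε hu.1)]
    exact ⟨hu.1, rfl⟩
  · rintro ⟨h1, h2⟩
    obtain ⟨k, hk⟩ := exists_eq_pt z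
    refine ⟨k, uco z, ⟨h1, ?_⟩, ?_⟩
    · have := norm_sq_fold z
      nlinarith [dist_nonneg (x := z) (y := 0), sq_nonneg (vco z)]
    · simp only
      rw [← h2, ← hk]

lemma dist_halfStrand (hε : IsSign ε) {k : Fin 8} {z : Plane} (hz : z ∈ halfStrand ε k) :
    dist z 0 ≤ 1000 ∧ (dist z 0 = 1000 → z = pt k 1000 0) := by
  obtain ⟨u, hu, rfl⟩ := hz
  have h := dist_pt k u (ε * prof u)
  rw [mul_pow, hε.sq, one_mul] at h
  simp only
  have hM := uM_bounds
  rcases le_or_gt 258 u with h1 | h1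
  · rw [prof_of_ge h1] at h ⊢
    have : dist (pt k u (ε * 0)) 0 = u := by
      have : 0 ≤ u := by linarith
      exact (pow_left_inj₀ dist_nonneg this two_ne_zero).1 (by linarith)
    rw [this]
    exact ⟨hu.2, fun e => by rw [e, mul_zero]⟩
  · have h2 := pow_le_pow_left₀ (abs_nonneg _) (abs_prof_le hu.1) 2
    rw [sq_abs] at h2
    have h3 : dist (pt k u (ε * prof u)) 0 < 1000 := by
      refine lt_of_pow_lt_pow_left₀ 2 (by norm_num) ?_
      nlinarith [hu.1]
    exact ⟨h3.le, fun e => absurd e h3.ne⟩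

end State

/-! ### The circular arms between the two places -/

/-- The reflection in the vertical axis. -/
noncomputable def flip : Plane ≃ᵢ Plane :=
  IsometryEquiv.mk' (fun z => !₂[-z 0, z 1]) (fun z => !₂[-z 0, z 1])
    (fun z => Plane.ext (by simp) (by simp))
    (Isometry.of_dist_eq fun z w => (pow_left_inj₀ dist_nonneg dist_nonneg two_ne_zero).1 (by
      rw [dist_sq_eq, dist_sq_eq]; simp; ring))

/-- The translation of the origin to the left place. -/
noncomputable def shift : Plane ≃ᵢ Plane :=
  IsometryEquiv.mk' (fun z => !₂[z 0 - 2000, z 1]) (fun z => !₂[z 0 + 2000, z 1])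
    (fun z => Plane.ext (by simp) (by simp))
    (Isometry.of_dist_eq fun z w => (pow_left_inj₀ dist_nonneg dist_nonneg two_ne_zero).1 (by
      rw [dist_sq_eq, dist_sq_eq]; simp))

lemma flip_apply_zero (z : Plane) : flip z 0 = -z 0 := rfl

lemma flip_apply_one (z : Plane) : flip z 1 = z 1 := rfl

lemma shift_apply_zero (z : Plane) : shift z 0 = z 0 - 2000 := rfl

lemma shift_apply_one (z : Plane) : shift z 1 = z 1 := rfl

lemma flip_flip (z : Plane) : flip (flip z) = z :=
  Plane.ext (by simp [flip_apply_zero]) (by simp [flip_apply_one])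

lemma flip_image_flip_image (K : Set Plane) : flip '' (flip '' K) = K := by
  rw [← image_comp, show flip ∘ flip = id from funext flip_flip, image_id]

/-- The left place. -/
noncomputable def place : Plane := shift 0

lemma dist_place_sq (z : Plane) : dist z place ^ 2 = (z 0 + 2000) ^ 2 + z 1 ^ 2 := by
  rw [dist_sq_eq, place, shift_apply_zero, shift_apply_one]; simp

lemma dist_shift_place (z : Plane) : dist (shift z) place = dist z 0 := shift.dist_eq z 0

/-- The (signed) radius of the arm with half-angle `θ`. -/
noncomputable def rad (θ : ℝ) : ℝ := (2000 - 1000 * Real.cos θ) / Real.sin θ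

/-- The height of the centre of the arm with half-angle `θ`. -/
noncomputable def ht (θ : ℝ) : ℝ := (1000 - 2000 * Real.cos θ) / Real.sin θ

/-- The arm that leaves the disc of radius `1000` around the left place radially in the direction
`θ` and ends symmetrically at the right place, with parameter in `[-1, 1]`. -/
noncomputable def armPt (θ s : ℝ) : Plane :=
  !₂[rad θ * Real.sin (s * θ), ht θ + rad θ * Real.cos (s * θ)]

lemma armPt_zero (θ s : ℝ) : armPt θ s 0 = rad θ * Real.sin (s * θ) := rfl

lemma armPt_one (θ s : ℝ) : armPt θ s 1 = ht θ + rad θ * Real.cos (s * θ) := rfl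

section Arm

variable {θ s : ℝ}

/-- Half-angles of arms: nonzero, strictly between `-π` and `π`. -/
def IsArmAngle (θ : ℝ) : Prop := 0 < |θ| ∧ |θ| < Real.pi

lemma IsArmAngle.sin_ne_zero (hθ : IsArmAngle θ) : Real.sin θ ≠ 0 := by
  obtain ⟨h1, h2⟩ := hθ
  intro h
  have := (abs_lt.1 h2)
  rw [Real.sin_eq_zero_iff_of_lt_of_lt this.1 this.2] at h
  exact h1.ne' (by simp [h])

lemma IsArmAngle.ne_zero (hθ : IsArmAngle θ) : θ ≠ 0 := abs_pos.1 hθ.1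

lemma rad_mul_sin (hθ : IsArmAngle θ) : rad θ * Real.sin θ = 2000 - 1000 * Real.cos θ :=
  div_mul_cancel₀ _ hθ.sin_ne_zero

lemma ht_mul_sin (hθ : IsArmAngle θ) : ht θ * Real.sin θ = 1000 - 2000 * Real.cos θ :=
  div_mul_cancel₀ _ hθ.sin_ne_zero

lemma rad_ne_zero (hθ : IsArmAngle θ) : rad θ ≠ 0 := by
  intro h
  have := rad_mul_sin hθ
  rw [h] at this
  linarith [Real.cos_le_one θ]

lemma ht_sq_sub_rad_sq (hθ : IsArmAngle θ) : ht θ ^ 2 + 2000 ^ 2 - 1000 ^ 2 = rad θ ^ 2 := by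
  have h := hθ.sin_ne_zero
  have h1 := rad_mul_sin hθ
  have h2 := ht_mul_sin hθ
  refine mul_right_cancel₀ (pow_ne_zero 2 h) ?_
  linear_combination (ht θ * Real.sin θ + (1000 - 2000 * Real.cos θ)) * h2 -
    (rad θ * Real.sin θ + (2000 - 1000 * Real.cos θ)) * h1 +
    (2000 ^ 2 - 1000 ^ 2) * Real.sin_sq_add_cos_sq θ

lemma armPt_neg : armPt θ (-s) = flip (armPt θ s) := by
  refine Plane.ext ?_ ?_
  · rw [flip_apply_zero, armPt_zero, armPt_zero, neg_mul, Real.sin_neg]; ring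
  · rw [flip_apply_one, armPt_one, armPt_one, neg_mul, Real.cos_neg]

lemma armPt_circle (hθ : IsArmAngle θ) :
    armPt θ s 0 ^ 2 + armPt θ s 1 ^ 2 - 2 * ht θ * armPt θ s 1 = 2000 ^ 2 - 1000 ^ 2 := by
  rw [armPt_zero, armPt_one]
  linear_combination rad θ ^ 2 * Real.sin_sq_add_cos_sq (s * θ) - ht_sq_sub_rad_sq hθ

lemma armPt_left_zero (hθ : IsArmAngle θ) : armPt θ (-1) 0 = 1000 * Real.cos θ - 2000 := by
  rw [armPt_zero, neg_one_mul, Real.sin_neg]; linarith [rad_mul_sin hθ]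

lemma armPt_left_one (hθ : IsArmAngle θ) : armPt θ (-1) 1 = 1000 * Real.sin θ := by
  rw [armPt_one, neg_one_mul, Real.cos_neg]
  refine mul_right_cancel₀ hθ.sin_ne_zero ?_
  linear_combination ht_mul_sin hθ + Real.cos θ * rad_mul_sin hθ -
    1000 * Real.sin_sq_add_cos_sq θ

lemma cos_le_cos_mul (hθ : IsArmAngle θ) (hs : s ∈ Icc (-1 : ℝ) 1) :
    Real.cos θ ≤ Real.cos (s * θ) := by
  rw [← Real.cos_abs θ, ← Real.cos_abs (s * θ), abs_mul]
  refine Real.cos_le_cos_of_nonneg_of_le_pi (by positivity) hθ.2.le ?_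
  have := abs_le.2 hs
  nlinarith [abs_nonneg θ]

/-- The upper arms lie strictly above the horizontal axis, the lower ones strictly below. -/
lemma armPt_side (hθ : IsArmAngle θ) (hs : s ∈ Icc (-1 : ℝ) 1) :
    0 < Real.sin θ * armPt θ s 1 := by
  have h1 := cos_le_cos_mul hθ hs
  have h2 : Real.sin θ * armPt θ s 1 =
      1000 * Real.sin θ ^ 2 +
        (2000 - 1000 * Real.cos θ) * (Real.cos (s * θ) - Real.cos θ) := by
    rw [armPt_one]
    linear_combination ht_mul_sin hθ + Real.cos (s * θ) * rad_mul_sin hθ -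
      1000 * Real.sin_sq_add_cos_sq θ
  have h3 : 0 < Real.sin θ ^ 2 := by have := hθ.sin_ne_zero; positivity
  have h4 : 0 ≤ 2000 - 1000 * Real.cos θ := by linarith [Real.cos_le_one θ]
  rw [h2]
  nlinarith [mul_nonneg h4 (sub_nonneg.2 h1)]

lemma dist_armPt (hθ : IsArmAngle θ) (hs : s ∈ Icc (-1 : ℝ) 1) :
    1000 ≤ dist (armPt θ s) place ∧ (dist (armPt θ s) place = 1000 → s = -1) := by
  have h1 := cos_le_cos_mul hθ hs
  have h2 := Real.cos_le_one ((s + 1) * θ)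
  have h3 : 0 < Real.sin θ ^ 2 := by have := hθ.sin_ne_zero; positivity
  have h4 : 0 < 2000 - 1000 * Real.cos θ := by linarith [Real.cos_le_one θ]
  have key : (dist (armPt θ s) place ^ 2 - 1000 ^ 2) * Real.sin θ ^ 2 =
      2 * (2000 - 1000 * Real.cos θ) * (2000 * (1 - Real.cos ((s + 1) * θ)) +
        1000 * (Real.cos (s * θ) - Real.cos θ)) := by
    rw [dist_place_sq, armPt_zero, armPt_one, show (s + 1) * θ = s * θ + θ by ring, Real.cos_add]
    have e1 := rad_mul_sin hθ
    have e2 := ht_mul_sin hθ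
    have e3 := ht_sq_sub_rad_sq hθ
    have e4 := Real.sin_sq_add_cos_sq (s * θ)
    generalize Real.sin (s * θ) = x at *
    generalize Real.cos (s * θ) = y at *
    generalize Real.cos θ = c at *
    generalize Real.sin θ = t at *
    linear_combination rad θ ^ 2 * t ^ 2 * e4 + t ^ 2 * e3 +
      (2 * rad θ * t + 2 * (2000 - 1000 * c) + 2 * y * ht θ * t + 4000 * x * t) * e1 +
      2 * y * (2000 - 1000 * c) * e2
  have h5 : 0 ≤ 2000 * (1 - Real.cos ((s + 1) * θ)) + 1000 * (Real.cos (s * θ) - Real.cos θ) := by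
    linarith
  constructor
  · have h6 : 0 ≤ (dist (armPt θ s) place ^ 2 - 1000 ^ 2) * Real.sin θ ^ 2 := by
      rw [key]; positivity
    have h7 := nonneg_of_mul_nonneg_left h6 h3
    exact (pow_le_pow_iff_left₀ (by norm_num) dist_nonneg two_ne_zero).1 (by linarith)
  · intro h
    rw [h, sub_self, zero_mul] at key
    have h8 := (mul_eq_zero.1 key.symm).resolve_left (by positivity)
    have h9 : Real.cos ((s + 1) * θ) = 1 := by linarith
    have hb : |(s + 1) * θ| < 2 * Real.pi := by
      rw [abs_mul]
      have := hθ.2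
      have h10 : |s + 1| ≤ 2 := abs_le.2 ⟨by linarith [hs.1], by linarith [hs.2]⟩
      nlinarith [abs_nonneg θ]
    rw [Real.cos_eq_one_iff_of_lt_of_lt (abs_lt.1 hb).1 (abs_lt.1 hb).2] at h9
    have := (mul_eq_zero.1 h9).resolve_right hθ.ne_zero
    linarith

lemma armPt_injOn (hθ : IsArmAngle θ) : InjOn (armPt θ) (Icc (-1) 1) := by
  intro s hs t ht h
  have hr := rad_ne_zero hθ
  have h0 : armPt θ s 0 = armPt θ t 0 := by rw [h]
  have h1 : armPt θ s 1 = armPt θ t 1 := by rw [h]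
  rw [armPt_zero, armPt_zero] at h0
  rw [armPt_one, armPt_one] at h1
  have h0' := mul_left_cancel₀ hr h0
  have h1' := mul_left_cancel₀ hr (add_left_cancel h1)
  have h9 : Real.cos (s * θ - t * θ) = 1 := by
    rw [Real.cos_sub, h0', h1']; linarith [Real.sin_sq_add_cos_sq (t * θ)]
  have hb : |s * θ - t * θ| < 2 * Real.pi := by
    rw [← sub_mul, abs_mul]
    have := hθ.2
    have h10 : |s - t| ≤ 2 := abs_le.2 ⟨by linarith [hs.1, ht.2], by linarith [hs.2, ht.1]⟩
    nlinarith [abs_nonneg θ]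
  rw [Real.cos_eq_one_iff_of_lt_of_lt (abs_lt.1 hb).1 (abs_lt.1 hb).2, ← sub_mul] at h9
  have := (mul_eq_zero.1 h9).resolve_right hθ.ne_zero
  linarith

lemma continuous_armPt (θ : ℝ) : Continuous (armPt θ) := by
  unfold armPt
  refine (PiLp.continuous_toLp 2 _).comp (continuous_pi fun i => ?_)
  fin_cases i <;> simp <;> fun_prop

end Arm

/-- The direction of the `k`-th ray, as an angle between `-π` and `π`. -/
noncomputable def ang (k : Fin 8) : ℝ := (![1, 3, 5, 7, -7, -5, -3, -1] : Fin 8 → ℝ) k *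
  (Real.pi / 8)

lemma isArmAngle_ang (k : Fin 8) : IsArmAngle (ang k) := by
  have := Real.pi_pos
  unfold IsArmAngle ang
  rw [abs_mul, abs_of_pos (show 0 < Real.pi / 8 by positivity)]
  fin_cases k <;> norm_num <;> constructor <;> linarith

lemma cos_sin_ang (k : Fin 8) : Real.cos (ang k) = al k * cc + be k * ss ∧
    Real.sin (ang k) = ga k * cc + de k * ss := by
  have e3 : Real.cos (3 * (Real.pi / 8)) = ss ∧ Real.sin (3 * (Real.pi / 8)) = cc := by
    rw [show 3 * (Real.pi / 8) = Real.pi / 2 - Real.pi / 8 by ring, Real.cos_pi_div_two_sub,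
      Real.sin_pi_div_two_sub]
    exact ⟨rfl, rfl⟩
  have e5 : Real.cos (5 * (Real.pi / 8)) = -ss ∧ Real.sin (5 * (Real.pi / 8)) = cc := by
    rw [show 5 * (Real.pi / 8) = Real.pi / 8 + Real.pi / 2 by ring, Real.cos_add_pi_div_two,
      Real.sin_add_pi_div_two]
    exact ⟨rfl, rfl⟩
  have e7 : Real.cos (7 * (Real.pi / 8)) = -cc ∧ Real.sin (7 * (Real.pi / 8)) = ss := by
    rw [show 7 * (Real.pi / 8) = Real.pi - Real.pi / 8 by ring, Real.cos_pi_sub,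
      Real.sin_pi_sub]
    exact ⟨rfl, rfl⟩
  have e1 : Real.cos (Real.pi / 8) = cc ∧ Real.sin (Real.pi / 8) = ss := ⟨rfl, rfl⟩
  unfold ang
  fin_cases k <;> simp [al, be, ga, de, e1, e3, e5, e7]

lemma armPt_left (k : Fin 8) : armPt (ang k) (-1) = shift (pt k 1000 0) := by
  obtain ⟨h1, h2⟩ := cos_sin_ang k
  refine Plane.ext ?_ ?_
  · rw [armPt_left_zero (isArmAngle_ang k), h1, shift_apply_zero, pt_zero]; ring
  · rw [armPt_left_one (isArmAngle_ang k), h2, shift_apply_one, pt_one]; ring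

/-- The `k`-th arm, which joins the ends of the `k`-th rays at the two places. -/
noncomputable def arm (k : Fin 8) : Set Plane := armPt (ang k) '' Icc (-1) 1

lemma isCompact_arm (k : Fin 8) : IsCompact (arm k) :=
  isCompact_Icc.image (continuous_armPt _)

lemma flip_image_arm (k : Fin 8) : flip '' arm k = arm k := by
  have : ∀ z ∈ arm k, flip z ∈ arm k := by
    rintro _ ⟨s, hs, rfl⟩
    exact ⟨-s, ⟨by linarith [hs.2], by linarith [hs.1]⟩, armPt_neg⟩
  refine Subset.antisymm (image_subset_iff.2 this) fun z hz => ⟨flip z, this z hz, flip_flip z⟩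

lemma isSimpleArc_arm (k : Fin 8) :
    IsSimpleArc (arm k) (shift (pt k 1000 0)) (flip (shift (pt k 1000 0))) := by
  refine ⟨armPt (ang k), -1, 1, by norm_num, (continuous_armPt _).continuousOn,
    armPt_injOn (isArmAngle_ang k), armPt_left k, ?_, rfl⟩
  rw [← armPt_left, ← armPt_neg, neg_neg]

lemma dist_arm {k : Fin 8} {z : Plane} (hz : z ∈ arm k) :
    1000 ≤ dist z place ∧ (dist z place = 1000 → z = shift (pt k 1000 0)) := by
  obtain ⟨s, hs, rfl⟩ := hz
  obtain ⟨h1, h2⟩ := dist_armPt (isArmAngle_ang k) hs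
  exact ⟨h1, fun h => by rw [h2 h, armPt_left]⟩

/-- The sign of the height of the `k`-th arm. -/
def side : Fin 8 → ℝ := ![1, 1, 1, 1, -1, -1, -1, -1]

lemma side_mul_sin_pos (k : Fin 8) : 0 < side k * Real.sin (ang k) := by
  have := cc_pos
  have := ss_pos
  rw [(cos_sin_ang k).2]
  fin_cases k <;> simpa [side, ga, de]

lemma ht_bounds (k : Fin 8) :
    (![-2300, 200, 1900, 7000, 7000, 1900, 200, -2300] : Fin 8 → ℝ) k < side k * ht (ang k) ∧
    side k * ht (ang k) < (![-2200, 300, 2000, 7500, 7500, 2000, 300, -2200] : Fin 8 → ℝ) k := by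
  obtain ⟨c1, c2⟩ := cc_bounds
  obtain ⟨s1, s2⟩ := ss_bounds
  have h := ht_mul_sin (isArmAngle_ang k)
  rw [(cos_sin_ang k).1, (cos_sin_ang k).2] at h
  generalize ht (ang k) = κ at *
  fin_cases k <;> simp [side, al, be, ga, de] at h ⊢ <;> constructor <;> nlinarith

/-- Distinct arms lie on circles of the same coaxal family, or on different sides of the horizontal
axis. -/
lemma disjoint_arm {k l : Fin 8} (hkl : k ≠ l) : Disjoint (arm k) (arm l) := by
  rw [disjoint_left]
  rintro _ ⟨s, hs, rfl⟩ ⟨t, ht', h⟩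
  have hk := isArmAngle_ang k
  have hl := isArmAngle_ang l
  have c1 := armPt_circle (s := s) hk
  have c2 := armPt_circle (s := t) hl
  have y1 := armPt_side hk hs
  have y2 := armPt_side hl ht'
  rw [h] at c2 y2
  have hy : armPt (ang k) s 1 ≠ 0 := by
    intro e; rw [e, mul_zero] at y1; exact lt_irrefl _ y1
  have hht : ht (ang k) = ht (ang l) :=
    mul_right_cancel₀ hy (by linarith)
  have sgn : ∀ m, 0 < Real.sin (ang m) * armPt (ang k) s 1 → 0 < side m * armPt (ang k) s 1 := by
    intro m hm
    have h2 := mul_pos hm (side_mul_sin_pos m)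
    have h3 : 0 < Real.sin (ang m) ^ 2 := by
      have := (isArmAngle_ang m).sin_ne_zero
      positivity
    exact pos_of_mul_pos_left (b := Real.sin (ang m) ^ 2) (by linarith) h3.le
  have s1 := sgn k y1
  have s2 := sgn l y2
  have b1 := ht_bounds k
  have b2 := ht_bounds l
  rw [← hht] at b2
  generalize armPt (ang k) s 1 = y at *
  generalize ht (ang k) = κ at *
  clear c1 c2 y1 y2 hht hk hl sgn h hy
  fin_cases k <;> fin_cases l <;>
    first
    | exact hkl rfl
    | (simp [side] at s1 s2 b1 b2; linarith)

/-! ### The curves -/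

section Curves

variable {ε δ : ℝ}

/-- The half-strands in the `k`-th octants of the left place in state `ε` and of the right place in
state `δ`, together with the arm that joins them. -/
noncomputable def longArm (ε δ : ℝ) (k : Fin 8) : Set Plane :=
  shift '' halfStrand ε k ∪ arm k ∪ flip '' (shift '' halfStrand δ k)

/-- The union of closed curves whose left and right crossings are in the states `ε` and `δ`. -/
noncomputable def curve (ε δ : ℝ) : Set Plane := ⋃ k, longArm ε δ k

lemma flip_image_longArm (k : Fin 8) : flip '' longArm ε δ k = longArm δ ε k := by
  simp only [longArm, image_union, flip_image_flip_image, flip_image_arm]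
  rw [union_comm, union_comm (flip '' _), union_assoc]

lemma flip_image_curve : flip '' curve ε δ = curve δ ε := by
  simp only [curve, image_iUnion, flip_image_longArm]

lemma dist_shift_halfStrand (hε : IsSign ε) {k : Fin 8} {z : Plane}
    (hz : z ∈ shift '' halfStrand ε k) :
    dist z place ≤ 1000 ∧ (dist z place = 1000 → z = shift (pt k 1000 0)) := by
  obtain ⟨w, hw, rfl⟩ := hz
  rw [dist_shift_place]
  obtain ⟨h1, h2⟩ := dist_halfStrand hε hw
  exact ⟨h1, fun h => by rw [h2 h]⟩

lemma neg_of_dist_place {z : Plane} (hz : dist z place ≤ 1000) : z 0 < 0 := by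
  have h := dist_place_sq z
  have h1 := pow_le_pow_left₀ dist_nonneg hz 2
  by_contra! h0
  nlinarith [sq_nonneg (z 1)]

lemma eq_of_mem_halfStrand_of_mem_arm (hε : IsSign ε) {k l : Fin 8} {z : Plane}
    (hz : z ∈ shift '' halfStrand ε k) (hz' : z ∈ arm l) :
    z = shift (pt k 1000 0) ∧ k = l := by
  obtain ⟨h1, h2⟩ := dist_shift_halfStrand hε hz
  obtain ⟨h3, h4⟩ := dist_arm hz'
  have h5 := le_antisymm h1 h3
  refine ⟨h2 h5, ?_⟩
  have := ss_pos
  exact pt_injective (by linarith) (by linarith) (shift.injective ((h2 h5).symm.trans (h4 h5)))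

lemma disjoint_halfStrand_flip (hε : IsSign ε) (hδ : IsSign δ) {k l : Fin 8} {z : Plane}
    (hz : z ∈ shift '' halfStrand ε k) (hz' : z ∈ flip '' (shift '' halfStrand δ l)) : False := by
  have h1 := neg_of_dist_place (dist_shift_halfStrand hε hz).1
  obtain ⟨w, hw, rfl⟩ := hz'
  have h2 := neg_of_dist_place (dist_shift_halfStrand hδ hw).1
  rw [flip_apply_zero] at h1
  linarith

lemma isSimpleArc_longArm (hε : IsSign ε) (hδ : IsSign δ) (k : Fin 8) :
    IsSimpleArc (longArm ε δ k) (shift (midpt ε k)) (flip (shift (midpt δ k))) := by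
  have h1 := (isSimpleArc_halfStrand hε k).image shift.isometry
  have h2 := isSimpleArc_arm k
  have h3 := ((isSimpleArc_halfStrand hδ k).image shift.isometry).image flip.isometry
  refine (h1.concat h2 fun x hx hx' => (eq_of_mem_halfStrand_of_mem_arm hε hx hx').1).concat
    h3.symm ?_
  rintro x (hx | hx) hx'
  · exact (disjoint_halfStrand_flip hε hδ hx hx').elim
  · obtain ⟨w, hw, rfl⟩ := hx'
    rw [← flip_image_arm] at hx
    obtain ⟨w', hw', h⟩ := hx
    rw [flip.injective h] at hw'
    rw [(eq_of_mem_halfStrand_of_mem_arm hδ hw hw').1]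

lemma mem_halfStrand_of_mem_longArm (hε : IsSign ε) (hδ : IsSign δ) {k : Fin 8} {z : Plane}
    (hz : z ∈ longArm ε δ k) (hd : dist z place ≤ 1000) : z ∈ shift '' halfStrand ε k := by
  rcases hz with (hz | hz) | hz
  · exact hz
  · obtain ⟨h1, h2⟩ := dist_arm hz
    rw [h2 (le_antisymm hd h1)]
    exact mem_image_of_mem _ (isSimpleArc_halfStrand hε k).right_mem
  · obtain ⟨w, hw, rfl⟩ := hz
    have h1 := neg_of_dist_place (dist_shift_halfStrand hδ hw).1
    have h2 := neg_of_dist_place hd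
    rw [flip_apply_zero] at h2
    linarith

/-- Different long arms meet at most in common midpoints of strands. -/
lemma longArm_inter (hε : IsSign ε) (hδ : IsSign δ) {k l : Fin 8} (hkl : k ≠ l) {z : Plane}
    (hk : z ∈ longArm ε δ k) (hl : z ∈ longArm ε δ l) :
    (z = shift (midpt ε k) ∧ midpt ε k = midpt ε l) ∨
      (z = flip (shift (midpt δ k)) ∧ midpt δ k = midpt δ l) := by
  have left : ∀ {ε δ : ℝ}, IsSign ε → IsSign δ → ∀ {z : Plane}, z ∈ longArm ε δ k →
      z ∈ longArm ε δ l → dist z place ≤ 1000 →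
      z = shift (midpt ε k) ∧ midpt ε k = midpt ε l := by
    intro ε δ hε hδ z hk hl hd
    obtain ⟨w, hw, rfl⟩ := mem_halfStrand_of_mem_longArm hε hδ hk hd
    obtain ⟨w', hw', h⟩ := mem_halfStrand_of_mem_longArm hε hδ hl hd
    rw [shift.injective h] at hw'
    obtain ⟨h1, h2⟩ := halfStrand_inter hε hkl hw hw'
    exact ⟨by rw [h1], h1.symm.trans h2⟩
  by_cases hd : dist z place ≤ 1000
  · exact Or.inl (left hε hδ hk hl hd)
  by_cases hd' : dist (flip z) place ≤ 1000
  · right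
    have hk' := mem_image_of_mem flip hk
    have hl' := mem_image_of_mem flip hl
    rw [flip_image_longArm] at hk' hl'
    obtain ⟨h1, h2⟩ := left hδ hε hk' hl' hd'
    exact ⟨by rw [← h1, flip_flip], h2⟩
  have arm_of : ∀ m, z ∈ longArm ε δ m → z ∈ arm m := by
    rintro m ((h | h) | ⟨w, hw, rfl⟩)
    · exact absurd (dist_shift_halfStrand hε h).1 hd
    · exact h
    · rw [flip_flip] at hd'
      exact absurd (dist_shift_halfStrand hδ hw).1 hd'
  exact (disjoint_left.1 (disjoint_arm hkl) (arm_of k hk) (arm_of l hl)).elim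

/-- Near the left place, the curves consist of the strands of a crossing. -/
lemma shift_mem_curve_iff (hε : IsSign ε) (hδ : IsSign δ) {z : Plane} (hz : dist z 0 ≤ 1000) :
    shift z ∈ curve ε δ ↔ uM ≤ uco z ∧ vco z = ε * prof (uco z) := by
  rw [← mem_halfStrand_iff hε hz, curve, mem_iUnion]
  refine exists_congr fun k => ⟨fun h => ?_, fun h => Or.inl (Or.inl (mem_image_of_mem _ h))⟩
  obtain ⟨w, hw, h'⟩ := mem_halfStrand_of_mem_longArm hε hδ h (by rwa [dist_shift_place])
  rwa [← shift.injective h']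

/-! ### The order of the long arms along the curves -/

lemma prof_uM : prof uM = -ss * mid := by
  have h := prof_lower_uM
  unfold uM at h ⊢
  exact mul_left_cancel₀ cc_pos.ne' (by linarith)

/-- The number of the strand of a crossing in state `1` that goes into the `k`-th octant. -/
def strandNo : Fin 8 → Fin 4 := ![0, 1, 1, 2, 2, 3, 3, 0]

/-- The number of the strand of a crossing in state `-1` that goes into the `k`-th octant. -/
def strandNo' : Fin 8 → Fin 4 := ![0, 0, 1, 1, 2, 2, 3, 3]

lemma midpt_eq_iff {k l : Fin 8} : midpt 1 k = midpt 1 l ↔ strandNo k = strandNo l := by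
  have hm := mid_bounds
  have h : ∀ k, midpt 1 k = !₂[mid * (![1, 0, -1, 0] : Fin 4 → ℝ) (strandNo k),
      mid * (![0, 1, 0, -1] : Fin 4 → ℝ) (strandNo k)] := by
    intro k
    have e1 : cc * uM - ss * (1 * prof uM) = mid := by
      rw [prof_uM, uM]; linear_combination mid * cc_sq_add_ss_sq
    have e2 : ss * uM + cc * (1 * prof uM) = 0 := by rw [one_mul, prof_lower_uM]
    refine Plane.ext ?_ ?_
    · rw [midpt, pt_zero, e1, e2]
      fin_cases k <;> simp [al, be, strandNo]
    · rw [midpt, pt_one, e1, e2]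
      fin_cases k <;> simp [ga, de, strandNo]
  constructor
  · intro e
    rw [h, h] at e
    have e0 := congrArg (fun z : Plane => z 0) e
    have e1 := congrArg (fun z : Plane => z 1) e
    simp only [Matrix.cons_val_zero, Matrix.cons_val_one] at e0 e1
    generalize strandNo k = a at *
    generalize strandNo l = b at *
    fin_cases a <;> fin_cases b <;> first | rfl | (exfalso; simp at e0 e1; linarith)
  · intro e
    rw [h, h, e]

lemma midpt_eq_iff' {k l : Fin 8} : midpt (-1) k = midpt (-1) l ↔ strandNo' k = strandNo' l := by
  have hm : 0 < 2 * cc * ss * mid := by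
    have := mid_bounds
    have := cc_pos
    have := ss_pos
    have : 0 < mid := by linarith
    positivity
  have h : ∀ k, midpt (-1) k = !₂[2 * cc * ss * mid * (![1, -1, -1, 1] : Fin 4 → ℝ) (strandNo' k),
      2 * cc * ss * mid * (![1, 1, -1, -1] : Fin 4 → ℝ) (strandNo' k)] := by
    intro k
    have e1 : cc * uM - ss * (-1 * prof uM) = 2 * cc * ss * mid := by
      rw [prof_uM, uM]; linear_combination mid * cc_sq_sub_ss_sq
    have e2 : ss * uM + cc * (-1 * prof uM) = 2 * cc * ss * mid := by rw [prof_uM, uM]; ring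
    refine Plane.ext ?_ ?_
    · rw [midpt, pt_zero, e1, e2]
      fin_cases k <;> simp [al, be, strandNo']
    · rw [midpt, pt_one, e1, e2]
      fin_cases k <;> simp [ga, de, strandNo']
  constructor
  · intro e
    rw [h, h] at e
    have e0 := congrArg (fun z : Plane => z 0) e
    have e1 := congrArg (fun z : Plane => z 1) e
    simp only [Matrix.cons_val_zero, Matrix.cons_val_one] at e0 e1
    generalize strandNo' k = a at *
    generalize strandNo' l = b at *
    generalize 2 * cc * ss * mid = w at *
    fin_cases a <;> fin_cases b <;> first | rfl | (exfalso; simp at e0 e1; linarith)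
  · intro e
    rw [h, h, e]

lemma isSign_one : IsSign 1 := Or.inl rfl

lemma isSign_neg_one : IsSign (-1) := Or.inr rfl

/-- If the two crossings are in different states, then the eight long arms are traversed in
cyclic order. -/
lemma isClosedCurve_curve : IsClosedCurve (curve 1 (-1)) := by
  have hc : curve 1 (-1) = ⋃ i ∈ Iic (6 + 1), longArm 1 (-1) (Fin.ofNat 8 i) := by
    ext z
    simp only [curve, mem_iUnion, mem_Iic, exists_prop]
    constructor
    · rintro ⟨k, hk⟩
      exact ⟨k, by omega, by simpa using hk⟩
    · rintro ⟨i, -, h⟩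
      exact ⟨_, h⟩
  rw [hc]
  refine isClosedCurve_iUnion (m := fun i => if Even i then shift (midpt 1 (Fin.ofNat 8 i))
    else flip (shift (midpt (-1) (Fin.ofNat 8 i)))) ?_ ?_ ?_
  · intro i hi
    have h := isSimpleArc_longArm isSign_one isSign_neg_one (Fin.ofNat 8 i)
    by_cases he : Even i
    · have he' : ¬ Even (i + 1) := by rwa [Nat.even_add_one, not_not]
      simp only [he, he', if_true, if_false]
      rwa [midpt_eq_iff'.2 (show strandNo' (Fin.ofNat 8 (i + 1)) = strandNo' (Fin.ofNat 8 i) by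
        revert he; interval_cases i <;> decide)]
    · have he' : Even (i + 1) := by rwa [Nat.even_add_one]
      simp only [he, he', if_true, if_false]
      rw [midpt_eq_iff.2 (show strandNo (Fin.ofNat 8 (i + 1)) = strandNo (Fin.ofNat 8 i) by
        revert he; interval_cases i <;> decide)]
      exact h.symm
  · have : ¬ Odd 8 := by decide
    simp [this]
  · intro i j hij hj x hx hx'
    have hne : Fin.ofNat 8 i ≠ Fin.ofNat 8 j := by
      intro h
      have := congrArg Fin.val h
      simp only [Fin.ofNat] at this
      omega
    rcases longArm_inter isSign_one isSign_neg_one hne hx hx' with ⟨h1, h2⟩ | ⟨h1, h2⟩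
    · have h3 : (j = i + 1 ∧ Even j) ∨ (i = 0 ∧ j = 6 + 1) := by
        rw [midpt_eq_iff] at h2
        clear hx hx' hne h1
        revert h2
        interval_cases j <;> interval_cases i <;> decide
      rcases h3 with ⟨h3, h4⟩ | ⟨rfl, h4⟩
      · refine Or.inl ⟨h3, ?_⟩
        simp only [h4, if_true]
        rw [h1, h2]
      · exact Or.inr ⟨rfl, h4, by simpa using h1⟩
    · have h3 : j = i + 1 ∧ ¬ Even j := by
        rw [midpt_eq_iff'] at h2
        clear hx hx' hne h1
        revert h2
        interval_cases j <;> interval_cases i <;> decide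
      refine Or.inl ⟨h3.1, ?_⟩
      simp only [h3.2, if_false]
      rw [h1, h2]

lemma exists_components_aux (hε : IsSign ε) {f : Fin 8 → Fin 4} {a b : Fin 4 → Fin 8}
    (hf : ∀ k l, midpt ε k = midpt ε l ↔ f k = f l) (hab : ∀ i, a i ≠ b i)
    (ha : ∀ i, f (a i) = i) (hb : ∀ i, f (b i) = i) (hk : ∀ k, k = a (f k) ∨ k = b (f k)) :
    ∃ F : Fin 4 → Set Plane, (∀ i, IsClosedCurve (F i)) ∧
      (∀ i j, i ≠ j → Disjoint (F i) (F j)) ∧ curve ε ε = ⋃ i, F i := by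
  have hm : ∀ i, midpt ε (a i) = midpt ε (b i) := fun i => (hf _ _).2 (by rw [ha, hb])
  refine ⟨fun i => longArm ε ε (a i) ∪ longArm ε ε (b i), fun i => ?_, ?_, ?_⟩
  · have h2 := isSimpleArc_longArm hε hε (b i)
    rw [← hm] at h2
    refine (isSimpleArc_longArm hε hε (a i)).isClosedCurve_union h2.symm fun x hx hx' => ?_
    exact (longArm_inter hε hε (hab i) hx hx').imp (fun h => h.1) (fun h => h.1)
  · intro i j hij
    have key : ∀ k l, f k = i → f l = j → Disjoint (longArm ε ε k) (longArm ε ε l) := by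
      rintro k l rfl rfl
      rw [disjoint_left]
      intro x hx hx'
      have hkl : k ≠ l := fun h => hij (by rw [h])
      rcases longArm_inter hε hε hkl hx hx' with ⟨-, h⟩ | ⟨-, h⟩ <;> exact hij ((hf k l).1 h)
    simp only [disjoint_union_left, disjoint_union_right]
    exact ⟨⟨key _ _ (ha i) (ha j), key _ _ (hb i) (ha j)⟩,
      ⟨key _ _ (ha i) (hb j), key _ _ (hb i) (hb j)⟩⟩
  · ext x
    simp only [curve, mem_iUnion, mem_union]
    constructor
    · rintro ⟨k, h⟩
      refine ⟨f k, ?_⟩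
      rcases hk k with e | e
      · exact Or.inl (e ▸ h)
      · exact Or.inr (e ▸ h)
    · rintro ⟨i, h | h⟩ <;> exact ⟨_, h⟩

/-- If the two crossings are in the same state, then the long arms close up in pairs. -/
lemma exists_components (hε : IsSign ε) :
    ∃ F : Fin 4 → Set Plane, (∀ i, IsClosedCurve (F i)) ∧
      (∀ i j, i ≠ j → Disjoint (F i) (F j)) ∧ curve ε ε = ⋃ i, F i := by
  rcases hε with rfl | rfl
  · exact exists_components_aux (f := strandNo) (a := ![0, 1, 3, 5]) (b := ![7, 2, 4, 6])
      isSign_one (fun k l => midpt_eq_iff) (by decide) (by decide) (by decide) (by decide)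
  · exact exists_components_aux (f := strandNo') (a := ![0, 2, 4, 6]) (b := ![1, 3, 5, 7])
      isSign_neg_one (fun k l => midpt_eq_iff') (by decide) (by decide) (by decide) (by decide)

lemma isDisconnected_curve (hε : IsSign ε) : IsDisconnectedUnionOfClosedCurves (curve ε ε) := by
  obtain ⟨F, h1, h2, h3⟩ := exists_components hε
  refine ⟨⟨4, F, h1, h2, h3⟩, ?_⟩
  rw [h3]
  exact not_isPreconnected_iUnion h1 h2 (show (0 : Fin 4) ≠ 1 by decide)

lemma isClosedCurve_curve' : IsClosedCurve (curve (-1) 1) := by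
  rw [← flip_image_curve]
  exact isClosedCurve_curve.image flip.isometry

lemma isClosedCurve_connectedComponentIn (hε : IsSign ε) (hδ : IsSign δ) {a : Plane}
    (ha : a ∈ curve ε δ) : IsClosedCurve (connectedComponentIn (curve ε δ) a) := by
  have same : ∀ {ε}, IsSign ε → a ∈ curve ε ε →
      IsClosedCurve (connectedComponentIn (curve ε ε) a) := by
    intro ε hε ha
    obtain ⟨F, h1, h2, h3⟩ := exists_components hε
    rw [h3] at ha ⊢
    obtain ⟨i, hi⟩ := mem_iUnion.1 ha
    rw [connectedComponentIn_iUnion h1 h2 hi]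
    exact h1 i
  rcases hε with rfl | rfl <;> rcases hδ with rfl | rfl
  · exact same isSign_one ha
  · rw [isClosedCurve_curve.connectedComponentIn_eq ha]; exact isClosedCurve_curve
  · rw [isClosedCurve_curve'.connectedComponentIn_eq ha]; exact isClosedCurve_curve'
  · exact same isSign_neg_one ha

lemma IsSimpleArc.isCompact {K : Set Plane} {p q : Plane} (h : IsSimpleArc K p q) :
    IsCompact K := by
  obtain ⟨γ, a, b, -, hc, -, -, -, rfl⟩ := h
  exact isCompact_Icc.image_of_continuousOn hc

lemma IsSimpleArc.isPreconnected {K : Set Plane} {p q : Plane} (h : IsSimpleArc K p q) :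
    IsPreconnected K := by
  obtain ⟨γ, a, b, -, hc, -, -, -, rfl⟩ := h
  exact isPreconnected_Icc.image _ hc

lemma isCompact_curve (hε : IsSign ε) (hδ : IsSign δ) : IsCompact (curve ε δ) :=
  isCompact_iUnion fun k => (isSimpleArc_longArm hε hδ k).isCompact

end Curves

/-! ### Positivity of the local feature size -/

/-- A point has a neighbourhood free of the medial axis if, for all `x` near it, some point of the
set is the only one nearby that is as close to `x`. -/
lemma eventually_notMem_medialAxis_of_nhds {C N : Set Plane} (hC : IsCompact C) {p : Plane}
    (hp : p ∈ C)
    (hN : N ∈ 𝓝 p)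
    (h : ∀ᶠ x in 𝓝 p, ∃ y ∈ C, ∀ q ∈ C, q ∈ N → dist x q ≤ dist x y → q = y) :
    ∀ᶠ x in 𝓝 p, x ∉ medialAxis C := by
  obtain ⟨r, hr, hrN⟩ := Metric.mem_nhds_iff.1 hN
  filter_upwards [h, Metric.ball_mem_nhds p (half_pos hr)] with x ⟨y, hy, hx⟩ hxp hmem
  have near : ∀ q, IsClosestPoint C x q → q = y := by
    intro q hq
    refine hx q hq.1 (hrN ?_) (hq.2 y hy)
    rw [Metric.mem_ball] at hxp ⊢
    linarith [hq.2 p hp, dist_triangle q x p, dist_comm x q]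
  obtain ⟨q, q', hq, hq', hne⟩ := exists_two_closest hC ⟨p, hp⟩ hmem
  exact hne ((near q hq).trans (near q' hq').symm)

/-- Uniqueness of the closest point on a circle: `y` is the radial projection of `x` to a circle
around `(0, κ)`. -/
lemma eq_of_dist_le_of_circle {κ l : ℝ} {x y q : Plane} (hl : 0 < l) (h0 : x 0 = l * y 0)
    (h1 : x 1 - κ = l * (y 1 - κ))
    (hq : q 0 ^ 2 + (q 1 - κ) ^ 2 = y 0 ^ 2 + (y 1 - κ) ^ 2) (h : dist x q ≤ dist x y) :
    q = y := by
  have h2 := pow_le_pow_left₀ dist_nonneg h 2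
  rw [dist_sq_eq, dist_sq_eq] at h2
  have h3 : 0 ≤ 2 * l * (q 0 * y 0 + (q 1 - κ) * (y 1 - κ) - (y 0 ^ 2 + (y 1 - κ) ^ 2)) := by
    have h4 : x 1 = l * (y 1 - κ) + κ := by linarith
    rw [h0, h4] at h2
    linarith
  have h5 := nonneg_of_mul_nonneg_right h3 (by positivity)
  have h6 : (q 0 - y 0) ^ 2 + (q 1 - y 1) ^ 2 ≤ 0 := by linarith
  refine Plane.ext ?_ ?_
  · nlinarith [sq_nonneg (q 0 - y 0), sq_nonneg (q 1 - y 1)]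
  · nlinarith [sq_nonneg (q 0 - y 0), sq_nonneg (q 1 - y 1)]

/-- Polar coordinates around the centre of an arm. -/
lemma exists_polar {θ s₀ : ℝ} (hθ : IsArmAngle θ) (hs : s₀ ∈ Icc (-1 : ℝ) 1) :
    ∃ s l : Plane → ℝ, Tendsto s (𝓝 (armPt θ s₀)) (𝓝 s₀) ∧ (∀ᶠ x in 𝓝 (armPt θ s₀), 0 < l x) ∧
      ∀ x, x 0 = l x * armPt θ (s x) 0 ∧ x 1 - ht θ = l x * (armPt θ (s x) 1 - ht θ) := by
  have hr := rad_ne_zero hθ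
  set w : Plane → ℂ := fun x => ⟨(x 1 - ht θ) / rad θ, x 0 / rad θ⟩ with hw
  have hwc : Continuous w := by
    have : w = fun x : Plane => (((x 1 - ht θ) / rad θ : ℝ) : ℂ) + ((x 0 / rad θ : ℝ) : ℂ) * Complex.I := by
      funext x; apply Complex.ext <;> simp [hw]
    rw [this]; fun_prop
  have hang : s₀ * θ ∈ Ioo (-Real.pi) Real.pi := by
    rw [mem_Ioo, ← abs_lt, abs_mul]
    have := abs_le.2 hs
    nlinarith [hθ.2, hθ.1]
  have hwp : w (armPt θ s₀) = Complex.cos (s₀ * θ : ℝ) + Complex.sin (s₀ * θ : ℝ) * Complex.I := by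
    apply Complex.ext
    · simp [hw, armPt_one, hr, ← Complex.ofReal_cos, ← Complex.ofReal_sin, -Complex.ofReal_mul]
    · simp [hw, armPt_zero, hr, ← Complex.ofReal_cos, ← Complex.ofReal_sin, -Complex.ofReal_mul]
  have harg : Complex.arg (w (armPt θ s₀)) = s₀ * θ := by
    rw [hwp, Complex.arg_cos_add_sin_mul_I ⟨hang.1, hang.2.le⟩]
  have hne : w (armPt θ s₀) ≠ 0 := by
    intro h
    have h2 := congrArg Complex.re h
    have h3 := congrArg Complex.im h
    simp [hw, armPt_zero, armPt_one, hr] at h2 h3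
    have := Real.sin_sq_add_cos_sq (s₀ * θ)
    rw [h2, h3] at this
    norm_num at this
  have hslit : w (armPt θ s₀) ∈ Complex.slitPlane := by
    rw [Complex.mem_slitPlane_iff_arg, harg]
    exact ⟨hang.2.ne, hne⟩
  refine ⟨fun x => Complex.arg (w x) / θ, fun x => ‖w x‖, ?_, ?_, fun x => ?_⟩
  · have h1 : ContinuousAt (fun x => Complex.arg (w x) / θ) (armPt θ s₀) :=
      ((Complex.continuousAt_arg hslit).comp hwc.continuousAt).div_const θ
    have h2 := h1.tendsto
    rwa [harg, mul_div_cancel_right₀ _ hθ.ne_zero] at h2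
  · filter_upwards [hwc.continuousAt.eventually_ne hne] with x hx using norm_pos_iff.2 hx
  · have h1 : (w x).re = (x 1 - ht θ) / rad θ := rfl
    have h2 : (w x).im = x 0 / rad θ := rfl
    rw [← Complex.norm_mul_cos_arg] at h1
    rw [← Complex.norm_mul_sin_arg] at h2
    rw [eq_div_iff hr] at h1 h2
    rw [armPt_zero, armPt_one, div_mul_cancel₀ _ hθ.ne_zero]
    constructor <;> linarith

lemma circle_armPt {θ s t : ℝ} : armPt θ s 0 ^ 2 + (armPt θ s 1 - ht θ) ^ 2 =
    armPt θ t 0 ^ 2 + (armPt θ t 1 - ht θ) ^ 2 := by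
  simp only [armPt_zero, armPt_one]
  linear_combination rad θ ^ 2 * (Real.sin_sq_add_cos_sq (s * θ)) -
    rad θ ^ 2 * Real.sin_sq_add_cos_sq (t * θ)

section Arms

variable {ε δ : ℝ}

lemma arm_subset_curve (k : Fin 8) : arm k ⊆ curve ε δ := fun _ hz =>
  mem_iUnion.2 ⟨k, Or.inl (Or.inr hz)⟩

lemma halfStrand_subset_curve (k : Fin 8) : shift '' halfStrand ε k ⊆ curve ε δ := fun _ hz =>
  mem_iUnion.2 ⟨k, Or.inl (Or.inl hz)⟩

/-- Near an inner point of an arm the curves form a circular arc, to which nearby points have a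
unique radial projection. -/
lemma eventually_notMem_medialAxis_arm (hε : IsSign ε) (hδ : IsSign δ) {k : Fin 8} {s₀ : ℝ}
    (hs : s₀ ∈ Ioo (-1 : ℝ) 1) :
    ∀ᶠ x in 𝓝 (armPt (ang k) s₀), x ∉ medialAxis (curve ε δ) := by
  have hθ := isArmAngle_ang k
  have hs' := Ioo_subset_Icc_self hs
  set p := armPt (ang k) s₀ with hp
  have hpk : p ∈ arm k := ⟨s₀, hs', rfl⟩
  set T : Set Plane := ⋃ l : {l // l ≠ k}, arm l with hT
  have hTc : IsClosed T := isClosed_iUnion_of_finite fun l => (isCompact_arm l).isClosed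
  have hpT : p ∉ T := by
    intro h
    obtain ⟨⟨l, hl⟩, h⟩ := mem_iUnion.1 h
    exact disjoint_left.1 (disjoint_arm hl) h hpk
  have out : ∀ s ∈ Ioo (-1 : ℝ) 1, 1000 < dist (armPt (ang k) s) place := by
    intro s hs
    obtain ⟨h1, h2⟩ := dist_armPt hθ (Ioo_subset_Icc_self hs)
    exact lt_of_le_of_ne h1 fun e => hs.1.ne' (h2 e.symm)
  have hN : {q : Plane | 1000 < dist q place} ∩ {q | 1000 < dist (flip q) place} ∩ Tᶜ ∈ 𝓝 p := by
    refine inter_mem (inter_mem ?_ ?_) (hTc.isOpen_compl.mem_nhds hpT)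
    · exact (isOpen_lt (by fun_prop) (by fun_prop)).mem_nhds (out s₀ hs)
    · refine (isOpen_lt (by fun_prop) (flip.continuous.dist continuous_const)).mem_nhds ?_
      change 1000 < dist (flip p) place
      rw [hp, ← armPt_neg]
      exact out _ ⟨by linarith [hs.2], by linarith [hs.1]⟩
  refine eventually_notMem_medialAxis_of_nhds (isCompact_curve hε hδ) (arm_subset_curve k hpk) hN ?_
  obtain ⟨s, l, h1, h2, h3⟩ := exists_polar hθ hs'
  filter_upwards [h1 (Ioo_mem_nhds hs.1 hs.2), h2] with x hx1 hx2
  refine ⟨armPt (ang k) (s x), arm_subset_curve k ⟨s x, Ioo_subset_Icc_self hx1, rfl⟩, ?_⟩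
  rintro q hq ⟨⟨hq1, hq2⟩, hq3⟩ hd
  obtain ⟨m, hm⟩ := mem_iUnion.1 hq
  have hqk : q ∈ arm k := by
    rcases hm with (h | h) | ⟨w, hw, rfl⟩
    · exact absurd (dist_shift_halfStrand hε h).1 (not_le.2 hq1)
    · by_cases e : m = k
      · exact e ▸ h
      · exact absurd (mem_iUnion.2 ⟨⟨m, e⟩, h⟩) hq3
    · have h' := (dist_shift_halfStrand hδ hw).1
      change 1000 < dist (flip (flip w)) place at hq2
      rw [flip_flip] at hq2
      exact absurd h' (not_le.2 hq2)
  obtain ⟨t, ht', rfl⟩ := hqk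
  exact eq_of_dist_le_of_circle hx2 (h3 x).1 (h3 x).2 circle_armPt hd

/-- Comparison of distances at a point where a ray runs tangentially into a circle of signed radius
`r`, in coordinates `(f, e)` for `x` and `(a, b)` for a point of the circle, along and orthogonal to
the ray. -/
lemma eq_zero_of_tangent {r f e a b : ℝ} (hf : f ≤ 0) (ha : 0 ≤ a) (hb : a ^ 2 + b ^ 2 = -2 * r * b)
    (he : |e| < |r|) (h : (f - a) ^ 2 + (e - b) ^ 2 ≤ e ^ 2) : a = 0 ∧ b = 0 ∧ f = 0 := by
  have hr : r ≠ 0 := by rintro rfl; simp at he; exact absurd he (not_lt.2 (abs_nonneg e))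
  have h1 : 0 < r ^ 2 + e * r := by
    have h2 : -(|e| * |r|) ≤ e * r := by rw [← abs_mul]; exact neg_abs_le _
    have h3 : |r| ^ 2 = r ^ 2 := sq_abs r
    nlinarith [mul_pos (sub_pos.2 he) (abs_pos.2 hr)]
  have h4 : (f ^ 2 + 2 * (-f) * a) * r ^ 2 + (a ^ 2 + b ^ 2) * (r ^ 2 + e * r) ≤ 0 := by
    have : ((f - a) ^ 2 + (e - b) ^ 2) * r ^ 2 ≤ e ^ 2 * r ^ 2 :=
      mul_le_mul_of_nonneg_right h (sq_nonneg r)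
    have e1 : (f ^ 2 + 2 * (-f) * a) * r ^ 2 + (a ^ 2 + b ^ 2) * (r ^ 2 + e * r) =
      ((f - a) ^ 2 + (e - b) ^ 2) * r ^ 2 - e ^ 2 * r ^ 2 := by
      linear_combination (e * r) * hb
    linarith
  have h5 : 0 ≤ (-f) * a := mul_nonneg (by linarith) ha
  have h6 : 0 < r ^ 2 := by positivity
  have h7 : 0 ≤ (f ^ 2 + 2 * (-f) * a) * r ^ 2 := by
    have : 0 ≤ f ^ 2 + 2 * (-f) * a := by nlinarith [sq_nonneg f]
    positivity
  have h8 : a ^ 2 + b ^ 2 = 0 := by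
    by_contra hne
    have : 0 < a ^ 2 + b ^ 2 := lt_of_le_of_ne (by positivity) (Ne.symm hne)
    linarith [mul_pos this h1]
  have h9 : a = 0 := by nlinarith [sq_nonneg a, sq_nonneg b]
  have h10 : b = 0 := by nlinarith [sq_nonneg a, sq_nonneg b]
  refine ⟨h9, h10, ?_⟩
  rw [h9, h10] at h4
  have : f ^ 2 ≤ 0 := by nlinarith
  nlinarith [sq_nonneg f]

lemma sin_mul_sin_pos {θ x : ℝ} (hθ : IsArmAngle θ) (hx : 0 < x) (hx' : x ≤ 1) :
    0 < Real.sin (x * θ) * Real.sin θ := by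
  have key : ∀ t, 0 < t → t < Real.pi → 0 < Real.sin (x * t) * Real.sin t := fun t h1 h2 =>
    mul_pos (Real.sin_pos_of_pos_of_lt_pi (by positivity) (by nlinarith))
      (Real.sin_pos_of_pos_of_lt_pi h1 h2)
  obtain ⟨h1, h2⟩ := hθ
  rcases abs_cases θ with ⟨e, -⟩ | ⟨e, -⟩
  · rw [e] at h1 h2; exact key θ h1 h2
  · rw [e] at h1 h2
    have := key (-θ) h1 h2
    rw [mul_neg, Real.sin_neg, Real.sin_neg] at this
    linarith

/-- The component along the ray of the position relative to the centre of the arm. -/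
lemma armPt_along {θ : ℝ} (hθ : IsArmAngle θ) (t : ℝ) :
    (armPt θ t 0 - armPt θ (-1) 0) * Real.cos θ + (armPt θ t 1 - armPt θ (-1) 1) * Real.sin θ =
      rad θ * Real.sin ((t + 1) * θ) := by
  rw [armPt_left_zero hθ, armPt_left_one hθ, armPt_zero, armPt_one,
    show (t + 1) * θ = t * θ + θ by ring, Real.sin_add]
  linear_combination ht_mul_sin hθ - 1000 * Real.sin_sq_add_cos_sq θ

lemma rad_mul_sin_pos {θ x : ℝ} (hθ : IsArmAngle θ) (hx : 0 < x) (hx' : x ≤ 1) :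
    0 < rad θ * Real.sin (x * θ) := by
  have h1 := sin_mul_sin_pos hθ hx hx'
  have h2 := rad_mul_sin hθ
  have h3 : 0 < Real.sin θ ^ 2 := by have := hθ.sin_ne_zero; positivity
  refine pos_of_mul_pos_left (b := Real.sin θ ^ 2) ?_ h3.le
  have h4 : 0 < 2000 - 1000 * Real.cos θ := by linarith [Real.cos_le_one θ]
  have : rad θ * Real.sin (x * θ) * Real.sin θ ^ 2 =
      (2000 - 1000 * Real.cos θ) * (Real.sin (x * θ) * Real.sin θ) := by
    linear_combination (Real.sin (x * θ) * Real.sin θ) * h2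
  rw [this]
  positivity

end Arms

section Junction

variable {ε δ : ℝ}

lemma shift_pt_zero (k : Fin 8) (u : ℝ) : shift (pt k u 0) 0 = u * Real.cos (ang k) - 2000 := by
  rw [shift_apply_zero, pt_zero, (cos_sin_ang k).1]; ring

lemma shift_pt_one (k : Fin 8) (u : ℝ) : shift (pt k u 0) 1 = u * Real.sin (ang k) := by
  rw [shift_apply_one, pt_one, (cos_sin_ang k).2]; ring

lemma halfStrand_of_ge {k : Fin 8} {u : ℝ} (h : 258 ≤ u) (h' : u ≤ 1000) :
    pt k u 0 ∈ halfStrand ε k := by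
  have := uM_bounds
  exact ⟨u, ⟨by linarith, h'⟩, by simp only [prof_of_ge h, mul_zero]⟩

/-- The part of the curves near the point where the `k`-th ray of the left place ends. -/
lemma exists_nhds_junction (hε : IsSign ε) (hδ : IsSign δ) (k : Fin 8) :
    ∃ N ∈ 𝓝 (shift (pt k 1000 0)), ∀ q ∈ curve ε δ, q ∈ N →
      (∃ t ∈ Ico (-1 : ℝ) 0, q = armPt (ang k) t) ∨ ∃ u ≤ 1000, q = shift (pt k u 0) := by
  have hθ := isArmAngle_ang k
  have hss := ss_pos
  set p := shift (pt k 1000 0) with hp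
  have hpk : p ∈ arm k := (isSimpleArc_arm k).left_mem
  have hpp : p = armPt (ang k) (-1) := (armPt_left k).symm
  set T : Set Plane := (⋃ l : {l // l ≠ k}, arm l ∪ shift '' halfStrand ε l) ∪
    armPt (ang k) '' Icc 0 1 with hT
  have hTc : IsClosed T := by
    refine (isClosed_iUnion_of_finite fun l => ?_).union
      (isCompact_Icc.image (continuous_armPt _)).isClosed
    exact (isCompact_arm l).isClosed.union
      ((isSimpleArc_halfStrand hε l).image shift.isometry).isCompact.isClosed
  have hpT : p ∉ T := by
    rintro (h | ⟨t, ht, h⟩)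
    · obtain ⟨⟨l, hl⟩, h | h⟩ := mem_iUnion.1 h
      · exact disjoint_left.1 (disjoint_arm hl) h hpk
      · exact hl (eq_of_mem_halfStrand_of_mem_arm hε h hpk).2
    · have := armPt_injOn hθ ⟨by linarith [ht.1], ht.2⟩ ⟨le_rfl, by norm_num⟩ (h.trans hpp)
      linarith [ht.1]
  have hd : dist p place = 1000 := by
    rw [hp, dist_shift_place]
    have := dist_pt k 1000 0
    exact (pow_left_inj₀ dist_nonneg (by norm_num) two_ne_zero).1 (by linarith)
  refine ⟨{q : Plane | 300 < dist q place} ∩ {q | 1000 < dist (flip q) place} ∩ Tᶜ,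
    inter_mem (inter_mem ?_ ?_) (hTc.isOpen_compl.mem_nhds hpT), ?_⟩
  · refine (isOpen_lt (by fun_prop) (by fun_prop)).mem_nhds ?_
    change 300 < dist p place
    rw [hd]; norm_num
  · refine (isOpen_lt (by fun_prop) (flip.continuous.dist continuous_const)).mem_nhds ?_
    change 1000 < dist (flip p) place
    by_contra! h
    have h1 := neg_of_dist_place h
    have h2 := neg_of_dist_place hd.le
    rw [flip_apply_zero] at h1
    linarith
  · rintro q hq ⟨⟨hq1, hq2⟩, hq3⟩
    obtain ⟨m, hm⟩ := mem_iUnion.1 hq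
    have hmk : q ∉ flip '' (shift '' halfStrand δ m) := by
      rintro ⟨w, hw, rfl⟩
      change 1000 < dist (flip (flip w)) place at hq2
      rw [flip_flip] at hq2
      exact absurd (dist_shift_halfStrand hδ hw).1 (not_le.2 hq2)
    have hm' : q ∈ shift '' halfStrand ε m ∪ arm m := hm.resolve_right hmk
    obtain rfl : m = k := by
      by_contra e
      exact hq3 (Or.inl (mem_iUnion.2 ⟨⟨m, e⟩, hm'.symm⟩))
    rcases hm' with ⟨_, ⟨u, hu, rfl⟩, rfl⟩ | ⟨t, ht, rfl⟩
    · refine Or.inr ⟨u, hu.2, ?_⟩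
      have hu' : 258 ≤ u := by
        by_contra! h
        change 300 < dist (shift _) place at hq1
        rw [dist_shift_place] at hq1
        have h1 := dist_pt m u (ε * prof u)
        rw [mul_pow, hε.sq, one_mul] at h1
        have h2 := pow_le_pow_left₀ (abs_nonneg _) (abs_prof_le hu.1) 2
        rw [sq_abs] at h2
        have h3 := pow_le_pow_left₀ (by norm_num) hq1.le 2
        have := uM_bounds
        nlinarith [hu.1]
      simp only [prof_of_ge hu', mul_zero]
    · refine Or.inl ⟨t, ⟨ht.1, ?_⟩, rfl⟩
      by_contra! h
      exact hq3 (Or.inr ⟨t, ⟨h, ht.2⟩, rfl⟩)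

/-- Where a ray runs tangentially into its arm, the normal line at the junction separates the nearby
points that project to the ray from those that project radially to the arm. -/
lemma eventually_notMem_medialAxis_junction (hε : IsSign ε) (hδ : IsSign δ) (k : Fin 8) :
    ∀ᶠ x in 𝓝 (shift (pt k 1000 0)), x ∉ medialAxis (curve ε δ) := by
  have hθ := isArmAngle_ang k
  obtain ⟨N, hN, hNC⟩ := exists_nhds_junction hε hδ k
  set p := shift (pt k 1000 0) with hp
  have hpp : p = armPt (ang k) (-1) := (armPt_left k).symm
  have hpC : p ∈ curve ε δ := arm_subset_curve k (isSimpleArc_arm k).left_mem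
  refine eventually_notMem_medialAxis_of_nhds (isCompact_curve hε hδ) hpC hN ?_
  obtain ⟨s, l, h1, h2, h3⟩ := exists_polar hθ (s₀ := -1) ⟨le_rfl, by norm_num⟩
  rw [← hpp] at h1 h2
  filter_upwards [h1 (Ioo_mem_nhds (show (-2 : ℝ) < -1 by norm_num) (show (-1 : ℝ) < 0 by norm_num)),
    h2, Metric.ball_mem_nhds p one_pos] with x hx1 hx2 hx3
  obtain ⟨hxa, hxb⟩ := h3 x
  rw [Metric.mem_ball] at hx3
  have p0 : p 0 = 1000 * Real.cos (ang k) - 2000 := shift_pt_zero k 1000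
  have p1 : p 1 = 1000 * Real.sin (ang k) := shift_pt_one k 1000
  have along := armPt_along hθ
  rw [← hpp] at along
  have hcs := Real.sin_sq_add_cos_sq (ang k)
  have hcirc := fun t => circle_armPt (θ := ang k) (s := t) (t := -1)
  rw [← hpp] at hcirc
  -- the ray ends at `p` in the direction orthogonal to the radius of the arm
  have hp0 : p 0 = rad (ang k) * -Real.sin (ang k) := by rw [p0]; linarith [rad_mul_sin hθ]
  have hp1 : p 1 - ht (ang k) = rad (ang k) * Real.cos (ang k) := by
    rw [hpp, armPt_one, neg_one_mul, Real.cos_neg]; ring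
  generalize hc : Real.cos (ang k) = c at *
  generalize hs : Real.sin (ang k) = σ at *
  set f := (x 0 - p 0) * c + (x 1 - p 1) * σ with hf
  set e := (x 1 - p 1) * c - (x 0 - p 0) * σ with he
  -- distances in the coordinates along and orthogonal to the ray
  have frame : ∀ q : Plane, dist x q ^ 2 = (f - ((q 0 - p 0) * c + (q 1 - p 1) * σ)) ^ 2 +
      (e - ((q 1 - p 1) * c - (q 0 - p 0) * σ)) ^ 2 := by
    intro q
    rw [dist_sq_eq, hf, he]
    linear_combination -((x 0 - q 0) ^ 2 + (x 1 - q 1) ^ 2) * hcs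
  have ray : ∀ u, dist x (shift (pt k u 0)) ^ 2 = (f - (u - 1000)) ^ 2 + e ^ 2 := by
    intro u
    have e1 : (u * c - 2000 - p 0) * c + (u * σ - p 1) * σ = u - 1000 := by
      rw [p0, p1]; linear_combination (u - 1000) * hcs
    have e2 : (u * σ - p 1) * c - (u * c - 2000 - p 0) * σ = 0 := by
      rw [p0, p1]; ring
    rw [frame, shift_pt_zero, shift_pt_one, hc, hs, e1, e2, sub_zero]
  have hpd : dist x p ^ 2 = f ^ 2 + e ^ 2 := by rw [frame]; ring
  have hfe : f ^ 2 + e ^ 2 < 1 := by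
    rw [← hpd]
    exact pow_lt_one₀ dist_nonneg hx3 two_ne_zero
  rcases le_or_gt f 0 with hf0 | hf0
  · -- here the closest point is the projection to the ray
    have hf1 : -1 < f := (abs_lt.1 ((sq_lt_one_iff_abs_lt_one f).1 (by linarith [sq_nonneg e]))).1
    have hyC : shift (pt k (1000 + f) 0) ∈ curve ε δ :=
      halfStrand_subset_curve k (mem_image_of_mem _ (halfStrand_of_ge (by linarith) (by linarith)))
    refine ⟨_, hyC, fun q hq hqN hd => ?_⟩
    have hd' := pow_le_pow_left₀ dist_nonneg hd 2
    rw [ray, show f - (1000 + f - 1000) = 0 by ring] at hd'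
    rcases hNC q hq hqN with ⟨t, htm, rfl⟩ | ⟨u, hu, rfl⟩
    · have ha : 0 ≤ rad (ang k) * Real.sin ((t + 1) * ang k) := by
        rcases htm.1.eq_or_lt with rfl | h
        · simp
        · exact (rad_mul_sin_pos hθ (by linarith) (by linarith [htm.2])).le
      rw [← along t] at ha
      have hcirc' := hcirc t
      rw [frame, zero_pow two_ne_zero, zero_add] at hd'
      have hr1 : (1 : ℝ) < |rad (ang k)| := by
        rw [← sq_lt_sq₀ (by norm_num) (abs_nonneg _), sq_abs]
        linarith [ht_sq_sub_rad_sq hθ, sq_nonneg (ht (ang k))]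
      have he1 : |e| < |rad (ang k)| := by
        have : |e| < 1 := by
          rw [← sq_lt_sq₀ (abs_nonneg _) (by norm_num), sq_abs]
          linarith [sq_nonneg f]
        linarith
      have hb : ((armPt (ang k) t 0 - p 0) * c + (armPt (ang k) t 1 - p 1) * σ) ^ 2 +
          ((armPt (ang k) t 1 - p 1) * c - (armPt (ang k) t 0 - p 0) * σ) ^ 2 =
          -2 * rad (ang k) * ((armPt (ang k) t 1 - p 1) * c - (armPt (ang k) t 0 - p 0) * σ) := by
        linear_combination hcirc' + ((armPt (ang k) t 0 - p 0) ^ 2 +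
          (armPt (ang k) t 1 - p 1) ^ 2) * hcs - 2 * (armPt (ang k) t 0 - p 0) * hp0 -
          2 * (armPt (ang k) t 1 - p 1) * hp1
      obtain ⟨h4, h5, h6⟩ := eq_zero_of_tangent hf0 ha hb he1 hd'
      rw [h6, add_zero, ← hp]
      refine Plane.ext ?_ ?_
      · linear_combination c * h4 - σ * h5 - (armPt (ang k) t 0 - p 0) * hcs
      · linear_combination σ * h4 + c * h5 - (armPt (ang k) t 1 - p 1) * hcs
    · rw [ray] at hd'
      have : f - (u - 1000) = 0 := by
        have := sq_nonneg (f - (u - 1000))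
        exact pow_eq_zero_iff two_ne_zero |>.1 (by linarith)
      rw [show u = 1000 + f by linarith]
  · -- here the closest point is the projection to the circle of the arm
    have hs1 : -1 < s x := by
      by_contra! h
      have hc0 : (0 - p 0) * c + (ht (ang k) - p 1) * σ = 0 := by
        linear_combination (-c) * hp0 - σ * hp1
      have h4 : f = l x * (rad (ang k) * Real.sin ((s x + 1) * ang k)) := by
        rw [← along, hf]
        linear_combination c * hxa + σ * hxb + (1 - l x) * hc0
      rcases h.eq_or_lt with h | h
      · rw [h] at h4; simp at h4; linarith
      · have h5 := rad_mul_sin_pos hθ (x := -(s x + 1)) (by linarith) (by linarith [hx1.1])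
        rw [neg_mul, Real.sin_neg, mul_neg] at h5
        have h6 := mul_pos hx2 h5
        linarith
    refine ⟨armPt (ang k) (s x), arm_subset_curve k ⟨s x, ⟨hs1.le, by linarith [hx1.2]⟩, rfl⟩, ?_⟩
    intro q hq hqN hd
    rcases hNC q hq hqN with ⟨t, -, rfl⟩ | ⟨u, hu, rfl⟩
    · exact eq_of_dist_le_of_circle hx2 hxa hxb circle_armPt hd
    · have h4 : dist x p ≤ dist x (shift (pt k u 0)) := by
        refine (pow_le_pow_iff_left₀ dist_nonneg dist_nonneg two_ne_zero).1 ?_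
        rw [hpd, ray]
        linarith [sq_nonneg (u - 1000), mul_nonneg hf0.le (sub_nonneg.2 hu)]
      have h5 : p = armPt (ang k) (s x) :=
        eq_of_dist_le_of_circle hx2 hxa hxb (hcirc (s x)).symm (h4.trans hd)
      have h6 := pow_le_pow_left₀ dist_nonneg hd 2
      rw [← h5, ray, hpd] at h6
      have h7 : u = 1000 := by
        have := pow_eq_zero_iff two_ne_zero |>.1 (le_antisymm (a := (u - 1000) ^ 2)
          (by linarith [mul_nonneg hf0.le (sub_nonneg.2 hu)]) (sq_nonneg _))
        linarith
      rw [← h5, h7]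

end Junction

/-! ### The sample -/

/-- The reflection in the bisector of the first octant. -/
noncomputable def octantFlip : Plane ≃ᵢ Plane :=
  have h : 2 * (2 * cc * ss) ^ 2 = 1 := by
    have h1 := cc_sq_add_ss_sq
    have h2 := cc_sq_sub_ss_sq
    linear_combination (cc ^ 2 + ss ^ 2 + 1) * h1 - (cc ^ 2 - ss ^ 2 + 2 * cc * ss) * h2
  IsometryEquiv.mk'
    (fun z => !₂[2 * cc * ss * (z 0 + z 1), 2 * cc * ss * (z 0 - z 1)])
    (fun z => !₂[2 * cc * ss * (z 0 + z 1), 2 * cc * ss * (z 0 - z 1)])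
    (fun z => Plane.ext (by simp; linear_combination z 0 * h) (by simp; linear_combination z 1 * h))
    (Isometry.of_dist_eq fun z w => (pow_left_inj₀ dist_nonneg dist_nonneg two_ne_zero).1 (by
      rw [dist_sq_eq, dist_sq_eq]; simp
      linear_combination ((z 0 - w 0) ^ 2 + (z 1 - w 1) ^ 2) * h))

lemma max_min_abs_octantFlip (z : Plane) :
    max |octantFlip z 0| |octantFlip z 1| = 2 * cc * ss * (max |z 0| |z 1| + min |z 0| |z 1|) ∧
    min |octantFlip z 0| |octantFlip z 1| = 2 * cc * ss * (max |z 0| |z 1| - min |z 0| |z 1|) := by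
  have h : 0 < 2 * cc * ss := by have := cc_pos; have := ss_pos; positivity
  have e0 : octantFlip z 0 = 2 * cc * ss * (z 0 + z 1) := rfl
  have e1 : octantFlip z 1 = 2 * cc * ss * (z 0 - z 1) := rfl
  rw [e0, e1, abs_mul (2 * cc * ss), abs_mul (2 * cc * ss), abs_of_pos h, ← mul_max_of_nonneg _ _ h.le,
    ← mul_min_of_nonneg _ _ h.le]
  generalize z 0 = x
  generalize z 1 = y
  constructor <;> congr 1 <;>
  · rcases abs_cases x with ⟨hx, hx'⟩ | ⟨hx, hx'⟩ <;> rcases abs_cases y with ⟨hy, hy'⟩ | ⟨hy, hy'⟩ <;>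
    rcases abs_cases (x + y) with ⟨hs, hs'⟩ | ⟨hs, hs'⟩ <;>
    rcases abs_cases (x - y) with ⟨hd, hd'⟩ | ⟨hd, hd'⟩ <;>
    rw [hx, hy, hs, hd] <;> grind

lemma uco_octantFlip (z : Plane) : uco (octantFlip z) = uco z := by
  obtain ⟨h1, h2⟩ := max_min_abs_octantFlip z
  rw [uco, uco, h1, h2]
  have e1 := cc_sq_add_ss_sq
  have e2 := cc_sq_sub_ss_sq
  generalize max |z 0| |z 1| = M
  generalize min |z 0| |z 1| = m
  linear_combination (M * cc + m * ss) * e1 + (m * ss - M * cc) * e2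

lemma vco_octantFlip (z : Plane) : vco (octantFlip z) = -vco z := by
  obtain ⟨h1, h2⟩ := max_min_abs_octantFlip z
  rw [vco, vco, h1, h2]
  have e1 := cc_sq_add_ss_sq
  have e2 := cc_sq_sub_ss_sq
  generalize max |z 0| |z 1| = M
  generalize min |z 0| |z 1| = m
  linear_combination (M * ss - m * cc) * e1 + (M * ss + m * cc) * e2

section Sample

variable {ε δ : ℝ}

/-- Up to an isometry, every crossing looks like the one formed by `strands`. -/
lemma exists_frame (hε : IsSign ε) :
    ∃ φ : Plane ≃ᵢ Plane, ∀ z, uco (φ z) = uco z ∧ vco (φ z) = ε * vco z := by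
  rcases hε with rfl | rfl
  · exact ⟨IsometryEquiv.refl _, fun z => ⟨rfl, by rw [one_mul]; rfl⟩⟩
  · exact ⟨octantFlip, fun z => ⟨uco_octantFlip z, by rw [vco_octantFlip]; ring⟩⟩

/-- In a suitable frame around the left place, the curves agree with `strands`. -/
lemma exists_frame_curve (hε : IsSign ε) (hδ : IsSign δ) :
    ∃ φ : Plane ≃ᵢ Plane, (∀ z, uco (φ z) = uco z ∧ vco (φ z) = ε * vco z) ∧
      ∃ C : Set Plane, IsCompact C ∧ (∀ z, dist z 0 < 1000 → (z ∈ C ↔ z ∈ strands)) ∧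
        ∀ z, localFeatureSize (curve ε δ) (shift (φ z)) = localFeatureSize C z := by
  obtain ⟨φ, hφ⟩ := exists_frame hε
  set ψ := φ.trans shift with hψ
  refine ⟨φ, hφ, ψ.symm '' curve ε δ, (isCompact_curve hε hδ).image ψ.symm.continuous, ?_, ?_⟩
  · intro z hz
    have h0 : dist (φ z) 0 = dist z 0 := by
      refine (pow_left_inj₀ dist_nonneg dist_nonneg two_ne_zero).1 ?_
      rw [norm_sq_fold, norm_sq_fold, (hφ z).1, (hφ z).2, mul_pow, hε.sq, one_mul]
    have h1 : z ∈ ψ.symm '' curve ε δ ↔ shift (φ z) ∈ curve ε δ := by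
      constructor
      · rintro ⟨w, hw, rfl⟩
        have : shift (φ (ψ.symm w)) = w := ψ.apply_symm_apply w
        rwa [this]
      · exact fun h => ⟨_, h, ψ.symm_apply_apply z⟩
    rw [h1, shift_mem_curve_iff hε hδ (by linarith), (hφ z).1, (hφ z).2, strands, mem_ofPred_eq]
    have hne : ε ≠ 0 := by rintro rfl; simpa using hε.sq
    exact and_congr_right fun _ => mul_right_inj' hne
  · intro z
    rw [← localFeatureSize_image ψ.symm]
    congr 1
    exact ψ.symm_apply_apply z

lemma localFeatureSize_flip (p : Plane) :
    localFeatureSize (curve δ ε) (flip p) = localFeatureSize (curve ε δ) p := by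
  rw [← flip_image_curve, localFeatureSize_image]

lemma localFeatureSize_strand_pos (hε : IsSign ε) (hδ : IsSign δ) {z : Plane}
    (hz : dist z 0 < 1000) (h : uM ≤ uco z ∧ vco z = ε * prof (uco z)) :
    0 < localFeatureSize (curve ε δ) (shift z) := by
  obtain ⟨φ, hφ, C, hC, hloc, hlfs⟩ := exists_frame_curve hε hδ
  obtain ⟨w, rfl⟩ := φ.surjective z
  have h0 : dist (φ w) 0 = dist w 0 := by
    refine (pow_left_inj₀ dist_nonneg dist_nonneg two_ne_zero).1 ?_
    rw [norm_sq_fold, norm_sq_fold, (hφ w).1, (hφ w).2, mul_pow, hε.sq, one_mul]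
  rw [h0] at hz
  rw [(hφ w).1, (hφ w).2] at h
  have hne : ε ≠ 0 := by rintro rfl; simpa using hε.sq
  rw [hlfs]
  exact localFeatureSize_pos (eventually_notMem_medialAxis_strands hC hloc
    ⟨h.1, mul_left_cancel₀ hne h.2⟩ hz)

/-- The points on the rays at distance `114`, `180` and `258` from the centre. -/
def criticalPoints : Set Plane := {z | (uco z = 114 ∨ uco z = 180 ∨ uco z = 258) ∧ vco z = 0}

lemma finite_criticalPoints : criticalPoints.Finite := by
  have h : criticalPoints ⊆ (fun w : Fin 8 × ℝ => pt w.1 w.2 0) '' (univ ×ˢ {114, 180, 258}) := by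
    rintro z ⟨h1, h2⟩
    obtain ⟨k, hk⟩ := exists_eq_pt z
    rw [h2] at hk
    exact ⟨(k, uco z), ⟨mem_univ _, by simpa using h1⟩, hk.symm⟩
  exact ((finite_univ.prod (by simp)).image _).subset h

/-- The critical part of a crossing is sampled densely enough. -/
lemma exists_criticalPoint (hε : IsSign ε) (hδ : IsSign δ) {z : Plane} (hu : uco z ≤ 258)
    (h : uM ≤ uco z ∧ vco z = ε * prof (uco z)) :
    ∃ s ∈ criticalPoints,
      edist (shift z) (shift s) < ENNReal.ofReal 0.72 * localFeatureSize (curve ε δ) (shift z) := by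
  obtain ⟨φ, hφ, C, hC, hloc, hlfs⟩ := exists_frame_curve hε hδ
  obtain ⟨w, rfl⟩ := φ.surjective z
  rw [(hφ w).1] at hu
  rw [(hφ w).1, (hφ w).2] at h
  have hne : ε ≠ 0 := by rintro rfl; simpa using hε.sq
  obtain ⟨s, hs1, hs2, hs3⟩ := exists_sample_of_strands hC le_rfl hloc
    (p := w) ⟨h.1, mul_left_cancel₀ hne h.2⟩ hu
  refine ⟨φ s, ⟨by rw [(hφ s).1]; exact hs1, by rw [(hφ s).2, hs2, mul_zero]⟩, ?_⟩
  rwa [shift.isometry.edist_eq, φ.isometry.edist_eq, hlfs]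

/-- The parts of the rays outside the critical part of a crossing. -/
noncomputable def rays : Set Plane := ⋃ k, (fun u => pt k u 0) '' Icc 258 1000

/-- The part that all the curves have in common outside the critical parts. -/
noncomputable def tame : Set Plane := (⋃ k, arm k) ∪ (shift '' rays ∪ flip '' (shift '' rays))

lemma isCompact_rays : IsCompact rays :=
  isCompact_iUnion fun k => isCompact_Icc.image
    ((continuous_pt k).comp (f := fun u : ℝ => (u, (0 : ℝ))) (by fun_prop))

lemma isCompact_tame : IsCompact tame := by
  have h := isCompact_rays.image shift.continuous
  exact (isCompact_iUnion isCompact_arm).union (h.union (h.image flip.continuous))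

lemma shift_rays_subset : shift '' rays ⊆ curve ε δ := by
  rintro _ ⟨z, hz, rfl⟩
  obtain ⟨k, u, hu, rfl⟩ := mem_iUnion.1 hz
  exact halfStrand_subset_curve k (mem_image_of_mem _ (halfStrand_of_ge hu.1 hu.2))

lemma flip_image_subset {K : Set Plane} (h : K ⊆ curve δ ε) : flip '' K ⊆ curve ε δ := by
  rw [← flip_image_curve]; exact image_mono h

lemma tame_subset_curve : tame ⊆ curve ε δ := by
  rintro z (h | h | h)
  · obtain ⟨k, hk⟩ := mem_iUnion.1 h
    exact arm_subset_curve k hk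
  · exact shift_rays_subset h
  · exact flip_image_subset shift_rays_subset h

lemma criticalPoint_on_strand {z : Plane} (hz : z ∈ criticalPoints) :
    uM ≤ uco z ∧ vco z = ε * prof (uco z) := by
  obtain ⟨h1, h2⟩ := hz
  have := uM_bounds
  refine ⟨by rcases h1 with h | h | h <;> linarith, by rw [h2, prof_eq_zero h1, mul_zero]⟩

lemma shift_criticalPoints_subset (hε : IsSign ε) (hδ : IsSign δ) :
    shift '' criticalPoints ⊆ curve ε δ := by
  rintro _ ⟨z, hz, rfl⟩
  refine (shift_mem_curve_iff hε hδ ?_).2 (criticalPoint_on_strand hz)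
  obtain ⟨h1, h2⟩ := hz
  have h := norm_sq_fold z
  rw [h2] at h
  have h3 : uco z ^ 2 ≤ 258 ^ 2 := by rcases h1 with h | h | h <;> rw [h] <;> norm_num
  nlinarith [dist_nonneg (x := z) (y := 0)]

/-- The three kinds of points of the curves. -/
lemma curve_cases (hε : IsSign ε) (hδ : IsSign δ) {p : Plane} (hp : p ∈ curve ε δ) :
    (∃ z, p = shift z ∧ dist z 0 < 1000 ∧ uM ≤ uco z ∧ vco z = ε * prof (uco z)) ∨
    (∃ z, p = flip (shift z) ∧ dist z 0 < 1000 ∧ uM ≤ uco z ∧ vco z = δ * prof (uco z)) ∨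
    ∃ k, p ∈ arm k := by
  have key : ∀ {ε}, IsSign ε → ∀ {k z}, z ∈ halfStrand ε k →
      (dist z 0 < 1000 ∧ uM ≤ uco z ∧ vco z = ε * prof (uco z)) ∨ shift z ∈ arm k := by
    intro ε hε k z hz
    obtain ⟨h1, h2⟩ := dist_halfStrand hε hz
    rcases h1.lt_or_eq with h | h
    · exact Or.inl ⟨h, (mem_halfStrand_iff hε h1).1 ⟨k, hz⟩⟩
    · rw [h2 h]
      exact Or.inr (isSimpleArc_arm k).left_mem
  obtain ⟨k, (⟨z, hz, rfl⟩ | h) | ⟨_, ⟨z, hz, rfl⟩, rfl⟩⟩ := mem_iUnion.1 hp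
  · rcases key hε hz with h | h
    · exact Or.inl ⟨z, rfl, h⟩
    · exact Or.inr (Or.inr ⟨k, h⟩)
  · exact Or.inr (Or.inr ⟨k, h⟩)
  · rcases key hδ hz with h | h
    · exact Or.inr (Or.inl ⟨z, rfl, h⟩)
    · refine Or.inr (Or.inr ⟨k, ?_⟩)
      rw [← flip_image_arm]
      exact mem_image_of_mem _ h

lemma localFeatureSize_curve_pos (hε : IsSign ε) (hδ : IsSign δ) {p : Plane}
    (hp : p ∈ curve ε δ) : 0 < localFeatureSize (curve ε δ) p := by
  rcases curve_cases hε hδ hp with ⟨z, rfl, h1, h2⟩ | ⟨z, rfl, h1, h2⟩ | ⟨k, t, ht, rfl⟩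
  · exact localFeatureSize_strand_pos hε hδ h1 h2
  · rw [localFeatureSize_flip]
    exact localFeatureSize_strand_pos hδ hε h1 h2
  · rcases ht.1.eq_or_lt with rfl | h1
    · rw [armPt_left]
      exact localFeatureSize_pos (eventually_notMem_medialAxis_junction hε hδ k)
    rcases ht.2.eq_or_lt with rfl | h2
    · rw [← neg_neg (1 : ℝ), armPt_neg, localFeatureSize_flip, armPt_left]
      exact localFeatureSize_pos (eventually_notMem_medialAxis_junction hδ hε k)
    · exact localFeatureSize_pos (eventually_notMem_medialAxis_arm hε hδ ⟨h1, h2⟩)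

lemma mem_tame_or (hε : IsSign ε) (hδ : IsSign δ) {p : Plane} (hp : p ∈ curve ε δ) :
    p ∈ tame ∨
    (∃ z, p = shift z ∧ uco z ≤ 258 ∧ uM ≤ uco z ∧ vco z = ε * prof (uco z)) ∨
    ∃ z, p = flip (shift z) ∧ uco z ≤ 258 ∧ uM ≤ uco z ∧ vco z = δ * prof (uco z) := by
  have key : ∀ {ε z}, dist z 0 < 1000 → vco z = ε * prof (uco z) → 258 < uco z → z ∈ rays := by
    intro ε z h1 h2 h3
    rw [prof_of_ge h3.le, mul_zero] at h2
    obtain ⟨k, hk⟩ := exists_eq_pt z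
    rw [h2] at hk
    refine mem_iUnion.2 ⟨k, uco z, ⟨h3.le, ?_⟩, hk.symm⟩
    have := norm_sq_fold z
    nlinarith [dist_nonneg (x := z) (y := 0), sq_nonneg (vco z)]
  rcases curve_cases hε hδ hp with ⟨z, rfl, h1, h2, h3⟩ | ⟨z, rfl, h1, h2, h3⟩ | ⟨k, h⟩
  · rcases le_or_gt (uco z) 258 with h | h
    · exact Or.inr (Or.inl ⟨z, rfl, h, h2, h3⟩)
    · exact Or.inl (Or.inr (Or.inl (mem_image_of_mem _ (key h1 h3 h))))
  · rcases le_or_gt (uco z) 258 with h | h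
    · exact Or.inr (Or.inr ⟨z, rfl, h, h2, h3⟩)
    · exact Or.inl (Or.inr (Or.inr (mem_image_of_mem _ (mem_image_of_mem _ (key h1 h3 h)))))
  · exact Or.inl (Or.inl (mem_iUnion.2 ⟨k, h⟩))

/-- There is a finite set that is a `0.72`-sample of all four unions of closed curves. It consists
of the critical points at both places and a finite subset of the common part of the curves. -/
lemma exists_sample : ∃ N : Set Plane, N.Finite ∧ N ⊆ tame ∧ ∀ ε δ, IsSign ε → IsSign δ →
    IsEpsilonSample 0.72 (curve ε δ)
      ((shift '' criticalPoints ∪ flip '' (shift '' criticalPoints)) ∪ N) := by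
  have hd : ∀ ε δ, IsSign ε → IsSign δ →
      ∃ d : ℝ, 0 < d ∧ ∀ p ∈ tame, ENNReal.ofReal d ≤ localFeatureSize (curve ε δ) p :=
    fun ε δ hε hδ => exists_le_localFeatureSize isCompact_tame fun p hp =>
      localFeatureSize_curve_pos hε hδ (tame_subset_curve hp)
  obtain ⟨d, hd0, hd⟩ : ∃ d : ℝ, 0 < d ∧ ∀ ε δ, IsSign ε → IsSign δ → ∀ p ∈ tame,
      ENNReal.ofReal d ≤ localFeatureSize (curve ε δ) p := by
    obtain ⟨d1, h1, h1'⟩ := hd 1 1 isSign_one isSign_one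
    obtain ⟨d2, h2, h2'⟩ := hd 1 (-1) isSign_one isSign_neg_one
    obtain ⟨d3, h3, h3'⟩ := hd (-1) 1 isSign_neg_one isSign_one
    obtain ⟨d4, h4, h4'⟩ := hd (-1) (-1) isSign_neg_one isSign_neg_one
    refine ⟨min (min d1 d2) (min d3 d4), by positivity, ?_⟩
    rintro ε δ (rfl | rfl) (rfl | rfl) p hp
    · exact le_trans (ENNReal.ofReal_le_ofReal (by simp)) (h1' p hp)
    · exact le_trans (ENNReal.ofReal_le_ofReal (by simp)) (h2' p hp)
    · exact le_trans (ENNReal.ofReal_le_ofReal (by simp)) (h3' p hp)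
    · exact le_trans (ENNReal.ofReal_le_ofReal (by simp)) (h4' p hp)
  obtain ⟨N, hNt, hNf, hN⟩ := finite_cover_balls_of_compact isCompact_tame (half_pos hd0)
  refine ⟨N, hNf, hNt, fun ε δ hε hδ => ⟨?_, fun p hp => ?_⟩⟩
  · exact union_subset (union_subset (shift_criticalPoints_subset hε hδ)
      (flip_image_subset (shift_criticalPoints_subset hδ hε))) (hNt.trans tame_subset_curve)
  rcases mem_tame_or hε hδ hp with h | ⟨z, rfl, h1, h2⟩ | ⟨z, rfl, h1, h2⟩
  · obtain ⟨n, hn, hpn⟩ := mem_iUnion₂.1 (hN h)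
    refine lt_of_le_of_lt (Metric.infEDist_le_edist_of_mem (y := n) (Or.inr hn)) ?_
    calc edist p n = ENNReal.ofReal (dist p n) := edist_dist p n
      _ < ENNReal.ofReal (0.72 * d) := by
        rw [ENNReal.ofReal_lt_ofReal_iff_of_nonneg dist_nonneg]
        rw [Metric.mem_ball] at hpn
        linarith
      _ = ENNReal.ofReal 0.72 * ENNReal.ofReal d := ENNReal.ofReal_mul (by norm_num)
      _ ≤ _ := by gcongr; exact hd ε δ hε hδ p h
  · obtain ⟨s, hs, h⟩ := exists_criticalPoint hε hδ h1 h2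
    exact lt_of_le_of_lt (Metric.infEDist_le_edist_of_mem (y := shift s)
      (Or.inl (Or.inl (mem_image_of_mem _ hs)))) h
  · obtain ⟨s, hs, h⟩ := exists_criticalPoint hδ hε h1 h2
    rw [localFeatureSize_flip]
    refine lt_of_le_of_lt (Metric.infEDist_le_edist_of_mem (y := flip (shift s))
      (Or.inl (Or.inr (mem_image_of_mem _ (mem_image_of_mem _ hs))))) ?_
    rwa [flip.isometry.edist_eq]

end Sample

/-! ### Recognizing consecutive sample points -/

section Graph

variable {d : ℕ} {C S V : Set (EuclideanSpace ℝ (Fin d))} {a b : EuclideanSpace ℝ (Fin d)}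

/-- One of two points is the next sample point after the other. -/
def Joined (C S : Set (EuclideanSpace ℝ (Fin d))) (a b : EuclideanSpace ℝ (Fin d)) : Prop :=
  IsNextSamplePoint C S a b ∨ IsNextSamplePoint C S b a

lemma exists_mem_frontier_of_isPreconnected {T : Set (EuclideanSpace ℝ (Fin d))}
    (hT : IsPreconnected T) (hV : IsOpen V) (h1 : (T ∩ V).Nonempty) (h2 : ¬ T ⊆ V) :
    ∃ x ∈ T, x ∈ frontier V := by
  by_contra! h
  refine h2 (hT.subset_left_of_subset_union hV (isClosed_closure (s := V)).isOpen_compl ?_ (fun x hx => ?_) h1)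
  · exact disjoint_compl_right.mono_left subset_closure |>.mono_right subset_rfl
  · by_cases hx' : x ∈ V
    · exact Or.inl hx'
    · refine Or.inr fun hc => h x hx ?_
      rw [hV.frontier_eq]
      exact ⟨hc, hx'⟩

/-- Two points are not joined if they are separated by an open set whose boundary meets the curve
only in sample points. -/
lemma not_joined (hV : IsOpen V) (hCV : ∀ x ∈ C, x ∈ frontier V → x ∈ S) (ha : a ∈ V)
    (hb : b ∉ closure V) : ¬ Joined C S a b := by
  have key : ∀ f : ℝ → EuclideanSpace ℝ (Fin d), Continuous f → (∀ u, f u ∈ C) → ∀ s t, s < t →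
      ((f s = a ∧ f t = b) ∨ (f s = b ∧ f t = a)) → ∃ u ∈ Ioo s t, f u ∈ S := by
    intro f hf hfC s t hst h
    have hT : IsPreconnected (f '' Icc s t) := isPreconnected_Icc.image _ hf.continuousOn
    have hs := mem_image_of_mem f (left_mem_Icc.2 hst.le)
    have ht := mem_image_of_mem f (right_mem_Icc.2 hst.le)
    have hbV : b ∉ V := fun h => hb (subset_closure h)
    have haF : a ∉ frontier V := by rw [hV.frontier_eq]; exact fun h => h.2 ha
    have hbF : b ∉ frontier V := fun h => hb (frontier_subset_closure h)
    obtain ⟨x, ⟨u, hu, rfl⟩, hx⟩ := exists_mem_frontier_of_isPreconnected hT hV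
      (by rcases h with ⟨h1, h2⟩ | ⟨h1, h2⟩
          · exact ⟨a, h1 ▸ hs, ha⟩
          · exact ⟨a, h2 ▸ ht, ha⟩)
      (fun h' => hbV (by
        rcases h with ⟨h1, h2⟩ | ⟨h1, h2⟩
        · exact h2 ▸ h' ht
        · exact h1 ▸ h' hs))
    refine ⟨u, ⟨lt_of_le_of_ne hu.1 ?_, lt_of_le_of_ne hu.2 ?_⟩, hCV _ (hfC u) hx⟩
    · rintro rfl
      rcases h with ⟨h1, -⟩ | ⟨h1, -⟩ <;> rw [h1] at hx
      exacts [haF hx, hbF hx]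
    · rintro rfl
      rcases h with ⟨-, h1⟩ | ⟨-, h1⟩ <;> rw [h1] at hx
      exacts [hbF hx, haF hx]
  rintro (⟨-, -, γ, ⟨hc, -, hr⟩, s, t, hst, h1, h2, h3⟩ |
    ⟨-, -, γ, ⟨hc, -, hr⟩, s, t, hst, h1, h2, h3⟩)
  · obtain ⟨u, hu, hu'⟩ := key (fun u => γ (Circle.exp u)) (by fun_prop)
      (fun u => connectedComponentIn_subset C a (hr ▸ mem_range_self _)) s t hst (Or.inl ⟨h1, h2⟩)
    exact h3 u hu hu'
  · obtain ⟨u, hu, hu'⟩ := key (fun u => γ (Circle.exp u)) (by fun_prop)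
      (fun u => connectedComponentIn_subset C b (hr ▸ mem_range_self _)) s t hst (Or.inr ⟨h1, h2⟩)
    exact h3 u hu hu'

/-- Two points are joined if they are the only exits of their component from an open set without
sample points. -/
lemma joined_of_exits (hV : IsOpen V) (hVS : ∀ x ∈ V, x ∉ S)
    (hCV : ∀ x ∈ C, x ∈ frontier V → x = a ∨ x = b) (haS : a ∈ S) (hbS : b ∈ S) (hab : a ≠ b)
    (hK : IsClosedCurve (connectedComponentIn C a)) (haK : a ∈ connectedComponentIn C a)
    (hbK : b ∈ connectedComponentIn C a) {m : EuclideanSpace ℝ (Fin d)}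
    (hmK : m ∈ connectedComponentIn C a) (hmV : m ∈ V) : Joined C S a b := by
  obtain ⟨γ, hc, hi, hr⟩ := hK
  set f : ℝ → EuclideanSpace ℝ (Fin d) := fun u => γ (Circle.exp u) with hf
  have hfc : Continuous f := by fun_prop
  have hfC : ∀ u, f u ∈ C := fun u => connectedComponentIn_subset C a (hr ▸ mem_range_self _)
  have hper : ∀ u (n : ℤ), f (u + n * (2 * Real.pi)) = f u := by
    intro u n
    simp only [hf, Circle.periodic_exp.int_mul n u]
  have hpi := Real.two_pi_pos
  -- every point of the component is passed in every interval `[c, c + 2π)`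
  have pass : ∀ x ∈ connectedComponentIn C a, ∀ c : ℝ, ∃ u ∈ Ico c (c + 2 * Real.pi), f u = x := by
    intro x hx c
    rw [← hr] at hx
    obtain ⟨w, rfl⟩ := hx
    obtain ⟨u, rfl⟩ := Circle.exp_surjective w
    obtain ⟨n, hn, -⟩ := existsUnique_add_zsmul_mem_Ico hpi u c
    rw [zsmul_eq_mul] at hn
    exact ⟨_, hn, hper u n⟩
  obtain ⟨u₀, -, hu₀⟩ := pass m hmK 0
  set T : Set ℝ := f ⁻¹' {a, b} with hT
  have hTc : IsClosed T := (Set.toFinite {a, b}).isClosed.preimage hfc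
  have hu₀T : u₀ ∉ T := by
    rintro (h | h)
    · exact hVS m hmV (by rw [← hu₀, h]; exact haS)
    · exact hVS m hmV (by rw [← hu₀, h]; exact hbS)
  have leave : ∀ u v, u ≤ v → u₀ ∈ Icc u v → (∀ w ∈ Icc u v, w ∉ T) → ∀ w ∈ Icc u v, f w ∉ S := by
    intro u v huv h0 hT' w hw hwS
    have hpre : IsPreconnected (f '' Icc u v) := isPreconnected_Icc.image _ hfc.continuousOn
    obtain ⟨x, ⟨y, hy, rfl⟩, hx⟩ := exists_mem_frontier_of_isPreconnected hpre hV
      ⟨f u₀, mem_image_of_mem f h0, hu₀ ▸ hmV⟩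
      (fun h => hVS _ (h (mem_image_of_mem f hw)) hwS)
    exact hT' y hy (hCV _ (hfC y) hx)
  -- the first exit after the inner point, and the last one before it
  obtain ⟨t, ⟨htT, ht0⟩, ht⟩ : ∃ t, IsLeast (T ∩ Ici u₀) t := by
    obtain ⟨u, hu, h⟩ := pass a haK u₀
    refine ⟨_, (hTc.inter isClosed_Ici).csInf_mem ⟨u, Or.inl h, hu.1⟩ ⟨u₀, fun x hx => hx.2⟩,
      fun x hx => csInf_le ⟨u₀, fun x hx => hx.2⟩ hx⟩
  obtain ⟨s, ⟨hsT, hs0⟩, hs⟩ : ∃ s, IsGreatest (T ∩ Iic u₀) s := by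
    obtain ⟨u, hu, h⟩ := pass a haK (u₀ - 2 * Real.pi)
    refine ⟨_, (hTc.inter isClosed_Iic).csSup_mem ⟨u, Or.inl h, by
        have := hu.2; simp only [mem_Iic]; linarith⟩
      ⟨u₀, fun x hx => hx.2⟩, fun x hx => le_csSup ⟨u₀, fun x hx => hx.2⟩ hx⟩
  have hs0' : s < u₀ := lt_of_le_of_ne hs0 (by rintro rfl; exact hu₀T hsT)
  have ht0' : u₀ < t := lt_of_le_of_ne ht0 (by rintro rfl; exact hu₀T htT)
  have inner : ∀ w ∈ Ioo s t, w ∉ T := by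
    intro w hw hwT
    rcases le_total u₀ w with h | h
    · exact absurd (ht ⟨hwT, h⟩) (not_le.2 hw.2)
    · exact absurd (hs ⟨hwT, h⟩) (not_le.2 hw.1)
  have innerS : ∀ w ∈ Ioo s t, f w ∉ S := by
    intro w hw
    refine leave (min u₀ w) (max u₀ w) min_le_max ⟨min_le_left _ _, le_max_left _ _⟩ ?_ w
      ⟨min_le_right _ _, le_max_right _ _⟩
    intro y hy
    exact inner y ⟨lt_of_lt_of_le (lt_min hs0' hw.1) hy.1,
      lt_of_le_of_lt hy.2 (max_lt ht0' hw.2)⟩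
  have hne : f s ≠ f t := by
    intro h
    -- otherwise the whole component is traversed, and both exits are found at the same point
    have hlen : 2 * Real.pi ≤ t - s := by
      by_contra! hlt
      have := Circle.exp_injOn_Icc hlt (left_mem_Icc.2 (hs0.trans ht0))
        (right_mem_Icc.2 (hs0.trans ht0)) (hi h)
      linarith
    have all : ∀ x ∈ connectedComponentIn C a, x = a ∨ x = b → x = f s := by
      intro x hx hxab
      obtain ⟨u, hu, rfl⟩ := pass x hx s
      rcases hu.1.eq_or_lt with rfl | h1
      · rfl
      · exact absurd hxab (inner u ⟨h1, by linarith [hu.2]⟩)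
    exact hab ((all a haK (Or.inl rfl)).trans (all b hbK (Or.inr rfl)).symm)
  have hst : s < t := hs0'.trans ht0'
  rcases hsT with h1 | h1 <;> rcases htT with h2 | h2
  · exact absurd (h1.trans h2.symm) hne
  · exact Or.inl ⟨haS, hbS, γ, ⟨hc, hi, hr⟩, s, t, hst, h1, h2, innerS⟩
  · exact Or.inr ⟨hbS, haS, γ, ⟨hc, hi, by rw [hr, connectedComponentIn_eq hbK]⟩, s, t, hst, h1, h2,
      innerS⟩
  · exact absurd (h1.trans h2.symm) hne

lemma IsNextSamplePoint.image (φ : EuclideanSpace ℝ (Fin d) ≃ᵢ EuclideanSpace ℝ (Fin d))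
    (hC : a ∈ C) (h : IsNextSamplePoint C S a b) :
    IsNextSamplePoint (φ '' C) (φ '' S) (φ a) (φ b) := by
  obtain ⟨ha, hb, γ, ⟨hc, hi, hr⟩, s, t, hst, h1, h2, h3⟩ := h
  refine ⟨mem_image_of_mem _ ha, mem_image_of_mem _ hb, φ ∘ γ,
    ⟨φ.continuous.comp hc, φ.injective.comp hi, ?_⟩, s, t, hst, ?_, ?_, ?_⟩
  · have := φ.toHomeomorph.image_connectedComponentIn hC
    rw [range_comp, hr]
    exact this
  · simp only [Function.comp_apply, h1]
  · simp only [Function.comp_apply, h2]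
  · intro u hu h
    exact h3 u hu (φ.injective.mem_set_image.1 h)

lemma joined_of_adj_iff {C' : Set (EuclideanSpace ℝ (Fin d))}
    (h : reconstructionGraph C S = reconstructionGraph C' S) (ha : a ∈ S) (hb : b ∈ S)
    (hab : a ≠ b) : Joined C S a b ↔ Joined C' S a b := by
  have h' := congrArg (fun G : SimpleGraph S => G.Adj ⟨a, ha⟩ ⟨b, hb⟩) h
  have hne : (⟨a, ha⟩ : S) ≠ ⟨b, hb⟩ := fun e => hab (congrArg Subtype.val e)
  simpa [reconstructionGraph, hne, hab, Joined] using h'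

end Graph

/-! ### The four graphs differ -/

section Crossing

variable {ε δ : ℝ}

/-- The sample that consists of the critical points at both places and a set `N`. -/
noncomputable def sampleSet (N : Set Plane) : Set Plane :=
  (shift '' criticalPoints ∪ flip '' (shift '' criticalPoints)) ∪ N

lemma flip_image_sampleSet (N : Set Plane) : flip '' sampleSet N = sampleSet (flip '' N) := by
  simp only [sampleSet, image_union, flip_image_flip_image]
  rw [union_comm (flip '' _) (shift '' _)]

lemma flip_image_tame : flip '' tame = tame := by
  simp only [tame, image_union, image_iUnion, flip_image_arm, flip_image_flip_image]
  rw [union_comm (flip '' _) (shift '' _)]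

lemma dist_lt_of_uco {z : Plane} (hz : uco z ≤ 258) : dist z 0 < 1000 := by
  obtain ⟨c1, c2⟩ := cc_bounds
  obtain ⟨s1, s2⟩ := ss_bounds
  have h1 := fold_lower z
  have h2 := fold_upper z
  have h0 : 0 ≤ uco z := by
    have : 0 ≤ ss * uco z := by linarith
    exact nonneg_of_mul_nonneg_right this ss_pos
  have h3 : |vco z| ≤ 258 := by
    rw [abs_le]; constructor <;> nlinarith
  have h4 : uco z ^ 2 ≤ 258 ^ 2 := pow_le_pow_left₀ h0 hz 2
  have h5 : vco z ^ 2 ≤ 258 ^ 2 := by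
    rw [← sq_abs (vco z)]; exact pow_le_pow_left₀ (abs_nonneg _) h3 2
  have := norm_sq_fold z
  nlinarith [dist_nonneg (x := z) (y := 0)]

/-- There are no sample points close to the centre of the left crossing. -/
lemma uco_ge_of_mem_sampleSet {N : Set Plane} (hN : N ⊆ tame) {z : Plane}
    (hz : shift z ∈ sampleSet N) : 114 ≤ uco z := by
  by_contra! h
  have hss := ss_pos
  have hd : dist (shift z) place < 1000 := by
    rw [dist_shift_place]; exact dist_lt_of_uco (by linarith)
  have right : ∀ {w : Plane}, dist w 0 ≤ 1000 → shift z ≠ flip (shift w) := by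
    intro w hw e
    have h1 := neg_of_dist_place hd.le
    have h2 := neg_of_dist_place (z := shift w) (by rwa [dist_shift_place])
    rw [e, flip_apply_zero] at h1
    linarith
  have ray : ∀ w ∈ rays, 258 ≤ uco w ∧ dist w 0 ≤ 1000 := by
    intro w hw
    obtain ⟨k, u, hu, rfl⟩ := mem_iUnion.1 hw
    have h0 : 0 ≤ ss * u := mul_nonneg hss.le (by linarith [hu.1])
    simp only
    rw [uco_pt k (by linarith) (by linarith)]
    refine ⟨hu.1, ?_⟩
    have := dist_pt k u 0
    nlinarith [dist_nonneg (x := pt k u 0) (y := 0), hu.1, hu.2]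
  rcases hz with (⟨w, hw, e⟩ | ⟨_, ⟨w, hw, rfl⟩, e⟩) | hz
  · rw [shift.injective e] at hw
    rcases hw.1 with h1 | h1 | h1 <;> linarith
  · refine right (dist_lt_of_uco ?_).le e.symm
    rcases hw.1 with h1 | h1 | h1 <;> linarith
  rcases hN hz with h1 | ⟨w, hw, e⟩ | ⟨_, ⟨w, hw, rfl⟩, e⟩
  · obtain ⟨k, hk⟩ := mem_iUnion.1 h1
    exact absurd (dist_arm hk).1 (not_le.2 hd)
  · rw [shift.injective e] at hw
    linarith [(ray z hw).1]
  · exact right (ray w hw).2 e.symm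

lemma pt_mem_criticalPoints (k : Fin 8) : pt k 114 0 ∈ criticalPoints := by
  have := ss_pos
  exact ⟨Or.inl (uco_pt k (by linarith) (by linarith)), vco_pt k (by linarith) (by linarith)⟩

lemma shift_mem_sampleSet {N : Set Plane} {z : Plane} (hz : z ∈ criticalPoints) :
    shift z ∈ sampleSet N := Or.inl (Or.inl (mem_image_of_mem _ hz))

lemma shift_mem_frontier {W : Set Plane} {z : Plane} (h : shift z ∈ frontier (shift '' W)) :
    z ∈ frontier W := by
  have := shift.toHomeomorph.image_frontier W
  change shift '' _ = frontier (shift '' W) at this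
  rw [← this] at h
  exact shift.injective.mem_set_image.1 h

lemma shift_mem_closure {W : Set Plane} {z : Plane} (h : shift z ∈ closure (shift '' W)) :
    z ∈ closure W := by
  have := shift.toHomeomorph.image_closure W
  change shift '' _ = closure (shift '' W) at this
  rw [← this] at h
  exact shift.injective.mem_set_image.1 h

lemma isOpen_shift_image {W : Set Plane} (h : IsOpen W) : IsOpen (shift '' W) :=
  shift.toHomeomorph.isOpenMap W h

/-- For a crossing in state `-1`, the first sample points on the rays `0` and `7` are not
joined: the first quadrant, cut off at the next sample points, separates them. -/
lemma not_joined_left (hδ : IsSign δ) {N : Set Plane} :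
    ¬ Joined (curve (-1) δ) (sampleSet N) (shift (pt 0 114 0)) (shift (pt 7 114 0)) := by
  have hss := ss_pos
  have hcc := cc_pos
  have hu := continuous_uco
  set W : Set Plane := {z | 0 < z 0 ∧ 0 < z 1 ∧ uco z < 180} with hW
  have hWo : IsOpen W := by
    have e0 : IsOpen {z : Plane | 0 < z 0} := isOpen_lt continuous_const (by fun_prop)
    have e1 : IsOpen {z : Plane | 0 < z 1} := isOpen_lt continuous_const (by fun_prop)
    exact e0.inter (e1.inter (isOpen_lt hu continuous_const))
  have hWc : closure W ⊆ {z | 0 ≤ z 0 ∧ 0 ≤ z 1 ∧ uco z ≤ 180} := by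
    refine closure_minimal (fun z hz => ⟨hz.1.le, hz.2.1.le, hz.2.2.le⟩) ?_
    have e0 : IsClosed {z : Plane | 0 ≤ z 0} := isClosed_le continuous_const (by fun_prop)
    have e1 : IsClosed {z : Plane | 0 ≤ z 1} := isClosed_le continuous_const (by fun_prop)
    exact e0.inter (e1.inter (isClosed_le hu continuous_const))
  refine not_joined (V := shift '' W) (isOpen_shift_image hWo) ?_ ?_ ?_
  · intro x hx hxV
    obtain ⟨z, rfl⟩ := shift.surjective x
    have hzW := shift_mem_frontier hxV
    rw [hWo.frontier_eq] at hzW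
    obtain ⟨h0, h1, h2⟩ := hWc hzW.1
    rw [shift_mem_curve_iff isSign_neg_one hδ (dist_lt_of_uco (by linarith)).le] at hx
    have h3 := prof_upper hx.1
    have h4 : 0 < min |z 0| |z 1| := by rw [min_abs_eq, hx.2]; linarith
    obtain ⟨h5, h6⟩ := lt_min_iff.1 h4
    rw [abs_of_nonneg h0] at h5
    rw [abs_of_nonneg h1] at h6
    have h7 : uco z = 180 := le_antisymm h2 (not_lt.1 fun h => hzW.2 ⟨h5, h6, h⟩)
    refine shift_mem_sampleSet ⟨Or.inr (Or.inl h7), ?_⟩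
    rw [hx.2, prof_eq_zero (Or.inr (Or.inl h7)), mul_zero]
  · refine mem_image_of_mem _ ⟨?_, ?_, ?_⟩
    · rw [pt_zero]; simp [al, be]; positivity
    · rw [pt_one]; simp [ga, de]; positivity
    · rw [uco_pt 0 (by linarith) (by linarith)]; norm_num
  · intro h
    have h1 := (hWc (shift_mem_closure h)).2.1
    rw [pt_one] at h1
    simp [ga, de] at h1
    linarith

lemma eq_pt_of_mem {z : Plane} (hu : uco z = 114) (hv : vco z = 0) (h : |z 1| ≤ z 0) :
    z = pt 0 114 0 ∨ z = pt 7 114 0 := by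
  have hss := ss_pos
  have hsc := ss_lt_cc
  obtain ⟨k, hk⟩ := exists_eq_pt z
  rw [hu, hv] at hk
  rw [hk, pt_zero, pt_one, mul_zero, mul_zero, sub_zero, add_zero, abs_le] at h
  fin_cases k
  · exact Or.inl hk
  all_goals first
    | exact Or.inr hk
    | (exfalso; simp [al, be, ga, de] at h; linarith [h.1, h.2])

/-- For a crossing in state `1`, the first sample points on the rays `0` and `7` are joined by a
strand that contains no further sample point. -/
lemma joined_left (hδ : IsSign δ) {N : Set Plane} (hN : N ⊆ tame) :
    Joined (curve 1 δ) (sampleSet N) (shift (pt 0 114 0)) (shift (pt 7 114 0)) := by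
  have hss := ss_pos
  have hsc := ss_lt_cc
  have hM := uM_bounds
  have hu := continuous_uco
  set W : Set Plane := {z | |z 1| < z 0 ∧ uco z < 114} with hW
  have hWo : IsOpen W := by
    have e0 : IsOpen {z : Plane | |z 1| < z 0} := isOpen_lt (by fun_prop) (by fun_prop)
    exact e0.inter (isOpen_lt hu continuous_const)
  have hWc : closure W ⊆ {z | |z 1| ≤ z 0 ∧ uco z ≤ 114} := by
    refine closure_minimal (fun z hz => ⟨hz.1.le, hz.2.le⟩) ?_
    have e0 : IsClosed {z : Plane | |z 1| ≤ z 0} := isClosed_le (by fun_prop) (by fun_prop)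
    exact e0.inter (isClosed_le hu continuous_const)
  have hmem : ∀ k, pt k 114 0 ∈ halfStrand 1 k := fun k =>
    ⟨114, ⟨by linarith, by norm_num⟩, by simp only [prof_eq_zero (Or.inl rfl), mul_zero]⟩
  have hL : ∀ k, shift (pt k 114 0) ∈ longArm 1 δ k := fun k =>
    Or.inl (Or.inl (mem_image_of_mem _ (hmem k)))
  have hsub : ∀ k, longArm 1 δ k ⊆ curve 1 δ := fun k => subset_iUnion _ k
  have haC : shift (pt 0 114 0) ∈ curve 1 δ := hsub 0 (hL 0)
  have hm : shift (midpt 1 0) ∈ connectedComponentIn (curve 1 δ) (shift (pt 0 114 0)) :=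
    (isSimpleArc_longArm isSign_one hδ 0).isPreconnected.subset_connectedComponentIn (hL 0)
      (hsub 0) (isSimpleArc_longArm isSign_one hδ 0).left_mem
  refine joined_of_exits (V := shift '' W) (m := shift (midpt 1 0)) (isOpen_shift_image hWo) ?_ ?_
    (shift_mem_sampleSet (pt_mem_criticalPoints 0)) (shift_mem_sampleSet (pt_mem_criticalPoints 7))
    ?_ (isClosedCurve_connectedComponentIn isSign_one hδ haC) (mem_connectedComponentIn haC) ?_ hm ?_
  · rintro _ ⟨z, hz, rfl⟩ hzS
    exact absurd (uco_ge_of_mem_sampleSet hN hzS) (not_le.2 hz.2)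
  · intro x hx hxV
    obtain ⟨z, rfl⟩ := shift.surjective x
    have hzW := shift_mem_frontier hxV
    rw [hWo.frontier_eq] at hzW
    obtain ⟨h0, h1⟩ := hWc hzW.1
    rw [shift_mem_curve_iff isSign_one hδ (dist_lt_of_uco (by linarith)).le, one_mul] at hx
    have h2 : |z 1| < z 0 := by
      have h3 := prof_upper hx.1
      rw [← hx.2, fold_upper_pos_iff] at h3
      rw [abs_of_nonneg (a := z 0) (le_trans (abs_nonneg _) h0), max_eq_left h0,
        min_eq_right h0] at h3
      exact h3
    have h4 : uco z = 114 := le_antisymm h1 (not_lt.1 fun h => hzW.2 ⟨h2, h⟩)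
    have h5 : vco z = 0 := by rw [hx.2, prof_eq_zero (Or.inl h4)]
    rcases eq_pt_of_mem h4 h5 h0 with h | h
    · exact Or.inl (by rw [h])
    · exact Or.inr (by rw [h])
  · intro h
    exact absurd (pt_injective (by linarith) (by linarith) (shift.injective h)) (by decide)
  · have h7 := isSimpleArc_longArm isSign_one hδ 7
    rw [connectedComponentIn_eq hm]
    refine h7.isPreconnected.subset_connectedComponentIn ?_ (hsub 7) (hL 7)
    rw [midpt_eq_iff.2 (show strandNo 0 = strandNo 7 by decide)]
    exact h7.left_mem
  · refine mem_image_of_mem _ ⟨?_, ?_⟩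
    · have h1 := prof_lower_uM
      have h2 := octant_lt (prof_upper le_rfl)
      rw [midpt, pt_zero, pt_one, one_mul]
      simp only [al, be, ga, de, Matrix.cons_val_zero, zero_mul, one_mul, zero_add, add_zero]
      rw [h1, abs_zero]
      linarith
    · rw [midpt, uco_pt 0 (state_lower isSign_one le_rfl) (state_upper isSign_one le_rfl)]
      linarith

lemma joined_left_iff (hε : IsSign ε) (hδ : IsSign δ) {N : Set Plane} (hN : N ⊆ tame) :
    Joined (curve ε δ) (sampleSet N) (shift (pt 0 114 0)) (shift (pt 7 114 0)) ↔ ε = 1 := by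
  rcases hε with rfl | rfl
  · exact ⟨fun _ => rfl, fun _ => joined_left hδ hN⟩
  · exact ⟨fun h => absurd h (not_joined_left hδ), fun h => by norm_num at h⟩

lemma Joined.flip {N : Set Plane} {a b : Plane} (ha : a ∈ curve ε δ) (hb : b ∈ curve ε δ)
    (h : Joined (curve ε δ) (sampleSet N) a b) :
    Joined (curve δ ε) (sampleSet (CurveReconstruction.flip '' N)) (CurveReconstruction.flip a)
      (CurveReconstruction.flip b) := by
  rw [← flip_image_sampleSet, ← flip_image_curve]
  exact h.imp (fun h => h.image _ ha) (fun h => h.image _ hb)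

lemma joined_right_iff (hε : IsSign ε) (hδ : IsSign δ) {N : Set Plane} (hN : N ⊆ tame) :
    Joined (curve ε δ) (sampleSet N) (flip (shift (pt 0 114 0))) (flip (shift (pt 7 114 0))) ↔
      δ = 1 := by
  have hN' : flip '' N ⊆ tame := by rw [← flip_image_tame]; exact image_mono hN
  have mem : ∀ k, shift (pt k 114 0) ∈ curve δ ε := fun k =>
    shift_criticalPoints_subset hδ hε (mem_image_of_mem _ (pt_mem_criticalPoints k))
  have mem' : ∀ k, flip (shift (pt k 114 0)) ∈ curve ε δ := fun k => by
    rw [← flip_image_curve]; exact mem_image_of_mem _ (mem k)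
  rw [← joined_left_iff hδ hε hN']
  constructor
  · intro h
    have := h.flip (mem' 0) (mem' 7)
    rwa [flip_flip, flip_flip] at this
  · intro h
    have := h.flip (mem 0) (mem 7)
    rwa [flip_image_flip_image] at this

/-- The reconstruction graph determines the states of both crossings. -/
lemma states_eq_of_graph_eq {ε' δ' : ℝ} (hε : IsSign ε) (hδ : IsSign δ) (hε' : IsSign ε')
    (hδ' : IsSign δ') {N : Set Plane} (hN : N ⊆ tame)
    (h : reconstructionGraph (curve ε δ) (sampleSet N) =
      reconstructionGraph (curve ε' δ') (sampleSet N)) : ε = ε' ∧ δ = δ' := by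
  have hss := ss_pos
  have hne : pt 0 114 0 ≠ pt 7 114 0 := fun e =>
    absurd (pt_injective (by linarith) (by linarith) e) (by decide)
  have mem : ∀ k, shift (pt k 114 0) ∈ sampleSet N := fun k =>
    shift_mem_sampleSet (pt_mem_criticalPoints k)
  have mem' : ∀ k, flip (shift (pt k 114 0)) ∈ sampleSet N := fun k =>
    Or.inl (Or.inr (mem_image_of_mem _ (mem_image_of_mem _ (pt_mem_criticalPoints k))))
  have h1 := joined_of_adj_iff h (mem 0) (mem 7) (shift.injective.ne hne)
  have h2 := joined_of_adj_iff h (mem' 0) (mem' 7) (flip.injective.ne (shift.injective.ne hne))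
  rw [joined_left_iff hε hδ hN, joined_left_iff hε' hδ' hN] at h1
  rw [joined_right_iff hε hδ hN, joined_right_iff hε' hδ' hN] at h2
  have key : ∀ {x y : ℝ}, IsSign x → IsSign y → (x = 1 ↔ y = 1) → x = y := by
    rintro x y (rfl | rfl) (rfl | rfl) h <;> first | rfl | (exfalso; norm_num at h)
  exact ⟨key hε hε' h1, key hδ hδ' h2⟩

end Crossing

/-- There is a sample common to two closed curves and two disconnected unions of closed curves whose
graphs are pairwise distinct. -/
lemma exists_sample_of_four_curves :
    ∃ (S : Set Plane) (C : Fin 4 → Set Plane),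
      S.Finite ∧
      (∀ i, IsEpsilonSample 0.72 (C i) S) ∧
      IsClosedCurve (C 0) ∧
      IsClosedCurve (C 1) ∧
      IsDisconnectedUnionOfClosedCurves (C 2) ∧
      IsDisconnectedUnionOfClosedCurves (C 3) ∧
      ∀ i j, i ≠ j →
        reconstructionGraph (C i) S ≠ reconstructionGraph (C j) S := by
  obtain ⟨N, hNf, hN, hS⟩ := exists_sample
  have hε : ∀ i : Fin 4, IsSign ((![1, -1, 1, -1] : Fin 4 → ℝ) i) := by
    intro i; fin_cases i <;> simp [IsSign]
  have hδ : ∀ i : Fin 4, IsSign ((![-1, 1, 1, -1] : Fin 4 → ℝ) i) := by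
    intro i; fin_cases i <;> simp [IsSign]
  refine ⟨sampleSet N, fun i => curve ((![1, -1, 1, -1] : Fin 4 → ℝ) i)
    ((![-1, 1, 1, -1] : Fin 4 → ℝ) i), ?_, fun i => hS _ _ (hε i) (hδ i), isClosedCurve_curve,
    isClosedCurve_curve', isDisconnected_curve isSign_one, isDisconnected_curve isSign_neg_one,
    ?_⟩
  · have h := finite_criticalPoints.image shift
    exact (h.union (h.image flip)).union hNf
  · intro i j hij h
    obtain ⟨h1, h2⟩ := states_eq_of_graph_eq (hε i) (hδ i) (hε j) (hδ j) hN h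
    refine hij ?_
    clear h hij
    fin_cases i <;> fin_cases j <;>
      first | rfl | (exfalso; norm_num at h1; done) | (exfalso; norm_num at h2)

end CurveReconstruction

theorem mainTheorem3 :
    (∃ (S : Set (EuclideanSpace ℝ (Fin 2))) (C : Fin 4 → Set (EuclideanSpace ℝ (Fin 2))),
      S.Finite ∧
      (∀ i, CurveReconstruction.IsEpsilonSample 0.72 (C i) S) ∧
      CurveReconstruction.IsClosedCurve (C 0) ∧
      CurveReconstruction.IsClosedCurve (C 1) ∧
      CurveReconstruction.IsDisconnectedUnionOfClosedCurves (C 2) ∧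
      CurveReconstruction.IsDisconnectedUnionOfClosedCurves (C 3) ∧
      ∀ i j, i ≠ j →
        CurveReconstruction.reconstructionGraph (C i) S ≠
          CurveReconstruction.reconstructionGraph (C j) S) ∧
    ¬ ∃ R : (S : Set (EuclideanSpace ℝ (Fin 2))) → SimpleGraph S,
      ∀ C S : Set (EuclideanSpace ℝ (Fin 2)),
        CurveReconstruction.IsClosedCurve C → S.Finite →
        CurveReconstruction.IsEpsilonSample 0.72 C S →
          R S = CurveReconstruction.reconstructionGraph C S := by
  have main := CurveReconstruction.exists_sample_of_four_curves
  refine ⟨main, ?_⟩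
  rintro ⟨R, hR⟩
  obtain ⟨S, C, hS, hC, h0, h1, -, -, hne⟩ := main
  exact hne 0 1 (by decide) ((hR _ S h0 hS (hC 0)).symm.trans (hR _ S h1 hS (hC 1)))
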